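/- For $1<s\le 2$ let $T_s:[0,1]\to[0,1]$ be the tent map $T_s(x)=sx+2-s$ for $0\le x\le c_s$, $T_s(x)=-sx+s$ for $c_s\le x\le 1$, with critical point $c_s=\frac{s-1}{s}$, and let $\varprojlim T_s=\{(x_0,x_1,\dots)\in[0,1]^{\mathbb N}: T_s(x_{k})=x_{k-1}\text{ for }k\ge 1\}$ with the topology inherited from the product. Let $\mathcal P$ be the set of $s\in(1,2]$ for which $c_s$ is periodic under $T_s$. For $n\ge1$ let $\mathcal A_n=\{a_1,\dots,a_n,\bar a_1,\dots,\bar a_n\}$, let $\mathcal W(\mathcal A_n)$ be the set of finite nonempty words in $\mathcal A_n$, and put $\bar{\bar a}_i=a_i$ and $\overline{b_1\cdots b_k}=\bar b_k\cdots\bar b_1$. A substitution is here a map $\tau:\mathcal A_n\to\mathcal W(\mathcal A_m)$ with $\tau(\bar b)=\overline{\tau(b)}$ for all $b\in\mathcal A_n$; it is extended to words by concatenation. Substitutions $\chi:\mathcal A_n\to\mathcal W(\mathcal A_n)$ and $\psi:\mathcal A_m\to\mathcal W(\mathcal A_m)$ are weakly equivalent, $\chi\sim_w\psi$, if there are positive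 integers $n_i,m_i$ and substitutions $\sigma_i:\mathcal A_m\to\mathcal W(\mathcal A_n)$, $\tau_i:\mathcal A_n\to\mathcal W(\mathcal A_m)$, $i=1,2,\dots$, such that $\sigma_i\circ\tau_i=\chi^{n_i}$ and $\tau_i\circ\sigma_{i+1}=\psi^{m_i}$ for all $i\ge1$. For $s\in\mathcal P$ let $n+1$ be the least period of $c_s$, let $x_0<x_1<\dots<x_n$ be the points of its orbit (so $x_0=0$, $x_n=1$), and let $J_i=[x_{i-1},x_i]$ for $1\le i\le n$. Each $T_s(J_i)$ is a union $J_\ell\cup J_{\ell+1}\cup\dots\cup J_{\ell+k}$, and $T_s$ is monotone on $J_i$. Let $\chi_s:\mathcal A_n\to\mathcal W(\mathcal A_n)$ be the substitution with $\chi_s(a_i)=a_\ell a_{\ell+1}\cdots a_{\ell+k}$ if $T_s$ is increasing on $J_i$, $\chi_s(a_i)=\bar a_{\ell+k}\cdots\bar a_\ell$ if $T_s$ is decreasing on $J_i$, and $\chi_s(\bar a_i)=\overline{\chi_s(a_i)}$. **Theorem.** Let $s_1,s_2\in\mathcal P$. Then $\varprojlim T_{s_1}$ and $\varprojlim T_{s_2}$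 are homeomorphic if and only if $\chi_{s_1}\sim_w\chi_{s_2}$. -/

import Mathlib

/-! ## Words and substitutions -/

/-- The alphabet `𝒜ₙ = {a₁, …, aₙ, ā₁, …, āₙ}`: `(i, true)` is the letter `aᵢ₊₁` and `(i, false)` is
the letter `āᵢ₊₁` (`i = 0, …, n - 1`). -/
abbrev Letter (n : ℕ) : Type := Fin n × Bool

/-- The involution `a ↦ ā` on letters. -/
def Letter.bar {n : ℕ} (a : Letter n) : Letter n := (a.1, !a.2)

/-- The bar of a word: reverse it and bar each letter, `b₁ … bₖ ↦ b̄ₖ … b̄₁`. -/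
def barWord {n : ℕ} (w : List (Letter n)) : List (Letter n) := (w.map Letter.bar).reverse

/-- A substitution `𝒜ₙ → 𝒲(𝒜ₘ)`, compatible with bar: every letter is sent to a nonempty finite
word, and the word of `ā` is the bar of the word of `a`. -/
structure Substitution (n m : ℕ) where
  toFun : Letter n → List (Letter m)
  ne_nil : ∀ a, toFun a ≠ []
  map_bar : ∀ a, toFun a.bar = barWord (toFun a)

/-- The extension of a substitution to words by concatenation,
`σ(c₁ … cₗ) = σ(c₁) … σ(cₗ)`. -/
def Substitution.ext {n m : ℕ} (σ : Substitution n m) (w : List (Letter n)) : List (Letter m) :=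
  w.flatMap σ.toFun

/-- Weak equivalence `χ ∼_w ψ` of substitutions: there are positive integers `nᵢ`, `mᵢ` and
substitutions `σᵢ : 𝒜ₘ → 𝒲(𝒜ₙ)`, `τᵢ : 𝒜ₙ → 𝒲(𝒜ₘ)` (all compatible with bar) such that, on words,
`σᵢ ∘ τᵢ = χ ^ nᵢ` and `τᵢ ∘ σᵢ₊₁ = ψ ^ mᵢ` for every `i`. -/
def WeaklyEquivalent {n m : ℕ} (χ : Substitution n n) (ψ : Substitution m m) : Prop :=
  ∃ (N M : ℕ → ℕ) (σ : ℕ → Substitution m n) (τ : ℕ → Substitution n m),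
    (∀ i, 0 < N i) ∧ (∀ i, 0 < M i) ∧
    (∀ i, (σ i).ext ∘ (τ i).ext = χ.ext^[N i]) ∧
    (∀ i, (τ i).ext ∘ (σ (i + 1)).ext = ψ.ext^[M i])

/-! ## Tent maps and their inverse limits -/

/-- The critical point `c_s = (s - 1) / s` of the tent map `T_s`. -/
noncomputable def tentCrit (s : ℝ) : ℝ := (s - 1) / s

/-- The tent map `T_s`: `s x + 2 - s` for `x ≤ c_s` and `-s x + s` for `x ≥ c_s`. For `1 < s ≤ 2` it
maps `[0, 1]` onto itself, and it is only used on `[0, 1]`. -/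
noncomputable def tentMap (s x : ℝ) : ℝ :=
  if x ≤ tentCrit s then s * x + 2 - s else -s * x + s

/-- The inverse limit of `T_s : [0, 1] → [0, 1]`: the sequences `(x₀, x₁, …)` in `[0, 1]` with
`T_s (xₖ₊₁) = xₖ`; as a subset of `ℕ → ℝ` it carries the topology inherited from the product. -/
def tentInverseLimit (s : ℝ) : Set (ℕ → ℝ) :=
  {x | (∀ k, x k ∈ Set.Icc (0 : ℝ) 1) ∧ ∀ k, tentMap s (x (k + 1)) = x k}

/-- The parameters `s ∈ (1, 2]` for which the critical point `c_s` is periodic under `T_s`. -/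
def periodicTentParams : Set ℝ :=
  {s | 1 < s ∧ s ≤ 2 ∧ tentCrit s ∈ Function.periodicPts (tentMap s)}

/-- The number `n`, where `n + 1` is the (least) period of `c_s` under `T_s`. -/
noncomputable def tentSize (s : ℝ) : ℕ := Function.minimalPeriod (tentMap s) (tentCrit s) - 1

/-- The orbit of the critical point, as a finite set. -/
noncomputable def tentOrbit (s : ℝ) : Finset ℝ :=
  (Finset.range (Function.minimalPeriod (tentMap s) (tentCrit s))).image
    fun k => (tentMap s)^[k] (tentCrit s)

theorem tentOrbit_card {s : ℝ} (hs : s ∈ periodicTentParams) :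
    (tentOrbit s).card = tentSize s + 1 := by
  have hpos := Function.minimalPeriod_pos_of_mem_periodicPts hs.2.2
  rw [tentOrbit, Finset.card_image_of_injOn, Finset.card_range, tentSize]
  · omega
  · intro a ha b hb h
    simp only [Finset.coe_range, Set.mem_Iio] at ha hb
    exact Function.iterate_injOn_Iio_minimalPeriod ha hb h

/-- The points `x₀ < x₁ < … < xₙ` of the orbit of `c_s`, in increasing order. -/
noncomputable def tentPoint (s : ℝ) (hs : s ∈ periodicTentParams) : Fin (tentSize s + 1) ↪o ℝ :=
  (tentOrbit s).orderEmbOfFin (tentOrbit_card hs)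

/-- The `n` intervals `[xᵢ₋₁, xᵢ]` into which the orbit of `c_s` divides `[0, 1]`. -/
noncomputable def tentInterval (s : ℝ) (hs : s ∈ periodicTentParams) (i : Fin (tentSize s)) :
    Set ℝ :=
  Set.Icc (tentPoint s hs i.castSucc) (tentPoint s hs i.succ)

open Classical in
/-- The positively oriented letters `aₗ aₗ₊₁ … aₗ₊ₖ`, in increasing order, of the intervals of which
`T_s(Jᵢ)` is the union. -/
noncomputable def tentBlock (s : ℝ) (hs : s ∈ periodicTentParams) (i : Fin (tentSize s)) :
    List (Letter (tentSize s)) :=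
  ((List.finRange (tentSize s)).filter
    fun l => tentInterval s hs l ⊆ tentMap s '' tentInterval s hs i).map fun l => (l, true)

open Classical in
/-- The word `χ_s(aᵢ)`: the word `aₗ … aₗ₊ₖ` if `T_s` is increasing on `Jᵢ`, and
`āₗ₊ₖ … āₗ` otherwise. -/
noncomputable def tentWord (s : ℝ) (hs : s ∈ periodicTentParams) (i : Fin (tentSize s)) :
    List (Letter (tentSize s)) :=
  if StrictMonoOn (tentMap s) (tentInterval s hs i) then tentBlock s hs i
  else barWord (tentBlock s hs i)

theorem mem_tentOrbit_iff {s : ℝ} (hs : s ∈ periodicTentParams) (x : ℝ) :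
    x ∈ tentOrbit s ↔ ∃ j, tentPoint s hs j = x := by
  have h := Finset.range_orderEmbOfFin (tentOrbit s) (tentOrbit_card hs)
  rw [← Finset.mem_coe, ← h]
  rfl

theorem tentMap_mem_tentOrbit {s : ℝ} (hs : s ∈ periodicTentParams) {x : ℝ}
    (hx : x ∈ tentOrbit s) : tentMap s x ∈ tentOrbit s := by
  have hpos := Function.minimalPeriod_pos_of_mem_periodicPts hs.2.2
  simp only [tentOrbit, Finset.mem_image, Finset.mem_range] at hx ⊢
  obtain ⟨k, -, rfl⟩ := hx
  refine ⟨(k + 1) % Function.minimalPeriod (tentMap s) (tentCrit s), Nat.mod_lt _ hpos, ?_⟩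
  rw [Function.iterate_mod_minimalPeriod_eq, Function.iterate_succ_apply']

/-- On each `Jᵢ` the tent map is either increasing or decreasing, and it maps `Jᵢ` onto an interval
between two points of the orbit, that is, onto a union `Jₗ ∪ … ∪ Jₗ₊ₖ`. -/
theorem tentMap_image_tentInterval {s : ℝ} (hs : s ∈ periodicTentParams) (i : Fin (tentSize s)) :
    (StrictMonoOn (tentMap s) (tentInterval s hs i) ∨
      StrictAntiOn (tentMap s) (tentInterval s hs i)) ∧
    ∃ p q, p < q ∧
      tentMap s '' tentInterval s hs i = Set.Icc (tentPoint s hs p) (tentPoint s hs q) := by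
  have hs0 : 0 < s := by linarith [hs.1]
  have hc : s * tentCrit s = s - 1 := by unfold tentCrit; field_simp
  have hlt : tentPoint s hs i.castSucc < tentPoint s hs i.succ :=
    (tentPoint s hs).strictMono (Fin.castSucc_lt_succ)
  obtain ⟨p, hp⟩ := (mem_tentOrbit_iff hs _).1
    (tentMap_mem_tentOrbit hs ((mem_tentOrbit_iff hs _).2 ⟨i.castSucc, rfl⟩))
  obtain ⟨q, hq⟩ := (mem_tentOrbit_iff hs _).1
    (tentMap_mem_tentOrbit hs ((mem_tentOrbit_iff hs _).2 ⟨i.succ, rfl⟩))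
  have hcm : tentCrit s ∈ tentOrbit s := by
    have hpos := Function.minimalPeriod_pos_of_mem_periodicPts hs.2.2
    exact Finset.mem_image.2 ⟨0, Finset.mem_range.2 hpos, rfl⟩
  obtain ⟨k, hk⟩ := (mem_tentOrbit_iff hs _).1 hcm
  unfold tentInterval
  generalize ha : tentPoint s hs i.castSucc = a at hlt hp ⊢
  generalize hb : tentPoint s hs i.succ = b at hlt hq ⊢
  have hcase : b ≤ tentCrit s ∨ tentCrit s ≤ a := by
    rcases le_or_gt k i.castSucc with h | h
    · right; rw [← hk, ← ha]; exact (tentPoint s hs).monotone h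
    · left; rw [← hk, ← hb]; exact (tentPoint s hs).monotone (show (i : ℕ) + 1 ≤ k from h)
  rcases hcase with h | h
  · have e : ∀ x ∈ Set.Icc a b, tentMap s x = s * x + 2 - s := by
      intro x hx; rw [tentMap, if_pos (hx.2.trans h)]
    have ea := e a ⟨le_rfl, hlt.le⟩
    have eb := e b ⟨hlt.le, le_rfl⟩
    refine ⟨Or.inl ?_, p, q, ?_, ?_⟩
    · intro x hx y hy hxy
      rw [e x hx, e y hy]; nlinarith
    · rw [← (tentPoint s hs).lt_iff_lt, hp, hq, ea, eb]; nlinarith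
    · rw [hp, hq, ea, eb]
      ext y
      constructor
      · rintro ⟨x, hx, rfl⟩
        rw [e x hx]
        constructor <;> nlinarith [hx.1, hx.2]
      · rintro ⟨h1, h2⟩
        have hx : (y - 2 + s) / s ∈ Set.Icc a b := by
          constructor
          · rw [le_div_iff₀ hs0]; nlinarith
          · rw [div_le_iff₀ hs0]; nlinarith
        refine ⟨_, hx, ?_⟩
        rw [e _ hx]; field_simp; ring
  · have e : ∀ x ∈ Set.Icc a b, tentMap s x = -s * x + s := by
      intro x hx
      rw [tentMap]
      split_ifs with hxc
      · have : x = tentCrit s := le_antisymm hxc (h.trans hx.1)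
        subst this; linarith
      · rfl
    have ea := e a ⟨le_rfl, hlt.le⟩
    have eb := e b ⟨hlt.le, le_rfl⟩
    refine ⟨Or.inr ?_, q, p, ?_, ?_⟩
    · intro x hx y hy hxy
      rw [e x hx, e y hy]; nlinarith
    · rw [← (tentPoint s hs).lt_iff_lt, hp, hq, ea, eb]; nlinarith
    · rw [hp, hq, ea, eb]
      ext y
      constructor
      · rintro ⟨x, hx, rfl⟩
        rw [e x hx]
        constructor <;> nlinarith [hx.1, hx.2]
      · rintro ⟨h1, h2⟩
        have hx : (s - y) / s ∈ Set.Icc a b := by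
          constructor
          · rw [le_div_iff₀ hs0]; nlinarith
          · rw [div_le_iff₀ hs0]; nlinarith
        refine ⟨_, hx, ?_⟩
        rw [e _ hx]; field_simp; ring

theorem tentBlock_ne_nil {s : ℝ} (hs : s ∈ periodicTentParams) (i : Fin (tentSize s)) :
    tentBlock s hs i ≠ [] := by
  obtain ⟨-, p, q, hpq, h⟩ := tentMap_image_tentInterval hs i
  have hp : (p : ℕ) < tentSize s := by have := q.2; have : (p : ℕ) < q := hpq; omega
  apply List.ne_nil_of_mem (a := ((⟨p, hp⟩ : Fin (tentSize s)), true))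
  simp only [tentBlock, List.mem_map, List.mem_filter, List.mem_finRange, true_and,
    decide_eq_true_eq]
  refine ⟨⟨p, hp⟩, ?_, rfl⟩
  rw [h]
  exact Set.Icc_subset_Icc le_rfl
    ((tentPoint s hs).monotone (show (p : ℕ) + 1 ≤ q from hpq))

theorem barWord_barWord {n : ℕ} (w : List (Letter n)) : barWord (barWord w) = w := by
  simp [barWord, Letter.bar, Function.comp_def]

theorem tentWord_ne_nil {s : ℝ} (hs : s ∈ periodicTentParams) (i : Fin (tentSize s)) :
    tentWord s hs i ≠ [] := by
  unfold tentWord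
  split_ifs
  · exact tentBlock_ne_nil hs i
  · simpa [barWord] using tentBlock_ne_nil hs i

/-- The substitution `χ_s` associated with `T_s`: `χ_s(aᵢ)` is the word `tentWord`, and `χ_s(āᵢ)` is
its bar. -/
noncomputable def tentSubstitution (s : ℝ) (hs : s ∈ periodicTentParams) :
    Substitution (tentSize s) (tentSize s) where
  toFun a := if a.2 then tentWord s hs a.1 else barWord (tentWord s hs a.1)
  ne_nil := by
    rintro ⟨i, _ | _⟩
    · simpa [barWord] using tentWord_ne_nil hs i
    · simpa using tentWord_ne_nil hs i
  map_bar := by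
    rintro ⟨i, _ | _⟩
    · simp [Letter.bar, barWord_barWord]
    · simp [Letter.bar]

/-!
The orbit `P` of the critical point divides `[0, 1]` into `n` intervals, and `T_s` turns around only
at points of `P`. The theorem compares two ways of passing between the inverse limits: through maps
of the intervals that follow the words of the substitutions, and through the coordinates of a given
homeomorphism. Vertices are the points of `P`, and a path traverses a word `b₁ … b_k` if it runs
successively and injectively along the intervals of its letters, in the indicated directions
(`Traverses`). `T_s^N` traverses `χ_s^N(aᵢ)` on the interval of `aᵢ`.

*From a weak equivalence to a homeomorphism.* If `f` realizes `σ`, a path along `σ(w)` lifts through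
`f` to a path along `w`, provided that consecutive letters of `w` fit together (`IsLegal`). Starting
from any realization of `τ₀`, one lifts alternately to get maps `pᵢ`, `qᵢ` that realize `τᵢ`, `σᵢ₊₁`
with `pᵢ ∘ qᵢ` and `qᵢ ∘ pᵢ₊₁` exactly equal to iterates of the two tent maps. Such a ladder
induces a homeomorphism of the inverse limits (`nonempty_homeomorph_of_interleaved`). The needed
legality (`isLegal_of_interleaved`) holds because an iterate of `T_s` passes straight through every
vertex other than `0` and `1` (`exists_forall_hasJunction`): the point `T_s(0)` has the second
preimage `2 c_s`, which is not in `P`, and the iterates carry this junction to all other vertices.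

*From a homeomorphism to a weak equivalence.* The points of the inverse limit with all coordinates
in `P` are those that are not interior to an arc (`isInteriorToArc_of_not_isEnd`,
`IsEnd.not_isInteriorToArc`), so a homeomorphism `g` preserves this set. By compactness the `L`-th
coordinate of `g(z)` is determined up to a small error by the `K`-th coordinate of `z` for large `K`,
and is close to `P` if the latter is in `P` (`exists_controls`). Take the arc over the interval of
`aᵢ` at level `K`. The `L`-th coordinate of its image turns around only at vertices
(`taut_coordinate`), so it follows a word, up to small errors at the ends; this word is
`τ(aᵢ)`. The word of a path is the longest one that it crosses up to a tolerance
(`HasItinerary`). Therefore it does not change under small perturbations of the path, and the words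
of `g` and `g⁻¹` between levels `K > L > K'` compose to the word of `T_s^(K - K')`, which is
`χ_s^(K - K')(aᵢ)` (`wordMap_eq_iterate`). Choosing levels and tolerances alternately in the two
inverse limits gives the weak equivalence.
-/

open Set


/-! ### Letters, words and bar -/

/-- The index of the vertex at which the letter `b` starts: the left end of its interval for `aᵢ`,
the right end for `āᵢ`. -/
def Letter.src {n : ℕ} (b : Letter n) : Fin (n + 1) := if b.2 then b.1.castSucc else b.1.succ

/-- The index of the vertex at which the letter `b` ends. -/
def Letter.tgt {n : ℕ} (b : Letter n) : Fin (n + 1) := if b.2 then b.1.succ else b.1.castSucc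

section Words

variable {n m : ℕ}

theorem Letter.bar_bar (b : Letter n) : b.bar.bar = b := by
  rcases b with ⟨i, _ | _⟩ <;> rfl

theorem Letter.src_bar (b : Letter n) : b.bar.src = b.tgt := by
  rcases b with ⟨i, _ | _⟩ <;> rfl

theorem Letter.tgt_bar (b : Letter n) : b.bar.tgt = b.src := by
  rcases b with ⟨i, _ | _⟩ <;> rfl

theorem Letter.src_ne_tgt (b : Letter n) : b.src ≠ b.tgt := by
  rcases b with ⟨i, _ | _⟩
  · exact (Fin.castSucc_lt_succ (i := i)).ne'
  · exact (Fin.castSucc_lt_succ (i := i)).ne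

theorem barWord_append (w w' : List (Letter n)) : barWord (w ++ w') = barWord w' ++ barWord w := by
  simp [barWord]

theorem barWord_cons (b : Letter n) (w : List (Letter n)) :
    barWord (b :: w) = barWord w ++ [b.bar] := by
  simp [barWord]

theorem List.Sublist.barWord {w w' : List (Letter n)} (h : w.Sublist w') :
    (_root_.barWord w).Sublist (_root_.barWord w') :=
  (h.map _).reverse

theorem Substitution.ext_singleton (σ : Substitution n m) (b : Letter n) :
    σ.ext [b] = σ.toFun b := by
  simp [Substitution.ext]

theorem Substitution.ext_cons (σ : Substitution n m) (b : Letter n) (w : List (Letter n)) :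
    σ.ext (b :: w) = σ.toFun b ++ σ.ext w := by
  simp [Substitution.ext]

theorem Substitution.ext_append (σ : Substitution n m) (w w' : List (Letter n)) :
    σ.ext (w ++ w') = σ.ext w ++ σ.ext w' := by
  simp [Substitution.ext]

theorem Substitution.ext_barWord (σ : Substitution n m) (w : List (Letter n)) :
    σ.ext (barWord w) = barWord (σ.ext w) := by
  induction w with
  | nil => rfl
  | cons b w ih =>
    rw [barWord_cons, σ.ext_append, ih, σ.ext_singleton, σ.ext_cons b w, barWord_append, σ.map_bar]

end Words

/-! ### Paths that traverse a word -/

/-- A lift through a continuous map that is injective on a compact set is continuous. -/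
theorem continuousOn_of_comp_injOn {α β γ : Type*} [TopologicalSpace α] [TopologicalSpace β]
    [TopologicalSpace γ] [T2Space γ] {f : β → γ} {K : Set β} (hK : IsCompact K)
    (hf : ContinuousOn f K) (hi : InjOn f K) {g : α → γ} {h : α → β} {S : Set α}
    (hg : ContinuousOn g S) (hm : MapsTo h S K) (he : ∀ s ∈ S, f (h s) = g s) :
    ContinuousOn h S := by
  have : CompactSpace K := isCompact_iff_compactSpace.1 hK
  have hemb := (continuousOn_iff_continuous_domRestrict.1 hf).isClosedEmbedding
    (injOn_iff_injective.1 hi)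
  have hc : Continuous (hm.restrict h S K) := by
    rw [hemb.isInducing.continuous_iff]
    have : K.domRestrict f ∘ hm.restrict h S K = S.domRestrict g := by
      ext s; exact he s s.2
    rw [this]
    exact continuousOn_iff_continuous_domRestrict.1 hg
  rw [continuousOn_iff_continuous_domRestrict]
  exact continuous_subtype_val.comp hc

section Paths

variable {n m : ℕ}

/-- The path `f` on `[u, v]` runs homeomorphically along the interval of the letter `b`, between
consecutive vertices of the partition `x`, from the start of `b` to its end. -/
structure Runs (x : Fin (n + 1) ↪o ℝ) (f : ℝ → ℝ) (u v : ℝ) (b : Letter n) : Prop where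
  lt : u < v
  cont : ContinuousOn f (Icc u v)
  inj : InjOn f (Icc u v)
  src : f u = x b.src
  tgt : f v = x b.tgt

/-- The path `f` on `[u, v]` runs along the letters of the word `w`, one after the other. -/
inductive Traverses (x : Fin (n + 1) ↪o ℝ) (f : ℝ → ℝ) : ℝ → ℝ → List (Letter n) → Prop
  | nil (u : ℝ) : Traverses x f u u []
  | cons {u t v : ℝ} {b : Letter n} {w : List (Letter n)} (h : Runs x f u t b)
      (ht : Traverses x f t v w) : Traverses x f u v (b :: w)

variable {x : Fin (n + 1) ↪o ℝ} {y : Fin (m + 1) ↪o ℝ} {f g : ℝ → ℝ} {u t v c d : ℝ}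
  {b : Letter n} {w w' : List (Letter n)}

theorem map_neg_Icc {u v t : ℝ} (h : t ∈ Icc (-v) (-u)) : -t ∈ Icc u v :=
  ⟨by linarith [h.2], by linarith [h.1]⟩

theorem ContinuousOn.comp_neg_Icc (h : ContinuousOn f (Icc u v)) :
    ContinuousOn (fun t => f (-t)) (Icc (-v) (-u)) :=
  h.comp continuous_neg.continuousOn fun _ => map_neg_Icc

theorem Set.InjOn.comp_neg_Icc (h : InjOn f (Icc u v)) :
    InjOn (fun t => f (-t)) (Icc (-v) (-u)) := fun _ h₁ _ h₂ h₁₂ =>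
  neg_injective (h (map_neg_Icc h₁) (map_neg_Icc h₂) h₁₂)

theorem Runs.neg (h : Runs x f u v b) : Runs x (fun t => f (-t)) (-v) (-u) b.bar where
  lt := neg_lt_neg h.lt
  cont := h.cont.comp_neg_Icc
  inj := h.inj.comp_neg_Icc
  src := by simp [h.tgt, Letter.src_bar]
  tgt := by simp [h.src, Letter.tgt_bar]

theorem Runs.congr (h : Runs x f u v b) (e : EqOn g f (Icc u v)) : Runs x g u v b where
  lt := h.lt
  cont := h.cont.congr e
  inj := h.inj.congr e.symm
  src := by rw [e ⟨le_rfl, h.lt.le⟩, h.src]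
  tgt := by rw [e ⟨h.lt.le, le_rfl⟩, h.tgt]

theorem Runs.mapsTo (h : Runs x f u v b) :
    MapsTo f (Icc u v) (Icc (x b.1.castSucc) (x b.1.succ)) := by
  have hu : u ∈ Icc u v := ⟨le_rfl, h.lt.le⟩
  have hv : v ∈ Icc u v := ⟨h.lt.le, le_rfl⟩
  have hs := h.src
  have ht := h.tgt
  have hlt : x b.1.castSucc < x b.1.succ := x.strictMono Fin.castSucc_lt_succ
  intro t h1
  rcases h.cont.strictMonoOn_of_injOn_Icc' h.lt.le h.inj with hm | hm
  · have h2 := hm hu hv h.lt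
    have h3 := hm.monotoneOn hu h1 h1.1
    have h4 := hm.monotoneOn h1 hv h1.2
    rcases b with ⟨i, _ | _⟩ <;> simp only [Letter.src, Letter.tgt, if_true, Bool.false_eq_true,
      if_false] at * <;> constructor <;> linarith
  · have h2 := hm hu hv h.lt
    have h3 := hm.antitoneOn hu h1 h1.1
    have h4 := hm.antitoneOn h1 hv h1.2
    rcases b with ⟨i, _ | _⟩ <;> simp only [Letter.src, Letter.tgt, if_true, Bool.false_eq_true,
      if_false] at * <;> constructor <;> linarith

theorem Runs.surjOn (h : Runs x f u v b) :
    SurjOn f (Icc u v) (Icc (x b.1.castSucc) (x b.1.succ)) := by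
  have h1 := intermediate_value_uIcc (f := f) (a := u) (b := v) (by rw [uIcc_of_le h.lt.le]; exact h.cont)
  rw [uIcc_of_le h.lt.le, h.src, h.tgt] at h1
  intro z hz
  apply h1
  rcases b with ⟨i, _ | _⟩ <;> simp only [Letter.src, Letter.tgt, if_true, Bool.false_eq_true,
      if_false] at *
  · exact Icc_subset_uIcc' hz
  · exact Icc_subset_uIcc hz

theorem Traverses.le (h : Traverses x f u v w) : u ≤ v := by
  induction h with
  | nil => exact le_rfl
  | cons h _ ih => exact h.lt.le.trans ih

theorem Traverses.lt (h : Traverses x f u v w) (hw : w ≠ []) : u < v := by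
  cases h with
  | nil => exact absurd rfl hw
  | cons h h' => exact h.lt.trans_le h'.le

theorem Traverses.ne_nil (h : Traverses x f u v w) (huv : u < v) : w ≠ [] := by
  rintro rfl
  cases h
  exact lt_irrefl _ huv

theorem Runs.traverses (h : Runs x f u v b) : Traverses x f u v [b] := .cons h (.nil v)

theorem Traverses.append (h : Traverses x f u t w) (h' : Traverses x f t v w') :
    Traverses x f u v (w ++ w') := by
  induction h with
  | nil => exact h'
  | cons h _ ih => exact .cons h (ih h')

theorem traverses_append : Traverses x f u v (w ++ w') ↔
    ∃ t, Traverses x f u t w ∧ Traverses x f t v w' := by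
  refine ⟨fun h => ?_, fun ⟨t, h, h'⟩ => h.append h'⟩
  induction w generalizing u with
  | nil => exact ⟨u, .nil u, h⟩
  | cons b w ih =>
    cases h with
    | cons h h' =>
      obtain ⟨t, h1, h2⟩ := ih h'
      exact ⟨t, .cons h h1, h2⟩

theorem Traverses.congr (h : Traverses x f u v w) (e : EqOn g f (Icc u v)) :
    Traverses x g u v w := by
  induction h with
  | nil => exact .nil _
  | cons h h' ih =>
    exact .cons (h.congr (e.mono (Icc_subset_Icc_right h'.le)))
      (ih (e.mono (Icc_subset_Icc_left h.lt.le)))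

theorem Traverses.neg (h : Traverses x f u v w) :
    Traverses x (fun t => f (-t)) (-v) (-u) (barWord w) := by
  induction h with
  | nil => exact .nil _
  | cons h h' ih => rw [barWord_cons]; exact ih.append h.neg.traverses

theorem Traverses.continuousOn (h : Traverses x f u v w) : ContinuousOn f (Icc u v) := by
  induction h with
  | nil => simp
  | cons h h' ih =>
    rw [← Icc_union_Icc_eq_Icc h.lt.le h'.le]
    exact h.cont.union_of_isClosed ih isClosed_Icc isClosed_Icc

theorem Traverses.mapsTo (h : Traverses x f u v w) (huv : u < v) :
    MapsTo f (Icc u v) (Icc (x 0) (x (Fin.last n))) := by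
  induction h with
  | nil => exact absurd huv (lt_irrefl _)
  | @cons u t v b w h h' ih =>
    intro s hs
    have hl : ∀ s ∈ Icc u t, f s ∈ Icc (x 0) (x (Fin.last n)) := fun s hs =>
      Icc_subset_Icc (x.monotone (Fin.zero_le _)) (x.monotone (Fin.le_last _)) (h.mapsTo hs)
    rcases le_or_gt s t with hst | hst
    · exact hl s ⟨hs.1, hst⟩
    · exact ih (hst.trans_le hs.2) ⟨hst.le, hs.2⟩

/-- Reparametrization by an increasing homeomorphism. -/
theorem Traverses.comp_mono (h : Traverses x f c d w) (hg : ContinuousOn g (Icc u v))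
    (hm : StrictMonoOn g (Icc u v)) (huv : u ≤ v) (hu : g u = c) (hv : g v = d) :
    Traverses x (fun s => f (g s)) u v w := by
  induction h generalizing u with
  | nil e =>
    have : u = v := hm.injOn ⟨le_rfl, huv⟩ ⟨huv, le_rfl⟩ (hu.trans hv.symm)
    subst this
    exact .nil _
  | @cons c e d b w h h' ih =>
    subst hu hv
    obtain ⟨t, ht, hte⟩ := intermediate_value_Icc huv hg ⟨h.lt.le, h'.le⟩
    subst hte
    have hsub : Icc u t ⊆ Icc u v := Icc_subset_Icc_right ht.2
    have hmaps : MapsTo g (Icc u t) (Icc (g u) (g t)) :=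
      (hm.mono hsub).monotoneOn.mapsTo_Icc
    refine .cons ⟨?_, h.cont.comp (hg.mono hsub) hmaps,
      h.inj.comp (hm.injOn.mono hsub) hmaps, h.src, h.tgt⟩
      (ih (hg.mono (Icc_subset_Icc_left ht.1)) (hm.mono (Icc_subset_Icc_left ht.1)) ht.2 rfl rfl)
    exact (hm.lt_iff_lt ⟨le_rfl, huv⟩ ht).1 h.lt

/-- Reparametrization by a decreasing homeomorphism. -/
theorem Traverses.comp_anti (h : Traverses x f c d w) (hg : ContinuousOn g (Icc u v))
    (hm : StrictAntiOn g (Icc u v)) (huv : u ≤ v) (hu : g u = d) (hv : g v = c) :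
    Traverses x (fun s => f (g s)) u v (barWord w) := by
  have h1 := h.neg.comp_mono (g := fun s => - g s) hg.neg hm.neg huv (by rw [hu]) (by rw [hv])
  simpa using h1

/-- `f` realizes `σ` between the partitions `x` and `y`: on the interval of each letter `aᵢ` it
traverses the word `σ(aᵢ)`. -/
def Realizes (x : Fin (n + 1) ↪o ℝ) (y : Fin (m + 1) ↪o ℝ) (f : ℝ → ℝ) (σ : Substitution n m) :
    Prop :=
  ∀ i : Fin n, Traverses y f (x i.castSucc) (x i.succ) (σ.toFun (i, true))

theorem Realizes.runs {σ : Substitution n m} (hf : Realizes x y f σ) (h : Runs x g u v b) :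
    Traverses y (fun t => f (g t)) u v (σ.toFun b) := by
  have hu : u ∈ Icc u v := ⟨le_rfl, h.lt.le⟩
  have hv : v ∈ Icc u v := ⟨h.lt.le, le_rfl⟩
  have hs := h.src
  have ht := h.tgt
  have hm := h.cont.strictMonoOn_of_injOn_Icc' h.lt.le h.inj
  rcases b with ⟨i, _ | _⟩
  · have hlt : x i.castSucc < x i.succ := x.strictMono Fin.castSucc_lt_succ
    have hb : σ.toFun (i, false) = barWord (σ.toFun (i, true)) := σ.map_bar (i, true)
    rw [hb]
    simp only [Letter.src, Letter.tgt, Bool.false_eq_true, if_false] at hs ht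
    refine (hf i).comp_anti h.cont (hm.resolve_left fun hm => ?_) h.lt.le hs ht
    have := hm hu hv h.lt
    linarith
  · have hlt : x i.castSucc < x i.succ := x.strictMono Fin.castSucc_lt_succ
    simp only [Letter.src, Letter.tgt, if_true] at hs ht
    refine (hf i).comp_mono h.cont (hm.resolve_right fun hm => ?_) h.lt.le hs ht
    have := hm hu hv h.lt
    linarith

theorem Realizes.traverses {σ : Substitution n m} (hf : Realizes x y f σ)
    (h : Traverses x g u v w) : Traverses y (fun t => f (g t)) u v (σ.ext w) := by
  induction h with
  | nil => exact .nil _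
  | cons h _ ih => rw [σ.ext_cons]; exact (hf.runs h).append ih

end Paths

section Lifting

variable {n m k : ℕ} {x : Fin (n + 1) ↪o ℝ} {y : Fin (m + 1) ↪o ℝ} {f g : ℝ → ℝ}
  {u t v c d : ℝ} {b : Letter n} {w w' : List (Letter n)}

/-! ### Partitions of an interval -/

theorem partition_lt (x : Fin (n + 1) ↪o ℝ) (i : Fin n) : x i.castSucc < x i.succ :=
  x.strictMono Fin.castSucc_lt_succ

theorem partition_succ_le {i j : Fin n} (x : Fin (n + 1) ↪o ℝ) (h : i < j) :
    x i.succ ≤ x j.castSucc :=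
  x.monotone (by
    rw [Fin.le_def, Fin.val_succ, Fin.val_castSucc]
    exact h)

theorem eq_of_mem_Icc_of_mem_Ioo {i j : Fin n} {z : ℝ}
    (h₁ : z ∈ Icc (x i.castSucc) (x i.succ)) (h₂ : z ∈ Ioo (x j.castSucc) (x j.succ)) : i = j := by
  rcases lt_trichotomy i j with h | h | h
  · linarith [partition_succ_le x h, h₁.2, h₂.1]
  · exact h
  · linarith [partition_succ_le x h, h₁.1, h₂.2]

theorem vertex_mem_Icc {i : Fin n} {j : Fin (n + 1)}
    (h : x j ∈ Icc (x i.castSucc) (x i.succ)) : j = i.castSucc ∨ j = i.succ := by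
  have h1 := x.le_iff_le.1 h.1
  have h2 := x.le_iff_le.1 h.2
  rw [Fin.le_def] at h1 h2
  simp only [Fin.ext_iff, Fin.val_succ, Fin.val_castSucc] at *
  omega

theorem exists_mem_interval (hn : 0 < n) {z : ℝ} (h : z ∈ Icc (x 0) (x (Fin.last n))) :
    ∃ i : Fin n, z ∈ Icc (x i.castSucc) (x i.succ) := by
  have key : ∀ j : Fin (n + 1), z ≤ x j → z = x 0 ∨ ∃ i : Fin n, z ∈ Icc (x i.castSucc) (x i.succ) := by
    intro j
    induction j using Fin.induction with
    | zero => intro h'; exact Or.inl (le_antisymm h' h.1)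
    | succ i ih =>
      intro h'
      rcases le_or_gt z (x i.castSucc) with h'' | h''
      · exact ih h''
      · exact Or.inr ⟨i, h''.le, h'⟩
  rcases key _ h.2 with h' | h'
  · refine ⟨⟨0, hn⟩, ?_⟩
    rw [h']
    exact ⟨le_rfl, (partition_lt x ⟨0, hn⟩).le⟩
  · exact h'

theorem mem_Ioo_of_mem_Icc {i : Fin n} {z : ℝ} (h : z ∈ Icc (x i.castSucc) (x i.succ))
    (hz : ∀ j, x j ≠ z) : z ∈ Ioo (x i.castSucc) (x i.succ) :=
  ⟨lt_of_le_of_ne h.1 (hz _), lt_of_le_of_ne h.2 (hz _).symm⟩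

/-! ### Legal words -/

/-- A word is legal if it is the word of a path: every letter starts at the vertex at which the
preceding letter ends. -/
def IsLegal (w : List (Letter n)) : Prop := w.IsChain fun b c => b.tgt = c.src

theorem IsLegal.barWord (h : IsLegal w) : IsLegal (barWord w) := by
  unfold IsLegal _root_.barWord at *
  rw [List.isChain_reverse, List.isChain_map]
  refine h.imp fun a b hab => ?_
  rw [Letter.tgt_bar, Letter.src_bar, hab]

theorem IsLegal.infix (h : IsLegal w) (h' : w' <:+: w) : IsLegal w' := List.IsChain.infix h h'

theorem Traverses.map_left (h : Traverses x f u v (b :: w)) : f u = x b.src := by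
  cases h with
  | cons h _ => exact h.src

theorem Traverses.map_right (h : Traverses x f u v (w ++ [b])) : f v = x b.tgt := by
  obtain ⟨t, -, h⟩ := traverses_append.1 h
  cases h with
  | cons h h' =>
    cases h'
    exact h.tgt

theorem Traverses.isLegal (h : Traverses x f u v w) : IsLegal w := by
  induction h with
  | nil => exact .nil
  | @cons u t v b w h h' ih =>
    cases w with
    | nil => exact .singleton _
    | cons c w => exact .cons_cons (x.injective (by rw [← h.tgt, h'.map_left])) ih

/-- Two paths along the two halves of a legal word meet. -/
theorem Traverses.eq_of_isLegal (h : Traverses x f u t w) (h' : Traverses x g t v w')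
    (hw : w ≠ []) (hw' : w' ≠ []) (hl : IsLegal (w ++ w')) : f t = g t := by
  obtain ⟨w₁, b, rfl⟩ := List.eq_nil_or_concat w |>.resolve_left hw
  obtain ⟨c, w₂, rfl⟩ := List.exists_cons_of_ne_nil hw'
  rw [List.concat_eq_append] at h hl
  have hbc : IsLegal [b, c] := hl.infix ⟨w₁, w₂, by simp⟩
  rw [h.map_right, h'.map_left, (List.isChain_pair.1 hbc)]

theorem Traverses.split (h : Traverses x f u v w) (ht : t ∈ Icc u v) {j : Fin (n + 1)}
    (hj : f t = x j) :
    ∃ w₁ w₂, w = w₁ ++ w₂ ∧ Traverses x f u t w₁ ∧ Traverses x f t v w₂ := by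
  induction h with
  | nil e =>
    obtain rfl : t = e := le_antisymm ht.2 ht.1
    exact ⟨[], [], rfl, .nil _, .nil _⟩
  | @cons u e v b w h h' ih =>
    rcases le_or_gt t e with hte | hte
    · have hm : t ∈ Icc u e := ⟨ht.1, hte⟩
      have hu : u ∈ Icc u e := ⟨le_rfl, h.lt.le⟩
      have he : e ∈ Icc u e := ⟨h.lt.le, le_rfl⟩
      have hj' : j = b.src ∨ j = b.tgt := by
        have := vertex_mem_Icc (hj ▸ h.mapsTo hm)
        rcases b with ⟨i, _ | _⟩
        · exact this.symm
        · exact this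
      rcases hj' with rfl | rfl
      · obtain rfl := h.inj hm hu (hj.trans h.src.symm)
        exact ⟨[], b :: w, rfl, .nil _, .cons h h'⟩
      · obtain rfl := h.inj hm he (hj.trans h.tgt.symm)
        exact ⟨[b], w, rfl, h.traverses, h'⟩
    · obtain ⟨w₁, w₂, rfl, h1, h2⟩ := ih ⟨hte.le, ht.2⟩
      exact ⟨b :: w₁, w₂, rfl, .cons h h1, h2⟩

theorem Traverses.exists_mem (h : Traverses x f u v w) (ht : t ∈ Icc u v) {i : Fin n}
    (hi : f t ∈ Ioo (x i.castSucc) (x i.succ)) (huv : u < v) : ∃ e, (i, e) ∈ w := by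
  induction h with
  | nil e => exact absurd huv (lt_irrefl _)
  | @cons u e v b w h h' ih =>
    rcases le_or_gt t e with hte | hte
    · obtain rfl := eq_of_mem_Icc_of_mem_Ioo (h.mapsTo ⟨ht.1, hte⟩) hi
      exact ⟨b.2, by simp⟩
    · obtain ⟨e, he⟩ := ih ⟨hte.le, ht.2⟩ (hte.trans_le ht.2)
      exact ⟨e, List.mem_cons_of_mem _ he⟩

/-! ### Gluing and lifting of paths -/

theorem ContinuousOn.glue (hf : ContinuousOn f (Icc u t)) (hg : ContinuousOn g (Icc t v))
    (h : f t = g t) (hut : u ≤ t) (htv : t ≤ v) :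
    ContinuousOn (fun s => if s ≤ t then f s else g s) (Icc u v) := by
  rw [← Icc_union_Icc_eq_Icc hut htv]
  refine ContinuousOn.union_of_isClosed (hf.congr fun s hs => if_pos hs.2)
    (hg.congr fun s hs => ?_) isClosed_Icc isClosed_Icc
  split_ifs with hst
  · rw [le_antisymm hst hs.1, h]
  · rfl

theorem Traverses.glue (hf : Traverses x f u t w) (hg : Traverses x g t v w') (h : f t = g t) :
    Traverses x (fun s => if s ≤ t then f s else g s) u v (w ++ w') := by
  refine (hf.congr fun s hs => if_pos hs.2).append (hg.congr fun s hs => ?_)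
  split_ifs with hst
  · rw [le_antisymm hst hs.1, h]
  · rfl

theorem exists_runs (x : Fin (n + 1) ↪o ℝ) (b : Letter n) (huv : u < v) :
    ∃ f, Runs x f u v b := by
  have h0 : v - u ≠ 0 := by linarith
  have h1 : x b.tgt - x b.src ≠ 0 := sub_ne_zero.2 fun h => b.src_ne_tgt (x.injective h).symm
  refine ⟨fun s => x b.src + (s - u) / (v - u) * (x b.tgt - x b.src), huv, by fun_prop, ?_, ?_, ?_⟩
  · intro s _ t _ hst
    simp only [add_right_inj] at hst
    have := mul_right_cancel₀ h1 hst
    rw [div_left_inj' h0] at this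
    linarith
  · simp
  · rw [div_self h0]; ring

theorem exists_traverses (x : Fin (n + 1) ↪o ℝ) (hl : IsLegal w) (hw : w ≠ []) (huv : u < v) :
    ∃ f, Traverses x f u v w := by
  induction w generalizing u with
  | nil => exact absurd rfl hw
  | cons b w ih =>
    rcases eq_or_ne w [] with rfl | hw'
    · obtain ⟨f, hf⟩ := exists_runs x b huv
      exact ⟨f, hf.traverses⟩
    · have h1 : u < (u + v) / 2 := by linarith
      obtain ⟨f, hf⟩ := exists_runs x b h1
      obtain ⟨g, hg⟩ := ih (List.IsChain.tail hl) hw' (u := (u + v) / 2) (by linarith)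
      exact ⟨_, hf.traverses.glue hg (hf.traverses.eq_of_isLegal hg (by simp) hw' hl)⟩

theorem Runs.exists_lift (hf : Runs x f c d b) (hg : Runs x g u v b) :
    ∃ h, ContinuousOn h (Icc u v) ∧ StrictMonoOn h (Icc u v) ∧ h u = c ∧ h v = d ∧
      ∀ t ∈ Icc u v, f (h t) = g t := by
  have hu : u ∈ Icc u v := ⟨le_rfl, hg.lt.le⟩
  have hv : v ∈ Icc u v := ⟨hg.lt.le, le_rfl⟩
  have hc : c ∈ Icc c d := ⟨le_rfl, hf.lt.le⟩
  have hd : d ∈ Icc c d := ⟨hf.lt.le, le_rfl⟩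
  have key : ∀ t : ℝ, ∃ s, t ∈ Icc u v → s ∈ Icc c d ∧ f s = g t := by
    intro t
    by_cases ht : t ∈ Icc u v
    · obtain ⟨s, hs, e⟩ := hf.surjOn (hg.mapsTo ht)
      exact ⟨s, fun _ => ⟨hs, e⟩⟩
    · exact ⟨0, fun h => absurd h ht⟩
  choose h hh using key
  have hcont : ContinuousOn h (Icc u v) := continuousOn_of_comp_injOn isCompact_Icc hf.cont hf.inj
    hg.cont (fun t ht => (hh t ht).1) fun t ht => (hh t ht).2
  have hinj : InjOn h (Icc u v) := fun s hs t ht e =>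
    hg.inj hs ht (by rw [← (hh s hs).2, ← (hh t ht).2, e])
  have h1 : h u = c := hf.inj (hh u hu).1 hc (by rw [(hh u hu).2, hg.src, hf.src])
  have h2 : h v = d := hf.inj (hh v hv).1 hd (by rw [(hh v hv).2, hg.tgt, hf.tgt])
  refine ⟨h, hcont, ?_, h1, h2, fun t ht => (hh t ht).2⟩
  refine (hcont.strictMonoOn_of_injOn_Icc' hg.lt.le hinj).resolve_right fun ha => ?_
  have := ha hu hv hg.lt
  linarith [hf.lt]

/-- Two paths along the same word differ by a reparametrization. -/
theorem Traverses.exists_lift (hf : Traverses x f c d w) (hg : Traverses x g u v w)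
    (hw : w ≠ []) :
    ∃ h, ContinuousOn h (Icc u v) ∧ StrictMonoOn h (Icc u v) ∧ h u = c ∧ h v = d ∧
      ∀ t ∈ Icc u v, f (h t) = g t := by
  induction hf generalizing u with
  | nil => exact absurd rfl hw
  | @cons c e d b w hf hf' ih =>
    cases hg with
    | @cons _ t _ _ _ hg hg' =>
      obtain ⟨h₁, hc₁, hm₁, hu₁, ht₁, he₁⟩ := hf.exists_lift hg
      rcases eq_or_ne w [] with rfl | hw'
      · cases hf'
        cases hg'
        exact ⟨h₁, hc₁, hm₁, hu₁, ht₁, he₁⟩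
      · obtain ⟨h₂, hc₂, hm₂, ht₂, hv₂, he₂⟩ := ih hg' hw'
        have htv := hg'.lt hw'
        have e₁ : EqOn (fun s => if s ≤ t then h₁ s else h₂ s) h₁ (Icc u t) :=
          fun s hs => if_pos hs.2
        have e₂ : EqOn (fun s => if s ≤ t then h₁ s else h₂ s) h₂ (Icc t v) := by
          intro s hs
          dsimp only
          split_ifs with hst
          · rw [le_antisymm hst hs.1, ht₁, ht₂]
          · rfl
        refine ⟨fun s => if s ≤ t then h₁ s else h₂ s,
          hc₁.glue hc₂ (by rw [ht₁, ht₂]) hg.lt.le htv.le, ?_, ?_, ?_, ?_⟩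
        · rw [← Icc_union_Icc_eq_Icc hg.lt.le htv.le]
          exact (hm₁.congr e₁.symm).union (hm₂.congr e₂.symm) (isGreatest_Icc hg.lt.le)
            (isLeast_Icc htv.le)
        · rw [e₁ ⟨le_rfl, hg.lt.le⟩, hu₁]
        · rw [e₂ ⟨htv.le, le_rfl⟩, hv₂]
        · intro s hs
          rcases le_or_gt s t with hst | hst
          · rw [e₁ ⟨hs.1, hst⟩, he₁ s ⟨hs.1, hst⟩]
          · rw [e₂ ⟨hst.le, hs.2⟩, he₂ s ⟨hst.le, hs.2⟩]

theorem Realizes.exists_runs_lift {σ : Substitution n m} (hf : Realizes x y f σ)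
    (hg : Traverses y g u v (σ.toFun b)) :
    ∃ h, Runs x h u v b ∧ ∀ t ∈ Icc u v, f (h t) = g t := by
  have huv := hg.lt (σ.ne_nil b)
  rcases b with ⟨i, _ | _⟩
  · have hb : σ.toFun (i, false) = barWord (σ.toFun (i, true)) := σ.map_bar (i, true)
    rw [hb] at hg
    obtain ⟨h, hc, hm, hu, hv, he⟩ := (hf i).neg.exists_lift hg (hb ▸ σ.ne_nil _)
    refine ⟨fun s => - h s, ⟨huv, hc.neg, hm.neg.injOn, ?_, ?_⟩, he⟩
    · rw [hu, neg_neg]; rfl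
    · rw [hv, neg_neg]; rfl
  · obtain ⟨h, hc, hm, hu, hv, he⟩ := (hf i).exists_lift hg (σ.ne_nil _)
    exact ⟨h, ⟨huv, hc, hm.injOn, hu, hv⟩, he⟩

/-- Path lifting: if `f` realizes `σ`, then a path along `σ(w)`, with `w` legal, lifts through `f`
to a path along `w`. -/
theorem Realizes.exists_traverses_lift {σ : Substitution n m} (hf : Realizes x y f σ)
    (hl : IsLegal w) (hw : w ≠ []) (hg : Traverses y g u v (σ.ext w)) :
    ∃ h, Traverses x h u v w ∧ ∀ t ∈ Icc u v, f (h t) = g t := by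
  induction w generalizing u with
  | nil => exact absurd rfl hw
  | cons b w ih =>
    rw [σ.ext_cons] at hg
    obtain ⟨t, hg₁, hg₂⟩ := traverses_append.1 hg
    obtain ⟨h₁, hr₁, he₁⟩ := hf.exists_runs_lift hg₁
    rcases eq_or_ne w [] with rfl | hw'
    · cases hg₂
      exact ⟨h₁, hr₁.traverses, he₁⟩
    · obtain ⟨h₂, hr₂, he₂⟩ := ih (List.IsChain.tail hl) hw' hg₂
      have heq := hr₁.traverses.eq_of_isLegal hr₂ (by simp) hw' hl
      refine ⟨_, hr₁.traverses.glue hr₂ heq, fun s hs => ?_⟩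
      split_ifs with hst
      · exact he₁ s ⟨hs.1, hst⟩
      · exact he₂ s ⟨(not_le.1 hst).le, hs.2⟩

/-- A family of maps on the intervals of a partition that agree at the common vertices comes from
one map. -/
theorem exists_glue (z : Fin (n + 1) ↪o ℝ) (h : Fin n → ℝ → ℝ)
    (hh : ∀ i j : Fin n, i.succ = j.castSucc → h i (z i.succ) = h j (z i.succ)) :
    ∃ f : ℝ → ℝ, ∀ i, EqOn f (h i) (Icc (z i.castSucc) (z i.succ)) := by
  classical
  have key : ∀ (i j : Fin n) (t : ℝ), t ∈ Icc (z i.castSucc) (z i.succ) →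
      t ∈ Icc (z j.castSucc) (z j.succ) → i < j → h i t = h j t := by
    intro i j t hi hj hij
    have h1 := partition_succ_le z hij
    have h2 : t = z i.succ := le_antisymm hi.2 (h1.trans hj.1)
    have h3 : z i.succ = z j.castSucc := le_antisymm h1 (hj.1.trans hi.2)
    rw [h2, hh i j (z.injective h3)]
  refine ⟨fun t => if ht : ∃ i : Fin n, t ∈ Icc (z i.castSucc) (z i.succ) then
    h ht.choose t else 0, fun i t hi => ?_⟩
  have ht : ∃ i : Fin n, t ∈ Icc (z i.castSucc) (z i.succ) := ⟨i, hi⟩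
  dsimp only
  rw [dif_pos ht]
  rcases lt_trichotomy ht.choose i with hlt | heq | hlt
  · exact key _ _ t ht.choose_spec hi hlt
  · rw [heq]
  · exact (key _ _ t hi ht.choose_spec hlt).symm

/-- All pairs of neighbouring intervals are sent by `τ` to legal words, so that `τ` is realized by
continuous maps. -/
def Substitution.IsLegal (τ : Substitution n m) : Prop :=
  (∀ i, _root_.IsLegal (τ.toFun (i, true))) ∧
  ∀ i j : Fin n, i.succ = j.castSucc → _root_.IsLegal (τ.toFun (i, true) ++ τ.toFun (j, true))

theorem Substitution.IsLegal.exists_realizes {τ : Substitution n m} (hτ : τ.IsLegal)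
    (x : Fin (n + 1) ↪o ℝ) (y : Fin (m + 1) ↪o ℝ) : ∃ f, Realizes x y f τ := by
  choose h hh using fun i => exists_traverses y (hτ.1 i) (τ.ne_nil _) (partition_lt x i)
  obtain ⟨f, hf⟩ := exists_glue x h fun i j hij => by
    have h2 := hh j
    rw [← hij] at h2
    exact (hh i).eq_of_isLegal h2 (τ.ne_nil _) (τ.ne_nil _) (hτ.2 i j hij)
  exact ⟨f, fun i => (hh i).congr (hf i)⟩

/-- Lifting of maps: if `f` realizes `σ` and `g` realizes `σ ∘ τ`, with `τ` legal, then `g` factors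
through `f` by a map that realizes `τ`. -/
theorem Realizes.exists_lift {σ : Substitution n m} (hf : Realizes x y f σ) (hk : 0 < k)
    {z : Fin (k + 1) ↪o ℝ} {τ : Substitution k n} (hτ : τ.IsLegal)
    (hg : ∀ i : Fin k, Traverses y g (z i.castSucc) (z i.succ) (σ.ext (τ.toFun (i, true)))) :
    ∃ h, Realizes z x h τ ∧ ∀ t ∈ Icc (z 0) (z (Fin.last k)), f (h t) = g t := by
  choose h hh he using fun i => hf.exists_traverses_lift (hτ.1 i) (τ.ne_nil _) (hg i)
  obtain ⟨H, hH⟩ := exists_glue z h fun i j hij => by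
    have h2 := hh j
    rw [← hij] at h2
    exact (hh i).eq_of_isLegal h2 (τ.ne_nil _) (τ.ne_nil _) (hτ.2 i j hij)
  refine ⟨H, fun i => (hh i).congr (hH i), fun t ht => ?_⟩
  obtain ⟨i, hi⟩ := exists_mem_interval hk ht
  rw [hH i hi, he i t hi]

theorem Realizes.mapsTo {σ : Substitution n m} (hf : Realizes x y f σ) (hn : 0 < n) :
    MapsTo f (Icc (x 0) (x (Fin.last n))) (Icc (y 0) (y (Fin.last m))) := by
  intro t ht
  obtain ⟨i, hi⟩ := exists_mem_interval hn ht
  exact (hf i).mapsTo (partition_lt x i) hi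

theorem Realizes.continuousOn {σ : Substitution n m} (hf : Realizes x y f σ) (hn : 0 < n) :
    ContinuousOn f (Icc (x 0) (x (Fin.last n))) := by
  have h : Icc (x 0) (x (Fin.last n)) = ⋃ i : Fin n, Icc (x i.castSucc) (x i.succ) := by
    refine Subset.antisymm (fun t ht => mem_iUnion.2 (exists_mem_interval hn ht)) ?_
    exact iUnion_subset fun i =>
      Icc_subset_Icc (x.monotone (Fin.zero_le _)) (x.monotone (Fin.le_last _))
  rw [h]
  exact LocallyFinite.continuousOn_iUnion (locallyFinite_of_finite _)
    (fun _ => isClosed_Icc) fun i => (hf i).continuousOn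

end Lifting

/-! ### The tent map and the orbit of its critical point -/

section Tent

variable {s : ℝ}

theorem tentCrit_mem_Ioo (h : 1 < s) : tentCrit s ∈ Ioo (0 : ℝ) 1 := by
  have h0 : 0 < s := by linarith
  unfold tentCrit
  exact ⟨div_pos (by linarith) h0, (div_lt_one h0).2 (by linarith)⟩

theorem mul_tentCrit (h : 1 < s) : s * tentCrit s = s - 1 := by
  have h0 : s ≠ 0 := by linarith
  unfold tentCrit
  field_simp

theorem tentMap_of_le {t : ℝ} (h : t ≤ tentCrit s) : tentMap s t = s * t + 2 - s := if_pos h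

theorem tentMap_of_ge (hs : 1 < s) {t : ℝ} (h : tentCrit s ≤ t) : tentMap s t = -s * t + s := by
  rcases h.eq_or_lt with rfl | h
  · rw [tentMap_of_le le_rfl]
    linarith [mul_tentCrit hs]
  · exact if_neg (not_le.2 h)

theorem continuous_tentMap (hs : 1 < s) : Continuous (tentMap s) := by
  refine Continuous.if_le (by fun_prop) (by fun_prop) continuous_id continuous_const ?_
  rintro t rfl
  linarith [mul_tentCrit hs]

theorem mapsTo_tentMap (hs : 1 < s) (hs' : s ≤ 2) : MapsTo (tentMap s) (Icc 0 1) (Icc 0 1) := by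
  intro t ht
  have hc := mul_tentCrit hs
  rcases le_total t (tentCrit s) with h | h
  · rw [tentMap_of_le h]
    constructor <;> nlinarith [ht.1, ht.2]
  · rw [tentMap_of_ge hs h]
    constructor <;> nlinarith [ht.1, ht.2]

theorem tentMap_tentCrit (hs : 1 < s) : tentMap s (tentCrit s) = 1 := by
  rw [tentMap_of_le le_rfl, mul_tentCrit hs]; ring

theorem tentMap_one (hs : 1 < s) : tentMap s 1 = 0 := by
  rw [tentMap_of_ge hs (tentCrit_mem_Ioo hs).2.le]; ring

theorem tentMap_zero (hs : 1 < s) : tentMap s 0 = 2 - s := by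
  rw [tentMap_of_le (tentCrit_mem_Ioo hs).1.le]; ring

theorem injOn_tentMap_Iic (hs : 1 < s) : InjOn (tentMap s) (Iic (tentCrit s)) := by
  intro a ha b hb h
  rw [tentMap_of_le ha, tentMap_of_le hb] at h
  exact mul_left_cancel₀ (by linarith : s ≠ 0) (by linarith)

theorem injOn_tentMap_Ici (hs : 1 < s) : InjOn (tentMap s) (Ici (tentCrit s)) := by
  intro a ha b hb h
  rw [tentMap_of_ge hs ha, tentMap_of_ge hs hb] at h
  exact mul_left_cancel₀ (by linarith : s ≠ 0) (by linarith)

theorem tentCrit_mem_tentOrbit (hs : s ∈ periodicTentParams) : tentCrit s ∈ tentOrbit s :=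
  Finset.mem_image.2
    ⟨0, Finset.mem_range.2 (Function.minimalPeriod_pos_of_mem_periodicPts hs.2.2), rfl⟩

theorem one_mem_tentOrbit (hs : s ∈ periodicTentParams) : (1 : ℝ) ∈ tentOrbit s :=
  tentMap_tentCrit hs.1 ▸ tentMap_mem_tentOrbit hs (tentCrit_mem_tentOrbit hs)

theorem zero_mem_tentOrbit (hs : s ∈ periodicTentParams) : (0 : ℝ) ∈ tentOrbit s :=
  tentMap_one hs.1 ▸ tentMap_mem_tentOrbit hs (one_mem_tentOrbit hs)

theorem iterate_mem_tentOrbit (hs : s ∈ periodicTentParams) {t : ℝ} (ht : t ∈ tentOrbit s)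
    (k : ℕ) : (tentMap s)^[k] t ∈ tentOrbit s := by
  induction k with
  | zero => exact ht
  | succ k ih => rw [Function.iterate_succ_apply']; exact tentMap_mem_tentOrbit hs ih

theorem tentOrbit_subset_Icc (hs : s ∈ periodicTentParams) {t : ℝ} (ht : t ∈ tentOrbit s) :
    t ∈ Icc (0 : ℝ) 1 := by
  simp only [tentOrbit, Finset.mem_image] at ht
  obtain ⟨k, -, rfl⟩ := ht
  exact (mapsTo_tentMap hs.1 hs.2.1).iterate k (Ioo_subset_Icc_self (tentCrit_mem_Ioo hs.1))

theorem injOn_tentMap_tentOrbit (hs : s ∈ periodicTentParams) :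
    InjOn (tentMap s) (tentOrbit s) := by
  set p := Function.minimalPeriod (tentMap s) (tentCrit s)
  have hpos : 0 < p := Function.minimalPeriod_pos_of_mem_periodicPts hs.2.2
  have key : ∀ t ∈ tentOrbit s, (tentMap s)^[p] t = t := by
    intro t ht
    simp only [tentOrbit, Finset.mem_image] at ht
    obtain ⟨k, -, rfl⟩ := ht
    rw [← Function.iterate_add_apply, add_comm, Function.iterate_add_apply,
      Function.iterate_minimalPeriod]
  intro a ha b hb h
  rw [← key a ha, ← key b hb]
  obtain ⟨q, hq⟩ := Nat.exists_eq_succ_of_ne_zero hpos.ne'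
  rw [hq, Function.iterate_succ_apply, Function.iterate_succ_apply, h]

theorem three_le_minimalPeriod (hs : s ∈ periodicTentParams) :
    3 ≤ Function.minimalPeriod (tentMap s) (tentCrit s) := by
  have hpos := Function.minimalPeriod_pos_of_mem_periodicPts hs.2.2
  have hc := tentCrit_mem_Ioo hs.1
  have h := Function.iterate_minimalPeriod (f := tentMap s) (x := tentCrit s)
  by_contra hlt
  obtain h1 | h1 : Function.minimalPeriod (tentMap s) (tentCrit s) = 1 ∨
      Function.minimalPeriod (tentMap s) (tentCrit s) = 2 := by omega
  · rw [h1] at h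
    simp only [Function.iterate_succ_apply, Function.iterate_zero_apply, tentMap_tentCrit hs.1] at h
    linarith [hc.2]
  · rw [h1] at h
    simp only [Function.iterate_succ_apply, Function.iterate_zero_apply, tentMap_tentCrit hs.1,
      tentMap_one hs.1] at h
    linarith [hc.1]

theorem tentSize_pos (hs : s ∈ periodicTentParams) : 0 < tentSize s := by
  have := three_le_minimalPeriod hs
  unfold tentSize
  omega

theorem lt_two_of_mem_periodicTentParams (hs : s ∈ periodicTentParams) : s < 2 := by
  refine lt_of_le_of_ne hs.2.1 ?_
  rintro rfl
  have h0 : (0 : ℝ) = 1 := injOn_tentMap_tentOrbit hs (zero_mem_tentOrbit hs)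
    (one_mem_tentOrbit hs) (by rw [tentMap_zero hs.1, tentMap_one hs.1]; norm_num)
  norm_num at h0

theorem tentPoint_mem (hs : s ∈ periodicTentParams) (j : Fin (tentSize s + 1)) :
    tentPoint s hs j ∈ tentOrbit s := (mem_tentOrbit_iff hs _).2 ⟨j, rfl⟩

theorem tentPoint_zero (hs : s ∈ periodicTentParams) : tentPoint s hs 0 = 0 := by
  obtain ⟨j, hj⟩ := (mem_tentOrbit_iff hs _).1 (zero_mem_tentOrbit hs)
  refine le_antisymm ?_ (tentOrbit_subset_Icc hs (tentPoint_mem hs 0)).1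
  rw [← hj]
  exact (tentPoint s hs).monotone (Fin.zero_le j)

theorem tentPoint_last (hs : s ∈ periodicTentParams) :
    tentPoint s hs (Fin.last (tentSize s)) = 1 := by
  obtain ⟨j, hj⟩ := (mem_tentOrbit_iff hs _).1 (one_mem_tentOrbit hs)
  refine le_antisymm (tentOrbit_subset_Icc hs (tentPoint_mem hs _)).2 ?_
  rw [← hj]
  exact (tentPoint s hs).monotone (Fin.le_last j)

theorem exists_mem_tentInterval (hs : s ∈ periodicTentParams) {t : ℝ} (ht : t ∈ Icc (0 : ℝ) 1) :
    ∃ i : Fin (tentSize s), t ∈ Icc (tentPoint s hs i.castSucc) (tentPoint s hs i.succ) :=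
  exists_mem_interval (tentSize_pos hs) (by rwa [tentPoint_zero, tentPoint_last])

theorem tentInterval_subset (hs : s ∈ periodicTentParams) (i : Fin (tentSize s)) :
    Icc (tentPoint s hs i.castSucc) (tentPoint s hs i.succ) ⊆ Icc 0 1 :=
  Icc_subset_Icc (tentOrbit_subset_Icc hs (tentPoint_mem hs _)).1
    (tentOrbit_subset_Icc hs (tentPoint_mem hs _)).2

theorem injOn_tentMap_tentInterval (hs : s ∈ periodicTentParams) (i : Fin (tentSize s)) :
    InjOn (tentMap s) (Icc (tentPoint s hs i.castSucc) (tentPoint s hs i.succ)) := by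
  rcases (tentMap_image_tentInterval hs i).1 with h | h
  · exact h.injOn
  · exact h.injOn

/-! ### The substitution of the tent map is realized by the tent map -/

/-- The word `aₚ₊₁ … a_q` of the increasing path between the vertices with indices `p` and `q`. -/
def ascendingWord {n : ℕ} (p q : Fin (n + 1)) : List (Letter n) :=
  ((List.finRange n).filter fun l => p ≤ l.castSucc ∧ l.succ ≤ q).map fun l => (l, true)

theorem ascendingWord_self {n : ℕ} (p : Fin (n + 1)) : ascendingWord p p = [] := by
  simp only [ascendingWord, List.map_eq_nil_iff, List.filter_eq_nil_iff, decide_eq_true_eq,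
    Fin.le_def, Fin.val_succ, Fin.val_castSucc]
  intros
  omega

theorem ascendingWord_succ {n : ℕ} {p : Fin (n + 1)} {i : Fin n} (h : p ≤ i.castSucc) :
    ascendingWord p i.succ = ascendingWord p i.castSucc ++ [(i, true)] := by
  have key : (List.finRange n).filter (fun l => p ≤ l.castSucc ∧ l.succ ≤ i.succ) =
      (List.finRange n).filter (fun l => p ≤ l.castSucc ∧ l.succ ≤ i.castSucc) ++ [i] := by
    have hp := List.pairwise_lt_finRange n
    refine List.Pairwise.eq_of_mem_iff (r := (· < ·)) (hp.filter _) ?_ ?_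
    · rw [List.pairwise_append]
      refine ⟨hp.filter _, by simp, ?_⟩
      simp only [List.mem_filter, List.mem_finRange, List.mem_singleton, decide_eq_true_eq,
        Fin.le_def, Fin.lt_def, Fin.val_succ, Fin.val_castSucc]
      rintro a ⟨-, -, h⟩ b rfl
      omega
    · intro a
      simp only [List.mem_filter, List.mem_finRange, List.mem_singleton, decide_eq_true_eq,
        Fin.le_def, Fin.ext_iff, Fin.val_succ, Fin.val_castSucc, List.mem_append, true_and] at *
      omega
  rw [ascendingWord, key, List.map_append]
  rfl

theorem traverses_ascendingWord {n : ℕ} {x : Fin (n + 1) ↪o ℝ} {f : ℝ → ℝ} {u v : ℝ}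
    {p q : Fin (n + 1)} (huv : u ≤ v) (hf : ContinuousOn f (Icc u v))
    (hm : StrictMonoOn f (Icc u v)) (hu : f u = x p) (hv : f v = x q) :
    Traverses x f u v (ascendingWord p q) := by
  have hpq : p ≤ q := by
    rw [← x.le_iff_le, ← hu, ← hv]
    exact hm.monotoneOn ⟨le_rfl, huv⟩ ⟨huv, le_rfl⟩ huv
  induction q using Fin.induction generalizing v with
  | zero =>
    obtain rfl : p = 0 := le_antisymm hpq (Fin.zero_le _)
    obtain rfl : u = v := hm.injOn ⟨le_rfl, huv⟩ ⟨huv, le_rfl⟩ (hu.trans hv.symm)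
    rw [ascendingWord_self]
    exact .nil _
  | succ i ih =>
    rcases hpq.eq_or_lt with rfl | hlt
    · obtain rfl : u = v := hm.injOn ⟨le_rfl, huv⟩ ⟨huv, le_rfl⟩ (hu.trans hv.symm)
      rw [ascendingWord_self]
      exact .nil _
    · have hpi : p ≤ i.castSucc := Fin.le_castSucc_iff.2 hlt
      obtain ⟨t, ht, e⟩ := intermediate_value_Icc huv hf (show x i.castSucc ∈ Icc (f u) (f v) by
        rw [hu, hv]; exact ⟨x.monotone hpi, (partition_lt x i).le⟩)
      have h1 : Icc u t ⊆ Icc u v := Icc_subset_Icc_right ht.2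
      have h2 : Icc t v ⊆ Icc u v := Icc_subset_Icc_left ht.1
      rw [ascendingWord_succ hpi]
      refine (ih ht.1 (hf.mono h1) (hm.mono h1) e hpi).append (Runs.traverses
        ⟨?_, hf.mono h2, hm.injOn.mono h2, e, hv⟩)
      rw [← hm.lt_iff_lt ht ⟨huv, le_rfl⟩, e, hv]
      exact partition_lt x i

theorem tentBlock_eq (hs : s ∈ periodicTentParams) {i : Fin (tentSize s)}
    {p q : Fin (tentSize s + 1)}
    (h : tentMap s '' tentInterval s hs i = Icc (tentPoint s hs p) (tentPoint s hs q)) :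
    tentBlock s hs i = ascendingWord p q := by
  unfold tentBlock ascendingWord
  congr 1
  refine List.filter_congr fun l _ => ?_
  rw [decide_eq_decide, h, tentInterval, Icc_subset_Icc_iff (partition_lt _ l).le,
    OrderEmbedding.le_iff_le, OrderEmbedding.le_iff_le]

theorem realizes_tentMap (hs : s ∈ periodicTentParams) :
    Realizes (tentPoint s hs) (tentPoint s hs) (tentMap s) (tentSubstitution s hs) := by
  intro i
  obtain ⟨hm, -⟩ := tentMap_image_tentInterval hs i
  have hlt := partition_lt (tentPoint s hs) i
  have hcont : ContinuousOn (tentMap s)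
    (Icc (tentPoint s hs i.castSucc) (tentPoint s hs i.succ)) := (continuous_tentMap hs.1).continuousOn
  obtain ⟨p, hp⟩ := (mem_tentOrbit_iff hs _).1 (tentMap_mem_tentOrbit hs (tentPoint_mem hs i.castSucc))
  obtain ⟨q, hq⟩ := (mem_tentOrbit_iff hs _).1 (tentMap_mem_tentOrbit hs (tentPoint_mem hs i.succ))
  have hl : tentPoint s hs i.castSucc ∈ tentInterval s hs i := ⟨le_rfl, hlt.le⟩
  have hr : tentPoint s hs i.succ ∈ tentInterval s hs i := ⟨hlt.le, le_rfl⟩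
  have hw : (tentSubstitution s hs).toFun (i, true) = tentWord s hs i := rfl
  rw [hw, tentWord]
  split_ifs with h
  · have him : tentMap s '' tentInterval s hs i = Icc (tentPoint s hs p) (tentPoint s hs q) := by
      rw [hp, hq]
      exact Subset.antisymm h.monotoneOn.mapsTo_Icc.image_subset
        (intermediate_value_Icc hlt.le hcont)
    rw [tentBlock_eq hs him]
    exact traverses_ascendingWord hlt.le hcont h hp.symm hq.symm
  · replace h := hm.resolve_left h
    have him : tentMap s '' tentInterval s hs i = Icc (tentPoint s hs q) (tentPoint s hs p) := by
      rw [hp, hq]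
      exact Subset.antisymm h.antitoneOn.mapsTo_Icc.image_subset
        (intermediate_value_Icc' hlt.le hcont)
    rw [tentBlock_eq hs him]
    have h1 := traverses_ascendingWord (x := tentPoint s hs) (f := fun t => tentMap s (-t))
      (u := - tentPoint s hs i.succ) (v := - tentPoint s hs i.castSucc) (neg_le_neg hlt.le)
      hcont.comp_neg_Icc ?_ (by rw [neg_neg]; exact hq.symm) (by rw [neg_neg]; exact hp.symm)
    · simpa using h1.neg
    · intro a ha b hb hab
      exact h (map_neg_Icc hb) (map_neg_Icc ha) (neg_lt_neg hab)

theorem Traverses.iterate_tentMap (hs : s ∈ periodicTentParams) {f : ℝ → ℝ} {u v : ℝ}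
    {w : List (Letter (tentSize s))} (h : Traverses (tentPoint s hs) f u v w) (N : ℕ) :
    Traverses (tentPoint s hs) (fun t => (tentMap s)^[N] (f t)) u v
      ((tentSubstitution s hs).ext^[N] w) := by
  induction N with
  | zero => exact h
  | succ N ih =>
    simp only [Function.iterate_succ_apply']
    exact (realizes_tentMap hs).traverses ih

theorem traverses_id {n : ℕ} (x : Fin (n + 1) ↪o ℝ) (i : Fin n) :
    Traverses x id (x i.castSucc) (x i.succ) [(i, true)] :=
  Runs.traverses ⟨partition_lt x i, continuousOn_id, injOn_id _, rfl, rfl⟩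

theorem traverses_iterate_tentMap (hs : s ∈ periodicTentParams) (i : Fin (tentSize s)) (N : ℕ) :
    Traverses (tentPoint s hs) (tentMap s)^[N] (tentPoint s hs i.castSucc) (tentPoint s hs i.succ)
      ((tentSubstitution s hs).ext^[N] [(i, true)]) :=
  (traverses_id _ i).iterate_tentMap hs N

/-! ### The inverse branch defined on all of `[0, 1]` -/

/-- The inverse branch of `T_s` with values in `[c_s, 1]`. -/
noncomputable def tentBranch (s t : ℝ) : ℝ := 1 - t / s

theorem tentBranch_mem (hs : 1 < s) {t : ℝ} (ht : t ∈ Icc (0 : ℝ) 1) :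
    tentBranch s t ∈ Icc (0 : ℝ) 1 := by
  have h0 : 0 < s := by linarith
  have h1 : 0 ≤ t / s := div_nonneg ht.1 h0.le
  have h2 : t / s ≤ 1 := (div_le_one h0).2 (by linarith [ht.2])
  exact ⟨by unfold tentBranch; linarith, by unfold tentBranch; linarith⟩

theorem tentMap_tentBranch (hs : 1 < s) {t : ℝ} (ht : t ∈ Icc (0 : ℝ) 1) :
    tentMap s (tentBranch s t) = t := by
  have h0 : 0 < s := by linarith
  rw [tentMap_of_ge hs]
  · unfold tentBranch
    field_simp
    ring
  · unfold tentBranch tentCrit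
    rw [div_le_iff₀ h0, sub_mul, div_mul_cancel₀ _ h0.ne']
    linarith [ht.2]

theorem continuous_tentBranch (s : ℝ) : Continuous (tentBranch s) := by
  unfold tentBranch; fun_prop

theorem iterate_tentMap_tentBranch (hs : 1 < s) {t : ℝ} (ht : t ∈ Icc (0 : ℝ) 1) (N : ℕ) :
    (tentMap s)^[N] ((tentBranch s)^[N] t) = t := by
  induction N with
  | zero => rfl
  | succ N ih =>
    have hm : (tentBranch s)^[N] t ∈ Icc (0 : ℝ) 1 :=
      MapsTo.iterate (fun _ => tentBranch_mem hs) N ht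
    rw [Function.iterate_succ_apply, Function.iterate_succ_apply', tentMap_tentBranch hs hm, ih]

/-! ### Letters and junctions that occur in the iterates -/

theorem Substitution.iterate_ext_barWord {n : ℕ} (σ : Substitution n n) (N : ℕ)
    (w : List (Letter n)) : σ.ext^[N] (barWord w) = barWord (σ.ext^[N] w) := by
  induction N generalizing w with
  | zero => rfl
  | succ N ih => rw [Function.iterate_succ_apply, σ.ext_barWord, ih, Function.iterate_succ_apply]

theorem Substitution.iterate_ext_append {n : ℕ} (σ : Substitution n n) (N : ℕ)
    (w w' : List (Letter n)) : σ.ext^[N] (w ++ w') = σ.ext^[N] w ++ σ.ext^[N] w' := by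
  induction N generalizing w w' with
  | zero => rfl
  | succ N ih => simp only [Function.iterate_succ_apply, σ.ext_append, ih]

theorem Substitution.ext_infix {n m : ℕ} (σ : Substitution n m) {w w' : List (Letter n)}
    (h : w <:+: w') : σ.ext w <:+: σ.ext w' := by
  obtain ⟨a, b, rfl⟩ := h
  exact ⟨σ.ext a, σ.ext b, by rw [σ.ext_append, σ.ext_append]⟩

theorem Substitution.iterate_ext_infix {n : ℕ} (σ : Substitution n n) (N : ℕ)
    {w w' : List (Letter n)} (h : w <:+: w') : σ.ext^[N] w <:+: σ.ext^[N] w' := by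
  obtain ⟨a, b, rfl⟩ := h
  exact ⟨σ.ext^[N] a, σ.ext^[N] b, by rw [σ.iterate_ext_append, σ.iterate_ext_append]⟩

theorem mem_barWord_iff {n : ℕ} {w : List (Letter n)} {b : Letter n} :
    b ∈ barWord w ↔ b.bar ∈ w := by
  simp only [barWord, List.mem_reverse, List.mem_map]
  constructor
  · rintro ⟨a, ha, rfl⟩; rwa [Letter.bar_bar]
  · intro h; exact ⟨_, h, Letter.bar_bar b⟩

/-- Every letter occurs in the word `χ_s^N(b)` of some letter `b`, because `T_s` is onto. -/
theorem exists_mem_iterate_tentSubstitution (hs : s ∈ periodicTentParams)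
    (a : Letter (tentSize s)) (N : ℕ) : ∃ b, a ∈ (tentSubstitution s hs).ext^[N] [b] := by
  have hlt := partition_lt (tentPoint s hs) a.1
  set t := (tentPoint s hs a.1.castSucc + tentPoint s hs a.1.succ) / 2 with ht
  have hta : t ∈ Ioo (tentPoint s hs a.1.castSucc) (tentPoint s hs a.1.succ) :=
    ⟨by linarith, by linarith⟩
  have ht1 := tentInterval_subset hs a.1 (Ioo_subset_Icc_self hta)
  have hm : (tentBranch s)^[N] t ∈ Icc (0 : ℝ) 1 :=
    MapsTo.iterate (fun _ => tentBranch_mem hs.1) N ht1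
  obtain ⟨i, hi⟩ := exists_mem_tentInterval hs hm
  obtain ⟨e, he⟩ := (traverses_iterate_tentMap hs i N).exists_mem hi (i := a.1)
    (by rwa [iterate_tentMap_tentBranch hs.1 ht1]) (partition_lt _ _)
  by_cases hea : e = a.2
  · exact ⟨(i, true), by rwa [hea] at he⟩
  · refine ⟨(i, false), ?_⟩
    have : [(i, false)] = barWord [((i, true) : Letter (tentSize s))] := rfl
    rw [this, Substitution.iterate_ext_barWord, mem_barWord_iff]
    have : a.bar = (a.1, e) := by
      rcases a with ⟨_, _ | _⟩ <;> rcases e with _ | _ <;> simp_all [Letter.bar]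
    rwa [this]

/-- The word `w` passes straight through the vertex `l`, in one of the two directions. -/
def HasJunction {n : ℕ} (w : List (Letter n)) (l : Fin (n + 1)) : Prop :=
  ∃ i j : Fin n, i.succ = l ∧ j.castSucc = l ∧
    ([(i, true), (j, true)] <:+: w ∨ [(i, true), (j, true)] <:+: barWord w)

theorem HasJunction.infix {n : ℕ} {w w' : List (Letter n)} {l : Fin (n + 1)}
    (h : HasJunction w l) (hw : w <:+: w') : HasJunction w' l := by
  obtain ⟨i, j, hi, hj, h⟩ := h
  refine ⟨i, j, hi, hj, h.imp (fun h => h.trans hw) fun h => h.trans ?_⟩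
  exact (hw.map _).reverse

theorem HasJunction.barWord {n : ℕ} {w : List (Letter n)} {l : Fin (n + 1)}
    (h : HasJunction w l) : HasJunction (barWord w) l := by
  obtain ⟨i, j, hi, hj, h⟩ := h
  exact ⟨i, j, hi, hj, by rw [barWord_barWord]; exact h.symm⟩

theorem hasJunction_of_injOn {n : ℕ} {x : Fin (n + 1) ↪o ℝ} {f : ℝ → ℝ} {u z v : ℝ}
    {w w' : List (Letter n)} (h : Traverses x f u z w) (h' : Traverses x f z v w')
    (hw : w ≠ []) (hw' : w' ≠ []) (hf : InjOn f (Icc u v)) {l : Fin (n + 1)} (hl : f z = x l) :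
    HasJunction (w ++ w') l := by
  obtain ⟨w₁, b, rfl⟩ := List.eq_nil_or_concat w |>.resolve_left hw
  obtain ⟨c, w₂, rfl⟩ := List.exists_cons_of_ne_nil hw'
  rw [List.concat_eq_append] at h ⊢
  obtain ⟨t, h1, h2⟩ := traverses_append.1 h
  have hut := h1.le
  cases h2 with
  | cons hb hn =>
    cases hn
    cases h' with
    | @cons _ t' _ _ _ hc h3 =>
      have ht'v := h3.le
      have hbt : b.tgt = l := x.injective (hb.tgt.symm.trans hl)
      have hcs : c.src = l := x.injective (hc.src.symm.trans hl)
      have hne : f t ≠ f t' := fun e => by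
        have := hf ⟨hut, by linarith [hb.lt, hc.lt]⟩ ⟨by linarith [hb.lt, hc.lt], ht'v⟩ e
        linarith [hb.lt, hc.lt]
      have hne' : b.src ≠ c.tgt := fun e => hne (by rw [hb.src, hc.tgt, e])
      have hbc : [b, c] <:+: w₁ ++ [b] ++ c :: w₂ := ⟨w₁, w₂, by simp⟩
      rcases b with ⟨i, _ | _⟩ <;> rcases c with ⟨j, _ | _⟩
      · exact ⟨j, i, hcs, hbt, Or.inr ((hbc.map Letter.bar).reverse)⟩
      · refine absurd ?_ hne'
        have : i = j := Fin.castSucc_injective _ (hbt.trans hcs.symm)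
        rw [this]; rfl
      · refine absurd ?_ hne'
        have : i = j := Fin.succ_injective _ (hbt.trans hcs.symm)
        rw [this]; rfl
      · exact ⟨i, j, hbt, hcs, Or.inl hbc⟩

theorem HasJunction.map_tentSubstitution (hs : s ∈ periodicTentParams)
    {w : List (Letter (tentSize s))} {l l' : Fin (tentSize s + 1)} (h : HasJunction w l)
    (hl : tentPoint s hs l ≠ tentCrit s) (hl' : tentMap s (tentPoint s hs l) = tentPoint s hs l') :
    HasJunction ((tentSubstitution s hs).ext w) l' := by
  obtain ⟨i, j, hi, hj, h⟩ := h
  have key : HasJunction ((tentSubstitution s hs).ext [(i, true), (j, true)]) l' := by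
    have h1 := realizes_tentMap hs i
    have h2 := realizes_tentMap hs j
    rw [hi] at h1
    rw [hj] at h2
    rw [Substitution.ext_cons, Substitution.ext_singleton]
    refine hasJunction_of_injOn h1 h2 (Substitution.ne_nil _ _) (Substitution.ne_nil _ _) ?_ hl'
    -- the critical point is a vertex, so it is not inside the union of the two intervals at `l`
    obtain ⟨k, hk⟩ := (mem_tentOrbit_iff hs _).1 (tentCrit_mem_tentOrbit hs)
    have hkl : k ≠ l := fun e => hl (by rw [← e, hk])
    obtain h3 | h3 : k ≤ i.castSucc ∨ j.succ ≤ k := by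
      rw [Fin.le_def, Fin.le_def]
      simp only [Fin.ext_iff, Fin.val_succ, Fin.val_castSucc, ne_eq] at *
      omega
    · refine (injOn_tentMap_Ici hs.1).mono fun t ht => ?_
      rw [mem_Ici, ← hk]
      exact ((tentPoint s hs).monotone h3).trans ht.1
    · refine (injOn_tentMap_Iic hs.1).mono fun t ht => ?_
      rw [mem_Iic, ← hk]
      exact ht.2.trans ((tentPoint s hs).monotone h3)
  rcases h with h | h
  · exact key.infix (Substitution.ext_infix _ h)
  · have := key.infix (Substitution.ext_infix _ h)
    rw [Substitution.ext_barWord] at this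
    simpa [barWord_barWord] using this.barWord

/-- The point `2 c_s` is the preimage of the orbit point `T_s(0) = 2 - s` outside the orbit; it lies
inside an interval on which `T_s` is injective. -/
theorem exists_hasJunction_two_sub (hs : s ∈ periodicTentParams) {l : Fin (tentSize s + 1)}
    (hl : tentPoint s hs l = 2 - s) :
    ∃ a, HasJunction ((tentSubstitution s hs).ext [a]) l := by
  have hc := tentCrit_mem_Ioo hs.1
  have hmul := mul_tentCrit hs.1
  have hs2 := lt_two_of_mem_periodicTentParams hs
  have hs1 := hs.1
  have hT : tentMap s (2 * tentCrit s) = 2 - s := by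
    rw [tentMap_of_ge hs.1 (by linarith [hc.1])]
    linarith
  have hy1 : 2 * tentCrit s < 1 := by nlinarith
  have hy : ∀ j, tentPoint s hs j ≠ 2 * tentCrit s := by
    intro j hj
    have := injOn_tentMap_tentOrbit hs (zero_mem_tentOrbit hs) (hj ▸ tentPoint_mem hs j)
      (by rw [hT, tentMap_zero hs.1])
    linarith [hc.1]
  obtain ⟨i, hi⟩ := exists_mem_tentInterval hs (t := 2 * tentCrit s) ⟨by linarith [hc.1], hy1.le⟩
  have hi' := mem_Ioo_of_mem_Icc hi hy
  obtain ⟨w₁, w₂, hw, h1, h2⟩ := (realizes_tentMap hs i).split hi (hT.trans hl.symm)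
  refine ⟨(i, true), ?_⟩
  rw [Substitution.ext_singleton, hw]
  exact hasJunction_of_injOn h1 h2 (h1.ne_nil hi'.1) (h2.ne_nil hi'.2)
    (injOn_tentMap_tentInterval hs i) (hT.trans hl.symm)

theorem exists_hasJunction_iterate (hs : s ∈ periodicTentParams) (m : ℕ)
    (hm : ∀ k < m, (tentMap s)^[k] (2 - s) ≠ tentCrit s) {l : Fin (tentSize s + 1)}
    (hl : tentPoint s hs l = (tentMap s)^[m] (2 - s)) :
    ∃ a, HasJunction ((tentSubstitution s hs).ext^[m + 1] [a]) l := by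
  induction m generalizing l with
  | zero => exact exists_hasJunction_two_sub hs hl
  | succ m ih =>
    have hmem : (tentMap s)^[m] (2 - s) ∈ tentOrbit s := by
      rw [← tentMap_zero hs.1]
      exact iterate_mem_tentOrbit hs (tentMap_mem_tentOrbit hs (zero_mem_tentOrbit hs)) m
    obtain ⟨l', hl'⟩ := (mem_tentOrbit_iff hs _).1 hmem
    obtain ⟨a, ha⟩ := ih (fun k hk => hm k (hk.trans m.lt_succ_self)) hl'
    refine ⟨a, ?_⟩
    rw [Function.iterate_succ_apply']
    refine ha.map_tentSubstitution hs ?_ ?_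
    · rw [hl']; exact hm m m.lt_succ_self
    · rw [hl', hl, Function.iterate_succ_apply']

/-- The path `T_s^N` passes straight through every vertex other than `0` and `1`, for all
large `N`. -/
theorem exists_forall_hasJunction (hs : s ∈ periodicTentParams) (l : Fin (tentSize s + 1))
    (h0 : l ≠ 0) (h1 : l ≠ Fin.last _) :
    ∃ N₀, ∀ N ≥ N₀, ∃ a, HasJunction ((tentSubstitution s hs).ext^[N] [a]) l := by
  have hp3 := three_le_minimalPeriod hs
  have hper := Function.iterate_minimalPeriod (f := tentMap s) (x := tentCrit s)
  have hthree : (tentMap s)^[3] (tentCrit s) = 2 - s := by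
    simp only [Function.iterate_succ_apply, Function.iterate_zero_apply, tentMap_tentCrit hs.1,
      tentMap_one hs.1, tentMap_zero hs.1]
  obtain ⟨i, hi3, hip, hi⟩ : ∃ i, 3 ≤ i ∧ i ≤ Function.minimalPeriod (tentMap s) (tentCrit s) ∧
      (tentMap s)^[i] (tentCrit s) = tentPoint s hs l := by
    have hmem := tentPoint_mem hs l
    simp only [tentOrbit, Finset.mem_image, Finset.mem_range] at hmem
    obtain ⟨i, hip, hi⟩ := hmem
    rcases i with _ | _ | _ | i
    · exact ⟨_, hp3, le_rfl, hper.trans hi⟩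
    · refine absurd ((tentPoint s hs).injective ?_) h1
      rw [tentPoint_last, ← hi]
      exact tentMap_tentCrit hs.1
    · refine absurd ((tentPoint s hs).injective ?_) h0
      rw [tentPoint_zero, ← hi]
      simp only [Function.iterate_succ_apply, Function.iterate_zero_apply, tentMap_tentCrit hs.1,
        tentMap_one hs.1]
    · exact ⟨_, by omega, hip.le, hi⟩
  obtain ⟨m, rfl⟩ : ∃ m, i = m + 3 := ⟨i - 3, by omega⟩
  rw [Function.iterate_add_apply, hthree] at hi
  obtain ⟨a, ha⟩ := exists_hasJunction_iterate hs m (fun k hk e => by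
    rw [← hthree, ← Function.iterate_add_apply] at e
    exact Function.not_isPeriodicPt_of_pos_of_lt_minimalPeriod (by omega) (by omega) e) hi.symm
  refine ⟨m + 1, fun N hN => ?_⟩
  obtain ⟨b, hb⟩ := exists_mem_iterate_tentSubstitution hs a (N - (m + 1))
  refine ⟨b, ha.infix ?_⟩
  have h2 : [a] <:+: (tentSubstitution s hs).ext^[N - (m + 1)] [b] := by
    obtain ⟨w₁, w₂, e⟩ := List.append_of_mem hb
    exact ⟨w₁, w₂, by simp [e]⟩
  have h3 := (tentSubstitution s hs).iterate_ext_infix (m + 1) h2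
  rwa [← Function.iterate_add_apply, show m + 1 + (N - (m + 1)) = N by omega] at h3

end Tent

/-! ### From interleaved maps to a homeomorphism -/

section Interleaving

variable {s : ℝ}

theorem iterate_tentMap_apply {z : ℕ → ℝ} (hz : z ∈ tentInverseLimit s) (j k : ℕ) :
    (tentMap s)^[j] (z (k + j)) = z k := by
  induction j with
  | zero => rfl
  | succ j ih => rw [Function.iterate_succ_apply, ← add_assoc, hz.2, ih]

/-- The point of the inverse limit with the prescribed coordinates `e i` at the levels `L i`. -/
noncomputable def limitPoint (s : ℝ) (L : ℕ → ℕ) (e : ℕ → ℝ) (k : ℕ) : ℝ :=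
  (tentMap s)^[L k - k] (e k)

variable {L M : ℕ → ℕ} {e : ℕ → ℝ}

theorem iterate_tentMap_levels (hL : ∀ i, L (i + 1) = L i + M i)
    (he : ∀ i, (tentMap s)^[M i] (e (i + 1)) = e i) (i j : ℕ) :
    (tentMap s)^[L (i + j) - L i] (e (i + j)) = e i ∧ L i ≤ L (i + j) := by
  induction j with
  | zero => simp
  | succ j ih =>
    have h1 := hL (i + j)
    have h2 : L (i + (j + 1)) - L i = (L (i + j) - L i) + M (i + j) := by
      rw [← add_assoc, h1]; omega
    refine ⟨?_, by rw [← add_assoc, h1]; omega⟩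
    rw [h2, Function.iterate_add_apply, ← add_assoc, he, ih.1]

theorem limitPoint_eq (hL : ∀ i, L (i + 1) = L i + M i) (hL' : ∀ i, i ≤ L i)
    (he : ∀ i, (tentMap s)^[M i] (e (i + 1)) = e i) (k j : ℕ) :
    limitPoint s L e k = (tentMap s)^[L (k + j) - k] (e (k + j)) := by
  obtain ⟨h1, h2⟩ := iterate_tentMap_levels hL he k j
  have h3 := hL' k
  rw [limitPoint, ← h1, ← Function.iterate_add_apply]
  congr 1
  rw [show L k - k + (L (k + j) - L k) = L (k + j) - k by omega]

theorem limitPoint_mem (hs : 1 < s) (hs' : s ≤ 2) (hL : ∀ i, L (i + 1) = L i + M i)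
    (hL' : ∀ i, i ≤ L i) (he : ∀ i, (tentMap s)^[M i] (e (i + 1)) = e i)
    (he' : ∀ i, e i ∈ Icc (0 : ℝ) 1) : limitPoint s L e ∈ tentInverseLimit s := by
  refine ⟨fun k => (mapsTo_tentMap hs hs').iterate _ (he' k), fun k => ?_⟩
  rw [limitPoint_eq hL hL' he k 1, limitPoint, ← Function.iterate_succ_apply' (tentMap s)]
  have := hL' (k + 1)
  congr 2
  omega

theorem limitPoint_level (hL : ∀ i, L (i + 1) = L i + M i) (hL' : ∀ i, i ≤ L i)
    (he : ∀ i, (tentMap s)^[M i] (e (i + 1)) = e i) (i : ℕ) : limitPoint s L e (L i) = e i := by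
  obtain ⟨j, hj⟩ := Nat.exists_eq_add_of_le (hL' i)
  rw [limitPoint_eq hL hL' he (L i) 0]
  have h := (iterate_tentMap_levels hL he i j).1
  rw [← hj] at h
  exact h

theorem tentInverseLimit_ext {z z' : ℕ → ℝ} (hz : z ∈ tentInverseLimit s)
    (hz' : z' ∈ tentInverseLimit s) (hL' : ∀ i, i ≤ L i) (h : ∀ i, z (L i) = z' (L i)) :
    z = z' := by
  funext k
  obtain ⟨j, hj⟩ := Nat.exists_eq_add_of_le (hL' k)
  rw [← iterate_tentMap_apply hz j, ← iterate_tentMap_apply hz' j, ← hj, h]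

/-- Maps between the two intervals that interleave iterates of the two tent maps induce mutually
inverse maps between the inverse limits. -/
theorem nonempty_homeomorph_of_interleaved {s₁ s₂ : ℝ} (h₁ : 1 < s₁) (h₁' : s₁ ≤ 2) (h₂ : 1 < s₂)
    (h₂' : s₂ ≤ 2) {N M : ℕ → ℕ} (hN : ∀ i, 0 < N i) (hM : ∀ i, 0 < M i) {p q : ℕ → ℝ → ℝ}
    (hp : ∀ i, MapsTo (p i) (Icc 0 1) (Icc 0 1)) (hq : ∀ i, MapsTo (q i) (Icc 0 1) (Icc 0 1))
    (hpc : ∀ i, ContinuousOn (p i) (Icc 0 1)) (hqc : ∀ i, ContinuousOn (q i) (Icc 0 1))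
    (hpq : ∀ i, ∀ t ∈ Icc (0 : ℝ) 1, p i (q i t) = (tentMap s₂)^[M i] t)
    (hqp : ∀ i, ∀ t ∈ Icc (0 : ℝ) 1, q i (p (i + 1) t) = (tentMap s₁)^[N i] t) :
    Nonempty (tentInverseLimit s₁ ≃ₜ tentInverseLimit s₂) := by
  set K : ℕ → ℕ := fun i => ∑ j ∈ Finset.range i, N j
  set L : ℕ → ℕ := fun i => ∑ j ∈ Finset.range i, M j
  have hK : ∀ i, K (i + 1) = K i + N i := fun i => Finset.sum_range_succ _ _
  have hL : ∀ i, L (i + 1) = L i + M i := fun i => Finset.sum_range_succ _ _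
  have hK' : ∀ i, i ≤ K i := by
    intro i
    induction i with
    | zero => exact Nat.zero_le _
    | succ i ih => have := hN i; rw [hK]; omega
  have hL' : ∀ i, i ≤ L i := by
    intro i
    induction i with
    | zero => exact Nat.zero_le _
    | succ i ih => have := hM i; rw [hL]; omega
  have hA : ∀ x : tentInverseLimit s₁, ∀ i,
      (tentMap s₂)^[M i] (p (i + 1) (x.1 (K (i + 1)))) = p i (x.1 (K i)) := by
    intro x i
    rw [← hpq i _ (hp _ (x.2.1 _)), hqp i _ (x.2.1 _), hK, iterate_tentMap_apply x.2]
  have hB : ∀ y : tentInverseLimit s₂, ∀ i,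
      (tentMap s₁)^[N i] (q (i + 1) (y.1 (L (i + 1 + 1)))) = q i (y.1 (L (i + 1))) := by
    intro y i
    rw [← hqp i _ (hq _ (y.2.1 _)), hpq (i + 1) _ (y.2.1 _), hL (i + 1),
      iterate_tentMap_apply y.2]
  have hA' : ∀ (x : tentInverseLimit s₁) i, p i (x.1 (K i)) ∈ Icc (0 : ℝ) 1 :=
    fun x i => hp _ (x.2.1 _)
  have hB' : ∀ (y : tentInverseLimit s₂) i, q i (y.1 (L (i + 1))) ∈ Icc (0 : ℝ) 1 :=
    fun y i => hq _ (y.2.1 _)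
  let F : tentInverseLimit s₁ → tentInverseLimit s₂ := fun x =>
    ⟨limitPoint s₂ L fun i => p i (x.1 (K i)), limitPoint_mem h₂ h₂' hL hL' (hA x) (hA' x)⟩
  let G : tentInverseLimit s₂ → tentInverseLimit s₁ := fun y =>
    ⟨limitPoint s₁ K fun i => q i (y.1 (L (i + 1))), limitPoint_mem h₁ h₁' hK hK' (hB y) (hB' y)⟩
  have hF : ∀ x i, (F x).1 (L i) = p i (x.1 (K i)) := fun x =>
    limitPoint_level (e := fun i => p i (x.1 (K i))) hL hL' (hA x)
  have hG : ∀ y i, (G y).1 (K i) = q i (y.1 (L (i + 1))) := fun y =>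
    limitPoint_level (e := fun i => q i (y.1 (L (i + 1)))) hK hK' (hB y)
  refine ⟨{
    toFun := F
    invFun := G
    left_inv := fun x => Subtype.ext (tentInverseLimit_ext (G (F x)).2 x.2 hK' fun i => ?_)
    right_inv := fun y => Subtype.ext (tentInverseLimit_ext (F (G y)).2 y.2 hL' fun i => ?_)
    continuous_toFun := ?_
    continuous_invFun := ?_ }⟩
  · rw [hG, hF, hqp i _ (x.2.1 _), hK, iterate_tentMap_apply x.2]
  · rw [hF, hG, hpq i _ (y.2.1 _), hL, iterate_tentMap_apply y.2]
  · refine Continuous.subtype_mk (continuous_pi fun k => ?_) _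
    exact ((continuous_tentMap h₂).iterate _).comp ((hpc k).comp_continuous
      ((continuous_apply _).comp continuous_subtype_val) fun x => x.2.1 _)
  · refine Continuous.subtype_mk (continuous_pi fun k => ?_) _
    exact ((continuous_tentMap h₁).iterate _).comp ((hqc k).comp_continuous
      ((continuous_apply _).comp continuous_subtype_val) fun x => x.2.1 _)

/-! ### Weak equivalence gives a homeomorphism -/

theorem isLegal_iterate_tentSubstitution (hs : s ∈ periodicTentParams) (N : ℕ)
    (b : Letter (tentSize s)) : IsLegal ((tentSubstitution s hs).ext^[N] [b]) := by
  rcases b with ⟨i, _ | _⟩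
  · have : [(i, false)] = barWord [((i, true) : Letter (tentSize s))] := rfl
    rw [this, Substitution.iterate_ext_barWord]
    exact (traverses_iterate_tentMap hs i N).isLegal.barWord
  · exact (traverses_iterate_tentMap hs i N).isLegal

theorem infix_of_mem {α : Type*} {a : α} {w : List α} (h : a ∈ w) : [a] <:+: w := by
  obtain ⟨w₁, w₂, e⟩ := List.append_of_mem h
  exact ⟨w₁, w₂, by simp [e]⟩

variable {s₁ s₂ : ℝ} {h₁ : s₁ ∈ periodicTentParams} {h₂ : s₂ ∈ periodicTentParams}
  {N : ℕ → ℕ} {σ : ℕ → Substitution (tentSize s₂) (tentSize s₁)}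
  {τ : ℕ → Substitution (tentSize s₁) (tentSize s₂)}

/-- The substitutions `τᵢ χ^R σ_{i+l+1}` telescope to powers of `ψ`, with exponents `R` that grow
with `l`. -/
theorem exists_interleaved_iterate {n m : ℕ} {χ : Substitution n n} {ψ : Substitution m m}
    {σ : ℕ → Substitution m n} {τ : ℕ → Substitution n m} (hN0 : ∀ i, 0 < N i)
    (hN : ∀ i, (σ i).ext ∘ (τ i).ext = χ.ext^[N i])
    (hM : ∀ i, (τ i).ext ∘ (σ (i + 1)).ext = ψ.ext^[M i]) (l i : ℕ) :
    ∃ R R', l ≤ R ∧ (l = 0 → R = 0) ∧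
      ∀ w, (τ i).ext (χ.ext^[R] ((σ (i + l + 1)).ext w)) = ψ.ext^[R'] w := by
  induction l generalizing i with
  | zero => exact ⟨0, M i, le_rfl, fun _ => rfl, fun w => congrFun (hM i) w⟩
  | succ l ih =>
    obtain ⟨R, R', hR, -, h⟩ := ih (i + 1)
    refine ⟨N (i + 1) + R, M i + R', by have := hN0 (i + 1); omega, by omega, fun w => ?_⟩
    rw [Function.iterate_add_apply, ← hN, Function.iterate_add_apply, ← hM, ← h]
    simp only [Function.comp_apply]
    rw [show i + (l + 1) + 1 = i + 1 + l + 1 by omega]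

/-- In a weak equivalence of tent substitutions the connecting substitutions are legal: every pair
of neighbouring letters occurs in an image `χ^R(a)`, hence its image under `τᵢ` occurs in a word
`ψ^R'(b)`, which is the word of a path. -/
theorem isLegal_of_interleaved (hN0 : ∀ i, 0 < N i)
    (hN : ∀ i, (σ i).ext ∘ (τ i).ext = (tentSubstitution s₁ h₁).ext^[N i])
    (hM : ∀ i, (τ i).ext ∘ (σ (i + 1)).ext = (tentSubstitution s₂ h₂).ext^[M i]) (i : ℕ) :
    (τ i).IsLegal := by
  have hocc : ∀ j a, ∃ b, a ∈ (σ j).ext [b] := by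
    intro j a
    obtain ⟨c, hc⟩ := exists_mem_iterate_tentSubstitution h₁ a (N j)
    rw [← hN] at hc
    simp only [Function.comp_apply, Substitution.ext, List.mem_flatMap] at hc
    obtain ⟨b, -, hb⟩ := hc
    exact ⟨b, by rwa [Substitution.ext_singleton]⟩
  have hleg : ∀ l, ∃ R, l ≤ R ∧ (l = 0 → R = 0) ∧
      ∀ a, IsLegal ((τ i).ext ((tentSubstitution s₁ h₁).ext^[R] [a])) := by
    intro l
    obtain ⟨R, R', hR, hR0, h⟩ := exists_interleaved_iterate hN0 hN hM l i
    refine ⟨R, hR, hR0, fun a => ?_⟩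
    obtain ⟨b, hb⟩ := hocc (i + l + 1) a
    refine (isLegal_iterate_tentSubstitution h₂ R' b).infix ?_
    rw [← h]
    exact Substitution.ext_infix _ (Substitution.iterate_ext_infix _ _ (infix_of_mem hb))
  refine ⟨fun a => ?_, fun a b hab => ?_⟩
  · obtain ⟨R, -, hR, h⟩ := hleg 0
    obtain rfl := hR rfl
    simpa [Substitution.ext_singleton] using h (a, true)
  · obtain ⟨l, hl⟩ := exists_forall_hasJunction h₁ a.succ (Fin.succ_ne_zero a) (by
      rw [hab]; exact (Fin.castSucc_lt_last b).ne)
    obtain ⟨R, hR, -, h⟩ := hleg l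
    obtain ⟨c, i', j', hi', hj', hc⟩ := hl R hR
    obtain rfl := Fin.succ_injective _ hi'
    obtain rfl := Fin.castSucc_injective _ (hj'.trans hab)
    have e : (τ i).toFun (i', true) ++ (τ i).toFun (j', true) =
        (τ i).ext [(i', true), (j', true)] := by
      rw [Substitution.ext_cons, Substitution.ext_singleton]
    rw [e]
    rcases hc with hc | hc
    · exact (h c).infix (Substitution.ext_infix _ hc)
    · refine (h c).barWord.infix ?_
      rw [← Substitution.ext_barWord]
      exact Substitution.ext_infix _ hc

theorem nonempty_homeomorph_of_weaklyEquivalent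
    (h : WeaklyEquivalent (tentSubstitution s₁ h₁) (tentSubstitution s₂ h₂)) :
    Nonempty (tentInverseLimit s₁ ≃ₜ tentInverseLimit s₂) := by
  obtain ⟨N, M, σ, τ, hN0, hM0, hN, hM⟩ := h
  have hτ := isLegal_of_interleaved hN0 hN hM
  have hσ : ∀ i, (σ (i + 1)).IsLegal :=
    isLegal_of_interleaved (σ := τ) (τ := fun i => σ (i + 1)) hM0 hM fun i => hN (i + 1)
  have hn := tentSize_pos h₁
  have hm := tentSize_pos h₂
  have hstep : ∀ i (p : {p // Realizes (tentPoint s₁ h₁) (tentPoint s₂ h₂) p (τ i)}),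
      ∃ (q : {q // Realizes (tentPoint s₂ h₂) (tentPoint s₁ h₁) q (σ (i + 1))})
        (p' : {p // Realizes (tentPoint s₁ h₁) (tentPoint s₂ h₂) p (τ (i + 1))}),
        (∀ t ∈ Icc (0 : ℝ) 1, p.1 (q.1 t) = (tentMap s₂)^[M i] t) ∧
        (∀ t ∈ Icc (0 : ℝ) 1, q.1 (p'.1 t) = (tentMap s₁)^[N (i + 1)] t) := by
    intro i p
    obtain ⟨q, hq, hpq⟩ := p.2.exists_lift hm (hσ i) (g := (tentMap s₂)^[M i])
      (z := tentPoint s₂ h₂) fun j => by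
        have := traverses_iterate_tentMap h₂ j (M i)
        rwa [← hM, Function.comp_apply, Substitution.ext_singleton] at this
    obtain ⟨p', hp', hqp⟩ := hq.exists_lift hn (hτ (i + 1)) (g := (tentMap s₁)^[N (i + 1)])
      (z := tentPoint s₁ h₁) fun j => by
        have := traverses_iterate_tentMap h₁ j (N (i + 1))
        rwa [← hN, Function.comp_apply, Substitution.ext_singleton] at this
    rw [tentPoint_zero, tentPoint_last] at hpq hqp
    exact ⟨⟨q, hq⟩, ⟨p', hp'⟩, hpq, hqp⟩
  choose Q P hPQ hQP using hstep
  obtain ⟨p₀, hp₀⟩ := (hτ 0).exists_realizes (tentPoint s₁ h₁) (tentPoint s₂ h₂)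
  let p : ∀ i, {p // Realizes (tentPoint s₁ h₁) (tentPoint s₂ h₂) p (τ i)} :=
    fun i => Nat.rec ⟨p₀, hp₀⟩ (fun i p => P i p) i
  refine nonempty_homeomorph_of_interleaved h₁.1 h₁.2.1 h₂.1 h₂.2.1 (N := fun i => N (i + 1))
    (M := M) (fun i => hN0 _) hM0 (p := fun i => (p i).1) (q := fun i => (Q i (p i)).1)
    (fun i => ?_) (fun i => ?_) (fun i => ?_) (fun i => ?_) (fun i => hPQ i (p i))
    (fun i => hQP i (p i))
  · have := (p i).2.mapsTo hn
    rwa [tentPoint_zero, tentPoint_last, tentPoint_zero, tentPoint_last] at this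
  · have := (Q i (p i)).2.mapsTo hm
    rwa [tentPoint_zero, tentPoint_last, tentPoint_zero, tentPoint_last] at this
  · have := (p i).2.continuousOn hn
    rwa [tentPoint_zero, tentPoint_last] at this
  · have := (Q i (p i)).2.continuousOn hm
    rwa [tentPoint_zero, tentPoint_last] at this

end Interleaving

/-! ### Crossings and itineraries of paths, up to a tolerance -/

section Itineraries

variable {n m : ℕ}

/-- During `[u, v]` the path `p` goes successively from the start to the end of each letter of the
word, up to the tolerance `δ`. What it does between these times is not prescribed. -/
inductive Crosses (x : Fin (n + 1) ↪o ℝ) (p : ℝ → ℝ) (δ : ℝ) : ℝ → ℝ → List (Letter n) → Prop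
  | nil {u v : ℝ} (h : u ≤ v) : Crosses x p δ u v []
  | cons {u s t v : ℝ} {b : Letter n} {w : List (Letter n)} (hus : u ≤ s) (hst : s ≤ t)
      (hs : |p s - x b.src| ≤ δ) (ht : |p t - x b.tgt| ≤ δ) (h : Crosses x p δ t v w) :
      Crosses x p δ u v (b :: w)

variable {x : Fin (n + 1) ↪o ℝ} {y : Fin (m + 1) ↪o ℝ} {p q r : ℝ → ℝ}
  {δ δ₁ δ₂ ε η γ u t v a c : ℝ} {b : Letter n} {w w' : List (Letter n)}

theorem Crosses.le (h : Crosses x p δ u v w) : u ≤ v := by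
  induction h with
  | nil h => exact h
  | cons hus hst _ _ _ ih => exact hus.trans (hst.trans ih)

theorem Crosses.mono (h : Crosses x p δ u v w) (hδ : δ ≤ ε) : Crosses x p ε u v w := by
  induction h with
  | nil h => exact .nil h
  | cons hus hst hs ht _ ih => exact .cons hus hst (hs.trans hδ) (ht.trans hδ) ih

theorem Crosses.extend_left (h : Crosses x p δ u v w) (hu : t ≤ u) : Crosses x p δ t v w := by
  cases h with
  | nil h => exact .nil (hu.trans h)
  | cons hus hst hs ht h => exact .cons (hu.trans hus) hst hs ht h

theorem Crosses.extend_right (h : Crosses x p δ u v w) (hv : v ≤ t) : Crosses x p δ u t w := by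
  induction h with
  | nil h => exact .nil (h.trans hv)
  | cons hus hst hs ht _ ih => exact .cons hus hst hs ht (ih hv)

theorem Crosses.append (h : Crosses x p δ u t w) (h' : Crosses x p δ t v w') :
    Crosses x p δ u v (w ++ w') := by
  induction h with
  | nil h => exact h'.extend_left h
  | cons hus hst hs ht _ ih => exact .cons hus hst hs ht (ih h')

theorem Crosses.neg (h : Crosses x p δ u v w) :
    Crosses x (fun t => p (-t)) δ (-v) (-u) (barWord w) := by
  induction h with
  | nil h => exact .nil (neg_le_neg h)
  | cons hus hst hs ht _ ih =>
    rw [barWord_cons]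
    refine ih.append (.cons le_rfl (neg_le_neg hst) ?_ ?_ (.nil (neg_le_neg hus)))
    · rwa [neg_neg, Letter.src_bar]
    · rwa [neg_neg, Letter.tgt_bar]

theorem Crosses.perturb (h : Crosses x p δ u v w) (hq : ∀ t ∈ Icc u v, |q t - p t| ≤ η) :
    Crosses x q (δ + η) u v w := by
  induction h with
  | nil h => exact .nil h
  | @cons u s t v b w hus hst hs ht h ih =>
    have htv := h.le
    refine .cons hus hst ?_ ?_ (ih fun e he => hq e ⟨(hus.trans hst).trans he.1, he.2⟩)
    · have := abs_sub_le (q s) (p s) (x b.src)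
      linarith [hq s ⟨hus, hst.trans htv⟩]
    · have := abs_sub_le (q t) (p t) (x b.tgt)
      linarith [hq t ⟨hus.trans hst, htv⟩]

theorem Crosses.of_comp (h : Crosses x (fun t => q (p t)) δ u v w)
    (hp : MonotoneOn p (Icc u v)) : Crosses x q δ (p u) (p v) w := by
  induction h with
  | nil h => exact .nil (hp ⟨le_rfl, h⟩ ⟨h, le_rfl⟩ h)
  | @cons u s t v b w hus hst hs ht h ih =>
    have htv := h.le
    refine .cons (hp ⟨le_rfl, by linarith⟩ ⟨hus, by linarith⟩ hus)
      (hp ⟨hus, by linarith⟩ ⟨by linarith, htv⟩ hst) hs ht (ih (hp.mono ?_))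
    exact Icc_subset_Icc_left (hus.trans hst)

/-- Crossings of `q` are crossings of `q ∘ p` if `p` runs through the domain of `q` except for two
short pieces at its ends. -/
theorem Crosses.comp (h : Crosses x q δ c a w) (hp : ContinuousOn p (Icc u v)) (huv : u ≤ v)
    (hpu : p u = max (p u) (min c (p v))) (hle : p u ≤ p v)
    (hη : ∀ s ∈ Icc c a, |q (max (p u) (min s (p v))) - q s| ≤ η) :
    Crosses x (fun t => q (p t)) (δ + η) u v w := by
  have key : ∀ c' a' w', Crosses x q δ c' a' w' →
      (∀ s ∈ Icc c a', |q (max (p u) (min s (p v))) - q s| ≤ η) → c ≤ c' → ∀ u' ∈ Icc u v,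
      p u' = max (p u) (min c' (p v)) → Crosses x (fun t => q (p t)) (δ + η) u' v w' := by
    intro c' a' w' h'
    induction h' with
    | nil h => intro _ _ u' hu' _; exact .nil hu'.2
    | @cons c' s t a' b w hcs hst hs ht h ih =>
      intro hη hcc u' hu' hpu'
      have hta := h.le
      have hv : ∀ e, max (p u) (min e (p v)) ≤ p v := fun e => max_le hle (min_le_right _ _)
      have hmono : ∀ {e e' : ℝ}, e ≤ e' → max (p u) (min e (p v)) ≤ max (p u) (min e' (p v)) :=
        fun h => max_le_max le_rfl (min_le_min h le_rfl)
      obtain ⟨s', hs', es⟩ := intermediate_value_Icc hu'.2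
        (hp.mono (Icc_subset_Icc_left hu'.1)) (show max (p u) (min s (p v)) ∈ Icc (p u') (p v) from
          ⟨hpu' ▸ hmono hcs, hv _⟩)
      obtain ⟨t', ht', et⟩ := intermediate_value_Icc hs'.2
        (hp.mono (Icc_subset_Icc_left (hu'.1.trans hs'.1)))
        (show max (p u) (min t (p v)) ∈ Icc (p s') (p v) from ⟨es ▸ hmono hst, hv _⟩)
      refine .cons hs'.1 ht'.1 ?_ ?_ (ih hη (by linarith) t'
        ⟨hu'.1.trans (hs'.1.trans ht'.1), ht'.2⟩ et)
      · have := abs_sub_le (q (p s')) (q s) (x b.src)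
        rw [es] at this ⊢
        linarith [hη s ⟨by linarith, by linarith⟩]
      · have := abs_sub_le (q (p t')) (q t) (x b.tgt)
        rw [et] at this ⊢
        linarith [hη t ⟨by linarith, by linarith⟩]
  exact key c a w h hη le_rfl u ⟨le_rfl, huv⟩ hpu

theorem exists_abs_sub_le_of_le (hp : ContinuousOn p (Icc u v)) (huv : u ≤ v) (hδ : 0 ≤ δ)
    (hu : p u ≤ c + δ) (hv : c - δ ≤ p v) : ∃ t ∈ Icc u v, |p t - c| ≤ δ := by
  rcases le_or_gt c (p u) with h | h
  · exact ⟨u, ⟨le_rfl, huv⟩, abs_le.2 ⟨by linarith, by linarith⟩⟩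
  rcases le_or_gt (p v) c with h' | h'
  · exact ⟨v, ⟨huv, le_rfl⟩, abs_le.2 ⟨by linarith, by linarith⟩⟩
  obtain ⟨t, ht, e⟩ := intermediate_value_Icc huv hp ⟨h.le, h'.le⟩
  exact ⟨t, ht, by rw [e]; simpa⟩

theorem exists_abs_sub_le_of_ge (hp : ContinuousOn p (Icc u v)) (huv : u ≤ v) (hδ : 0 ≤ δ)
    (hu : c - δ ≤ p u) (hv : p v ≤ c + δ) : ∃ t ∈ Icc u v, |p t - c| ≤ δ := by
  obtain ⟨t, ht, h⟩ := exists_abs_sub_le_of_le (p := fun t => -p t) (c := -c) hp.neg huv hδ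
    (by linarith) (by linarith)
  refine ⟨t, ht, ?_⟩
  rwa [← abs_neg, show -(p t - c) = -p t - -c by ring]

/-- A time at which the path is close to a vertex splits its crossings: a letter crossed around that
time is crossed before it or after it. -/
theorem Crosses.split (h : Crosses x p δ u v w) (hp : ContinuousOn p (Icc u v)) (ht : t ∈ Icc u v)
    {j : Fin (n + 1)} (hj : |p t - x j| ≤ δ) :
    ∃ w₁ w₂, w = w₁ ++ w₂ ∧ Crosses x p δ u t w₁ ∧ Crosses x p δ t v w₂ := by
  have hδ : 0 ≤ δ := (abs_nonneg _).trans hj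
  induction h with
  | nil h => exact ⟨[], [], rfl, .nil ht.1, .nil ht.2⟩
  | @cons u s e v b w hus hse hs he h ih =>
    have hev := h.le
    rcases le_or_gt e t with h1 | h1
    · obtain ⟨w₁, w₂, rfl, h2, h3⟩ := ih (hp.mono (Icc_subset_Icc_left (hus.trans hse))) ⟨h1, ht.2⟩
      exact ⟨b :: w₁, w₂, rfl, .cons hus hse hs he h2, h3⟩
    rcases le_or_gt t s with h2 | h2
    · exact ⟨[], b :: w, rfl, .nil ht.1, .cons h2 hse hs he h⟩
    have hpr : ContinuousOn p (Icc t e) := hp.mono (Icc_subset_Icc ht.1 hev)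
    have hpl : ContinuousOn p (Icc s t) := hp.mono (Icc_subset_Icc hus ht.2)
    suffices (∃ s' ∈ Icc t e, |p s' - x b.src| ≤ δ) ∨ ∃ e' ∈ Icc s t, |p e' - x b.tgt| ≤ δ by
      rcases this with ⟨s', hs', h3⟩ | ⟨e', he', h3⟩
      · exact ⟨[], b :: w, rfl, .nil ht.1, .cons hs'.1 hs'.2 h3 he h⟩
      · exact ⟨[b], w, rfl, .cons hus he'.1 hs h3 (.nil he'.2), h.extend_left h1.le⟩
    rw [abs_le] at hj hs he
    obtain ⟨i, e'⟩ := b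
    have hlt := partition_lt x i
    rcases le_or_gt j i.castSucc with h3 | h3
    · replace h3 := x.monotone h3
      rcases e' with _ | _
      · exact Or.inr (exists_abs_sub_le_of_ge hpl h2.le hδ (c := x i.castSucc)
          (by change _ ∧ p s - x i.succ ≤ δ at hs; linarith [show -δ ≤ p s - x i.succ from hs.1])
          (by linarith))
      · exact Or.inl (exists_abs_sub_le_of_le hpr h1.le hδ (c := x i.castSucc) (by linarith)
          (by linarith [show -δ ≤ p e - x i.succ from he.1]))
    · replace h3 := x.monotone (Fin.castSucc_lt_iff_succ_le.1 h3)
      rcases e' with _ | _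
      · exact Or.inl (exists_abs_sub_le_of_ge hpr h1.le hδ (c := x i.succ) (by linarith)
          (by linarith [show p e - x i.castSucc ≤ δ from he.2]))
      · exact Or.inr (exists_abs_sub_le_of_le hpl h2.le hδ (c := x i.succ)
          (by linarith [show p s - x i.castSucc ≤ δ from hs.2]) (by linarith))

/-- The word `w` is crossed with tolerance `δ₁` and is the longest word crossed with tolerance `δ₂`,
in the strong sense that it contains all of them as sublists. For `δ₁ ≤ δ₂` it is
determined by the path, and stable under small perturbations. -/
def HasItinerary (x : Fin (n + 1) ↪o ℝ) (p : ℝ → ℝ) (δ₁ δ₂ u v : ℝ) (w : List (Letter n)) : Prop :=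
  Crosses x p δ₁ u v w ∧ ∀ w', Crosses x p δ₂ u v w' → w'.Sublist w

theorem HasItinerary.unique {δ₁' δ₂' : ℝ} (h : HasItinerary x p δ₁ δ₂ u v w)
    (h' : HasItinerary x p δ₁' δ₂' u v w') (h₁ : δ₁ ≤ δ₂') (h₂ : δ₁' ≤ δ₂) : w = w' :=
  (h'.2 _ (h.1.mono h₁)).antisymm (h.2 _ (h'.1.mono h₂))

theorem HasItinerary.neg (h : HasItinerary x p δ₁ δ₂ u v w) :
    HasItinerary x (fun t => p (-t)) δ₁ δ₂ (-v) (-u) (barWord w) := by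
  refine ⟨h.1.neg, fun w' h' => ?_⟩
  have := h'.neg
  simp only [neg_neg] at this
  simpa [barWord_barWord] using (h.2 _ this).barWord

theorem HasItinerary.perturb (h : HasItinerary x p δ₁ δ₂ u v w)
    (hq : ∀ t ∈ Icc u v, |q t - p t| ≤ η) : HasItinerary x q (δ₁ + η) (δ₂ - η) u v w := by
  refine ⟨h.1.perturb hq, fun w' h' => h.2 _ ?_⟩
  have := h'.perturb (q := p) (η := η) fun t ht => by rw [abs_sub_comm]; exact hq t ht
  rwa [sub_add_cancel] at this

theorem HasItinerary.append (h : HasItinerary x p δ₁ δ₂ u t w)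
    (h' : HasItinerary x p δ₁ δ₂ t v w') (hp : ContinuousOn p (Icc u v)) {j : Fin (n + 1)}
    (hj : |p t - x j| ≤ δ₂) : HasItinerary x p δ₁ δ₂ u v (w ++ w') := by
  refine ⟨h.1.append h'.1, fun w'' h'' => ?_⟩
  obtain ⟨w₁, w₂, rfl, h₁, h₂⟩ := h''.split hp ⟨h.1.le, h'.1.le⟩ hj
  exact (h.2 _ h₁).append (h'.2 _ h₂)

theorem HasItinerary.comp (h : HasItinerary x q δ₁ δ₂ a c w) (hp : ContinuousOn p (Icc u v))
    (hm : MonotoneOn p (Icc u v)) (huv : u ≤ v) (hpu : a ≤ p u) (hpv : p v ≤ c)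
    (hη : ∀ s ∈ Icc a c, |q (max (p u) (min s (p v))) - q s| ≤ η) :
    HasItinerary x (fun t => q (p t)) (δ₁ + η) δ₂ u v w := by
  have hle := hm ⟨le_rfl, huv⟩ ⟨huv, le_rfl⟩ huv
  refine ⟨h.1.comp hp huv ?_ hle hη, fun w' h' => h.2 _ ?_⟩
  · rw [max_eq_left ((min_le_left _ _).trans hpu)]
  · exact ((h'.of_comp hm).extend_left hpu).extend_right hpv

theorem hasItinerary_nil (huv : u ≤ v) (hγ : ∀ i : Fin n, x i.castSucc + γ ≤ x i.succ)
    (hp : ∀ t ∈ Icc u v, |p t - c| ≤ δ) (hδ : 2 * δ₂ + 2 * δ < γ) :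
    HasItinerary x p δ₁ δ₂ u v [] := by
  refine ⟨.nil huv, fun w' h' => ?_⟩
  cases h' with
  | nil => exact .refl _
  | @cons _ s t _ b w hus hst hs ht h =>
    exfalso
    have h1 := hp s ⟨hus, hst.trans h.le⟩
    have h2 := hp t ⟨hus.trans hst, h.le⟩
    have h3 := hγ b.1
    rw [abs_le] at *
    rcases b with ⟨i, _ | _⟩ <;> simp only [Letter.src, Letter.tgt, if_true, Bool.false_eq_true,
      if_false] at * <;> linarith

theorem hasItinerary_singleton (huv : u ≤ v) (hγ : ∀ i : Fin n, x i.castSucc + γ ≤ x i.succ)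
    {i : Fin n} (hm : MonotoneOn p (Icc u v))
    (hp : MapsTo p (Icc u v) (Icc (x i.castSucc) (x i.succ)))
    (hu : |p u - x i.castSucc| ≤ δ₁) (hv : |p v - x i.succ| ≤ δ₁) (hδ₂ : 0 ≤ δ₂)
    (hδ : 2 * δ₂ < γ) : HasItinerary x p δ₁ δ₂ u v [(i, true)] := by
  refine ⟨.cons le_rfl huv hu hv (.nil le_rfl), fun w' h' => ?_⟩
  have key : ∀ (s t : ℝ) (b : Letter n), s ∈ Icc u v → t ∈ Icc u v → s ≤ t → |p s - x b.src| ≤ δ₂ →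
      |p t - x b.tgt| ≤ δ₂ → b = (i, true) := by
    intro s t b hs ht hst h1 h2
    have h3 := hm hs ht hst
    have h4 := hp hs
    have h5 := hp ht
    rw [abs_le] at h1 h2
    have h6 := hγ b.1
    rcases b with ⟨j, _ | _⟩
    · simp only [Letter.src, Letter.tgt, Bool.false_eq_true, if_false] at *
      linarith
    · simp only [Letter.src, Letter.tgt, if_true] at *
      rcases lt_trichotomy i j with hij | rfl | hij
      · linarith [partition_succ_le x hij, h5.2]
      · rfl
      · linarith [partition_succ_le x hij, h4.1]
  cases h' with
  | nil => exact List.nil_sublist _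
  | @cons _ s t _ b w hus hst hs ht h =>
    have htv := h.le
    obtain rfl := key s t b ⟨hus, by linarith⟩ ⟨by linarith, htv⟩ hst hs ht
    cases h with
    | nil => exact .refl _
    | @cons _ s' t' _ b' w' hus' hst' hs' ht' h' =>
      exfalso
      have htv' := h'.le
      obtain rfl := key s' t' b' ⟨by linarith, by linarith⟩ ⟨by linarith, htv'⟩ hst' hs' ht'
      have h1 := hm ⟨by linarith, htv⟩ ⟨by linarith, by linarith⟩ hus'
      have h2 := hγ i
      rw [abs_le] at ht hs'
      simp only [Letter.src, Letter.tgt, if_true] at *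
      linarith

/-! ### Paths that follow a word up to a tolerance -/

/-- The path `p` is a concatenation of monotone pieces, each of which stays in the interval of a
letter and joins its ends up to `ε`, and of pieces that stay `ε`-close to a vertex; the word
records the letters. -/
inductive Follows (x : Fin (n + 1) ↪o ℝ) (p : ℝ → ℝ) (ε : ℝ) : ℝ → ℝ → List (Letter n) → Prop
  | near {u v : ℝ} (j : Fin (n + 1)) (huv : u ≤ v) (h : ∀ t ∈ Icc u v, |p t - x j| ≤ ε) :
      Follows x p ε u v []
  | up {u v : ℝ} {i : Fin n} (huv : u ≤ v) (hm : MonotoneOn p (Icc u v))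
      (hp : MapsTo p (Icc u v) (Icc (x i.castSucc) (x i.succ)))
      (hu : |p u - x i.castSucc| ≤ ε) (hv : |p v - x i.succ| ≤ ε) : Follows x p ε u v [(i, true)]
  | down {u v : ℝ} {i : Fin n} (huv : u ≤ v) (hm : AntitoneOn p (Icc u v))
      (hp : MapsTo p (Icc u v) (Icc (x i.castSucc) (x i.succ)))
      (hu : |p u - x i.succ| ≤ ε) (hv : |p v - x i.castSucc| ≤ ε) : Follows x p ε u v [(i, false)]
  | append {u t v : ℝ} {w w' : List (Letter n)} (h : Follows x p ε u t w)
      (h' : Follows x p ε t v w') : Follows x p ε u v (w ++ w')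

theorem Follows.le (h : Follows x p ε u v w) : u ≤ v := by
  induction h with
  | near _ huv => exact huv
  | up huv => exact huv
  | down huv => exact huv
  | append _ _ ih ih' => exact ih.trans ih'

theorem Follows.left (h : Follows x p ε u v w) : ∃ j, |p u - x j| ≤ ε := by
  induction h with
  | near j huv h => exact ⟨j, h _ ⟨le_rfl, huv⟩⟩
  | up huv _ _ hu => exact ⟨_, hu⟩
  | down huv _ _ hu => exact ⟨_, hu⟩
  | append _ _ ih => exact ih

theorem monotoneOn_comp_neg (hm : AntitoneOn p (Icc u v)) :
    MonotoneOn (fun t => p (-t)) (Icc (-v) (-u)) := fun _ ha _ hb hab =>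
  hm (map_neg_Icc hb) (map_neg_Icc ha) (neg_le_neg hab)

theorem Follows.hasItinerary (h : Follows x p ε u v w) (hp : ContinuousOn p (Icc u v))
    (hγ : ∀ i : Fin n, x i.castSucc + γ ≤ x i.succ) (hε : ε ≤ δ₂) (hδ : 2 * δ₂ + 2 * ε < γ)
    (hε0 : 0 ≤ ε) : HasItinerary x p ε δ₂ u v w := by
  induction h with
  | near j huv h => exact hasItinerary_nil huv hγ h hδ
  | up huv hm hpi hu hv =>
    exact hasItinerary_singleton huv hγ hm hpi hu hv (hε0.trans hε) (by linarith)
  | down huv hm hpi hu hv =>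
    have := (hasItinerary_singleton (δ₁ := ε) (neg_le_neg huv) hγ (monotoneOn_comp_neg hm)
      (fun t ht => hpi (map_neg_Icc ht)) (by rwa [neg_neg]) (by rwa [neg_neg]) (hε0.trans hε)
      (by linarith)).neg
    simp only [neg_neg] at this
    exact this
  | append h h' ih ih' =>
    obtain ⟨j, hj⟩ := h'.left
    exact (ih (hp.mono (Icc_subset_Icc_right h'.le))).append
      (ih' (hp.mono (Icc_subset_Icc_left h.le))) hp (hj.trans hε)

theorem Runs.follows (h : Runs x p u v b) : Follows x p 0 u v [b] := by
  have hu : u ∈ Icc u v := ⟨le_rfl, h.lt.le⟩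
  have hv : v ∈ Icc u v := ⟨h.lt.le, le_rfl⟩
  have hs := h.src
  have ht := h.tgt
  have hmaps := h.mapsTo
  have hm := h.cont.strictMonoOn_of_injOn_Icc' h.lt.le h.inj
  rcases b with ⟨i, _ | _⟩ <;> have hlt := partition_lt x i <;>
    simp only [Letter.src, Letter.tgt, Bool.false_eq_true, if_false, if_true] at hs ht
  · refine .down h.lt.le (hm.resolve_left fun hm => ?_).antitoneOn hmaps (by simp [hs]) (by simp [ht])
    have := hm hu hv h.lt
    linarith
  · refine .up h.lt.le (hm.resolve_right fun hm => ?_).monotoneOn hmaps (by simp [hs]) (by simp [ht])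
    have := hm hu hv h.lt
    linarith

theorem Traverses.follows (h : Traverses x p u v w) (huv : u < v) : Follows x p 0 u v w := by
  induction h with
  | nil => exact absurd huv (lt_irrefl _)
  | @cons u t v b w h h' ih =>
    rcases eq_or_ne w [] with rfl | hw
    · cases h'
      exact h.follows
    · exact h.follows.append (ih (h'.lt hw))

/-- The extension to words of a family of words `W i` for the letters `aᵢ`, compatible with bar. -/
def wordMap (W : Fin n → List (Letter m)) (w : List (Letter n)) : List (Letter m) :=
  w.flatMap fun b => if b.2 then W b.1 else barWord (W b.1)

/-- If `p` follows the word `w`, and `r` is close to `q ∘ p` for a map `q` whose itinerary on the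
interval of `aᵢ` is `W i`, then the itinerary of `r` is the image of `w`. -/
theorem Follows.hasItinerary_wordMap (h : Follows x p ε u v w) {W : Fin n → List (Letter m)}
    (hγ : ∀ i : Fin m, y i.castSucc + γ ≤ y i.succ)
    (hp : ContinuousOn p (Icc u v)) (hr : ContinuousOn r (Icc u v))
    (hnear : ∀ t ∈ Icc u v, ∀ t' ∈ Icc u v, |p t - p t'| ≤ 2 * ε → |r t - r t'| ≤ η)
    (hvert : ∀ t ∈ Icc u v, (∃ j, |p t - x j| ≤ ε) → ∃ j, |r t - y j| ≤ η)
    (hrq : ∀ t ∈ Icc u v, |r t - q (p t)| ≤ η)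
    (hq : ∀ a ∈ Icc (x 0) (x (Fin.last n)), ∀ a' ∈ Icc (x 0) (x (Fin.last n)),
      |a - a'| ≤ ε → |q a - q a'| ≤ η)
    (hW : ∀ i, HasItinerary y q δ₁ δ₂ (x i.castSucc) (x i.succ) (W i))
    (hδ : 2 * δ₂ + 2 * η < γ) (hη : η ≤ δ₂ - η) (hε : 0 ≤ ε) :
    HasItinerary y r (δ₁ + η + η) (δ₂ - η) u v (wordMap W w) := by
  have hsub : ∀ i : Fin n, Icc (x i.castSucc) (x i.succ) ⊆ Icc (x 0) (x (Fin.last n)) := fun i =>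
    Icc_subset_Icc (x.monotone (Fin.zero_le _)) (x.monotone (Fin.le_last _))
  -- the clamped point is `ε`-close, since only two pieces of length `ε` are missed
  have hclamp : ∀ (i : Fin n) (α β : ℝ), α ∈ Icc (x i.castSucc) (x i.succ) →
      β ∈ Icc (x i.castSucc) (x i.succ) → α ≤ β → |α - x i.castSucc| ≤ ε → |β - x i.succ| ≤ ε →
      ∀ s ∈ Icc (x i.castSucc) (x i.succ), |q (max α (min s β)) - q s| ≤ η := by
    intro i α β hα hβ hαβ h1 h2 s hs
    rw [abs_le] at h1 h2
    have h3 : max α (min s β) ∈ Icc (x i.castSucc) (x i.succ) :=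
      ⟨hα.1.trans (le_max_left _ _), max_le hα.2 ((min_le_left _ _).trans hs.2)⟩
    refine hq _ (hsub i h3) _ (hsub i hs) ?_
    rw [abs_le]
    rcases le_total s β with h4 | h4
    · rw [min_eq_left h4]
      rcases le_total α s with h5 | h5
      · rw [max_eq_right h5]; constructor <;> linarith
      · rw [max_eq_left h5]; constructor <;> linarith [hs.1]
    · rw [min_eq_right h4, max_eq_right hαβ]; constructor <;> linarith [hs.2]
  induction h with
  | @near u v j huv h =>
    have hu : u ∈ Icc u v := ⟨le_rfl, huv⟩
    refine hasItinerary_nil (c := r u) (δ := η) huv hγ (fun t ht => hnear t ht u hu ?_)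
      (by linarith [(abs_nonneg _).trans (hrq u hu)])
    have h1 := h t ht
    have h2 := h u hu
    rw [abs_le] at *
    constructor <;> linarith
  | @up u v i huv hm hpi hu hv =>
    have h1 := hpi ⟨le_rfl, huv⟩
    have h2 := hpi ⟨huv, le_rfl⟩
    have := ((hW i).comp hp hm huv h1.1 h2.2 (hclamp i _ _ h1 h2
      (hm ⟨le_rfl, huv⟩ ⟨huv, le_rfl⟩ huv) hu hv)).perturb hrq
    simpa [wordMap] using this
  | @down u v i huv hm hpi hu hv =>
    have h1 := hpi ⟨le_rfl, huv⟩
    have h2 := hpi ⟨huv, le_rfl⟩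
    have h3 := (hW i).comp (p := fun t => p (-t)) (u := -v) (v := -u) hp.comp_neg_Icc
      (monotoneOn_comp_neg hm) (neg_le_neg huv) (by rw [neg_neg]; exact h2.1)
      (by rw [neg_neg]; exact h1.2) (η := η) (by
        simp only [neg_neg]
        exact hclamp i _ _ h2 h1 (hm ⟨le_rfl, huv⟩ ⟨huv, le_rfl⟩ huv) hv hu)
    have h4 := h3.neg
    simp only [neg_neg] at h4
    simpa [wordMap] using h4.perturb hrq
  | @append u t v w w' h h' ih ih' =>
    have hl : Icc u t ⊆ Icc u v := Icc_subset_Icc_right h'.le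
    have hr' : Icc t v ⊆ Icc u v := Icc_subset_Icc_left h.le
    obtain ⟨j, hj⟩ := hvert t ⟨h.le, h'.le⟩ h'.left
    have e : wordMap W (w ++ w') = wordMap W w ++ wordMap W w' := by simp [wordMap]
    rw [e]
    exact (ih (hp.mono hl) (hr.mono hl) (fun a ha a' ha' => hnear a (hl ha) a' (hl ha'))
      (fun a ha => hvert a (hl ha)) (fun a ha => hrq a (hl ha))).append
      (ih' (hp.mono hr') (hr.mono hr') (fun a ha a' ha' => hnear a (hr' ha) a' (hr' ha'))
      (fun a ha => hvert a (hr' ha)) (fun a ha => hrq a (hr' ha))) hr (hj.trans hη)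

/-! ### Taut paths -/

/-- The path `p` is a concatenation of injective pieces inside the intervals of the partition, cut
at times at which `p` is at a vertex: it turns around at vertices only. -/
inductive Taut (x : Fin (n + 1) ↪o ℝ) (p : ℝ → ℝ) : ℝ → ℝ → Prop
  | piece {u v : ℝ} (i : Fin n) (huv : u ≤ v) (hc : ContinuousOn p (Icc u v))
      (hi : InjOn p (Icc u v)) (hp : MapsTo p (Icc u v) (Icc (x i.castSucc) (x i.succ))) :
      Taut x p u v
  | append {u t v : ℝ} (j : Fin (n + 1)) (hj : p t = x j) (h : Taut x p u t) (h' : Taut x p t v) :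
      Taut x p u v

theorem Taut.neg (h : Taut x p u v) : Taut x (fun t => p (-t)) (-v) (-u) := by
  induction h with
  | piece i huv hc hi hp =>
    exact .piece i (neg_le_neg huv) hc.comp_neg_Icc hi.comp_neg_Icc fun t ht => hp (map_neg_Icc ht)
  | append j hj _ _ ih ih' => exact .append j (by rwa [neg_neg]) ih' ih

theorem taut_of_strictMonoOn (hn : 0 < n) (huv : u ≤ v) (hc : ContinuousOn p (Icc u v))
    (hm : StrictMonoOn p (Icc u v)) (hp : MapsTo p (Icc u v) (Icc (x 0) (x (Fin.last n)))) :
    Taut x p u v := by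
  have key : ∀ (j : Fin (n + 1)) (v : ℝ), u ≤ v → ContinuousOn p (Icc u v) →
      StrictMonoOn p (Icc u v) → MapsTo p (Icc u v) (Icc (x 0) (x (Fin.last n))) → p v ≤ x j →
      Taut x p u v := by
    intro j
    induction j using Fin.induction with
    | zero =>
      intro v huv hc hm hp hv
      refine .piece ⟨0, hn⟩ huv hc hm.injOn fun t ht => ⟨(hp ht).1, ?_⟩
      exact ((hm.monotoneOn ht ⟨huv, le_rfl⟩ ht.2).trans hv).trans (x.monotone (Fin.zero_le _))
    | succ i ih =>
      intro v huv hc hm hp hv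
      rcases le_or_gt (p v) (x i.castSucc) with h | h
      · exact ih v huv hc hm hp h
      rcases le_or_gt (x i.castSucc) (p u) with h' | h'
      · exact .piece i huv hc hm.injOn fun t ht =>
          ⟨h'.trans (hm.monotoneOn ⟨le_rfl, huv⟩ ht ht.1),
            (hm.monotoneOn ht ⟨huv, le_rfl⟩ ht.2).trans hv⟩
      obtain ⟨t, ht, e⟩ := intermediate_value_Icc huv hc ⟨h'.le, h.le⟩
      have hl : Icc u t ⊆ Icc u v := Icc_subset_Icc_right ht.2
      have hr : Icc t v ⊆ Icc u v := Icc_subset_Icc_left ht.1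
      refine .append i.castSucc e
        (ih t ht.1 (hc.mono hl) (hm.mono hl) (hp.mono_left hl) e.le)
        (.piece i ht.2 (hc.mono hr) (hm.injOn.mono hr) fun a ha => ⟨?_, ?_⟩)
      · rw [← e]; exact hm.monotoneOn ht (hr ha) ha.1
      · exact (hm.monotoneOn (hr ha) ⟨huv, le_rfl⟩ ha.2).trans hv
  exact key (Fin.last n) v huv hc hm hp (hp ⟨huv, le_rfl⟩).2

theorem taut_of_injOn (hn : 0 < n) (huv : u ≤ v) (hc : ContinuousOn p (Icc u v))
    (hi : InjOn p (Icc u v)) (hp : MapsTo p (Icc u v) (Icc (x 0) (x (Fin.last n)))) :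
    Taut x p u v := by
  rcases hc.strictMonoOn_of_injOn_Icc' huv hi with hm | hm
  · exact taut_of_strictMonoOn hn huv hc hm hp
  · have := (taut_of_strictMonoOn (x := x) hn (neg_le_neg huv) hc.comp_neg_Icc
      (fun a ha b hb hab => hm (map_neg_Icc hb) (map_neg_Icc ha) (neg_lt_neg hab))
      fun t ht => hp (map_neg_Icc ht)).neg
    simpa using this

/-- Tautness is preserved by maps that fold at vertices only. -/
theorem Taut.comp (h : Taut x p u v) (hn : 0 < n) {T : ℝ → ℝ} (hT : Continuous T)
    (hi : ∀ i : Fin n, InjOn T (Icc (x i.castSucc) (x i.succ)))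
    (hm : MapsTo T (Icc (x 0) (x (Fin.last n))) (Icc (x 0) (x (Fin.last n))))
    (hv : ∀ j, ∃ j', T (x j) = x j') : Taut x (fun t => T (p t)) u v := by
  induction h with
  | piece i huv hc hinj hp =>
    refine taut_of_injOn hn huv (hT.comp_continuousOn hc) ((hi i).comp hinj hp) fun t ht => hm ?_
    exact Icc_subset_Icc (x.monotone (Fin.zero_le _)) (x.monotone (Fin.le_last _)) (hp ht)
  | append j hj _ _ ih ih' =>
    obtain ⟨j', hj'⟩ := hv j
    exact .append j' (by rw [hj, hj']) ih ih'

theorem Taut.exists_follows (h : Taut x p u v) (hγ : ∀ i : Fin n, x i.castSucc + γ ≤ x i.succ)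
    (hε : ε < γ) {j j' : Fin (n + 1)} (hu : |p u - x j| ≤ ε) (hv : |p v - x j'| ≤ ε) :
    ∃ w, Follows x p ε u v w := by
  induction h generalizing j j' with
  | @piece u v i huv hc hi hp =>
    have hnear : ∀ t ∈ Icc u v, ∀ k : Fin (n + 1), |p t - x k| ≤ ε →
        k = i.castSucc ∨ k = i.succ := by
      intro t ht k hk
      have h1 := hp ht
      rw [abs_le] at hk
      by_contra! hne
      obtain h2 | h2 : (k : ℕ) < i ∨ (i : ℕ) + 1 < k := by
        simp only [Fin.ext_iff, Fin.val_succ, Fin.val_castSucc, ne_eq] at hne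
        omega
      · have h3 := hγ ⟨k, by omega⟩
        have h4 := partition_succ_le x (i := ⟨k, by omega⟩) (j := i) h2
        have h5 : (Fin.castSucc ⟨k, by omega⟩ : Fin (n + 1)) = k := rfl
        rw [h5] at h3
        linarith [h1.1]
      · have hk0 := k.2
        have h3 := hγ ⟨k - 1, by omega⟩
        have h4 := partition_succ_le x (i := i) (j := ⟨k - 1, by omega⟩)
          (by rw [Fin.lt_def]; dsimp only; omega)
        have h5 : (Fin.succ ⟨k - 1, by omega⟩ : Fin (n + 1)) = k := by
          ext; simp only [Fin.val_succ]; omega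
        rw [h5] at h3
        linarith [h1.2]
    have hu' : u ∈ Icc u v := ⟨le_rfl, huv⟩
    have hv' : v ∈ Icc u v := ⟨huv, le_rfl⟩
    have hu1 := hp hu'
    have hv1 := hp hv'
    have hju := hnear u hu' j hu
    have hjv := hnear v hv' j' hv
    rcases hc.strictMonoOn_of_injOn_Icc' huv hi with hm | hm
    · replace hm := hm.monotoneOn
      rcases hju with rfl | rfl
      · rcases hjv with rfl | rfl
        · refine ⟨_, .near i.castSucc huv fun t ht => ?_⟩
          have h1 := hp ht
          have h2 := hm ht hv' ht.2
          rw [abs_le] at *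
          constructor <;> linarith [h1.1]
        · exact ⟨_, .up huv hm hp hu hv⟩
      · refine ⟨_, .near i.succ huv fun t ht => ?_⟩
        have h1 := hp ht
        have h2 := hm hu' ht ht.1
        rw [abs_le] at *
        constructor <;> linarith [h1.2]
    · replace hm := hm.antitoneOn
      rcases hju with rfl | rfl
      · refine ⟨_, .near i.castSucc huv fun t ht => ?_⟩
        have h1 := hp ht
        have h2 := hm hu' ht ht.1
        rw [abs_le] at *
        constructor <;> linarith [h1.1]
      · rcases hjv with rfl | rfl
        · exact ⟨_, .down huv hm hp hu hv⟩
        · refine ⟨_, .near i.succ huv fun t ht => ?_⟩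
          have h1 := hp ht
          have h2 := hm ht hv' ht.2
          rw [abs_le] at *
          constructor <;> linarith [h1.2]
  | append k hk _ _ ih ih' =>
    have hε0 : 0 ≤ ε := (abs_nonneg _).trans hu
    obtain ⟨w, hw⟩ := ih hu (j' := k) (by rw [hk]; simpa)
    obtain ⟨w', hw'⟩ := ih' (j := k) (by rw [hk]; simpa) hv
    exact ⟨_, hw.append hw'⟩

end Itineraries

section Limit

variable {s s₁ s₂ : ℝ}

/-! ### The topology of the inverse limit and its end points -/

theorem isCompact_tentInverseLimit (hs : 1 < s) : IsCompact (tentInverseLimit s) := by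
  have h : tentInverseLimit s = (univ.pi fun _ => Icc (0 : ℝ) 1) ∩
      {z | ∀ k, tentMap s (z (k + 1)) = z k} := by
    ext z
    simp only [tentInverseLimit, mem_ofPred_eq, mem_inter_iff, mem_pi, mem_univ, true_imp_iff]
  rw [h]
  refine (isCompact_univ_pi fun _ => isCompact_Icc).inter_right ?_
  simp only [ofPred_forall]
  exact isClosed_iInter fun k => isClosed_eq
    ((continuous_tentMap hs).comp (continuous_apply _)) (continuous_apply _)

theorem compactSpace_tentInverseLimit (hs : 1 < s) : CompactSpace (tentInverseLimit s) :=
  isCompact_iff_compactSpace.1 (isCompact_tentInverseLimit hs)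

theorem continuous_coordinate (k : ℕ) :
    Continuous fun z : tentInverseLimit s => z.1 k :=
  (continuous_apply k).comp continuous_subtype_val

/-- The points of the inverse limit all of whose coordinates lie in the orbit of `c_s`. -/
def IsEnd (z : tentInverseLimit s) : Prop := ∀ k, z.1 k ∈ tentOrbit s

/-- The point `z` is an interior point of an arc. -/
def IsInteriorToArc {X : Type*} [TopologicalSpace X] (z : X) : Prop :=
  ∃ γ : ℝ → X, ContinuousOn γ (Icc (-1) 1) ∧ InjOn γ (Icc (-1) 1) ∧ γ 0 = z

theorem IsInteriorToArc.map {X Y : Type*} [TopologicalSpace X] [TopologicalSpace Y] {z : X}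
    (h : IsInteriorToArc z) (f : X ≃ₜ Y) : IsInteriorToArc (f z) := by
  obtain ⟨γ, hc, hi, rfl⟩ := h
  exact ⟨fun t => f (γ t), f.continuous.comp_continuousOn hc, f.injective.comp_injOn hi, rfl⟩

theorem coordinate_mem_tentOrbit_of_le (hs : s ∈ periodicTentParams) (z : tentInverseLimit s)
    {k l : ℕ} (hkl : k ≤ l) (h : z.1 l ∈ tentOrbit s) : z.1 k ∈ tentOrbit s := by
  obtain ⟨j, rfl⟩ := Nat.exists_eq_add_of_le hkl
  rw [← iterate_tentMap_apply z.2 j]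
  exact iterate_mem_tentOrbit hs h j

theorem coordinate_eq_of_le (z z' : tentInverseLimit s) {k l : ℕ} (hkl : k ≤ l)
    (h : z.1 l = z'.1 l) : z.1 k = z'.1 k := by
  obtain ⟨j, rfl⟩ := Nat.exists_eq_add_of_le hkl
  rw [← iterate_tentMap_apply z.2 j, ← iterate_tentMap_apply z'.2 j, h]

/-- Local inverse branches along the coordinates of `z`, starting at the level `k`: the left branch
of `T_s` where the coordinate of `z` is at most `c_s`, the right branch elsewhere. -/
noncomputable def branchAlong (s : ℝ) (z : ℕ → ℝ) (k : ℕ) : ℕ → ℝ → ℝ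
  | 0, t => t
  | j + 1, t => if z (k + (j + 1)) ≤ tentCrit s then (branchAlong s z k j t + s - 2) / s
      else tentBranch s (branchAlong s z k j t)

theorem continuous_branchAlong (s : ℝ) (z : ℕ → ℝ) (k j : ℕ) :
    Continuous (branchAlong s z k j) := by
  induction j with
  | zero => exact continuous_id
  | succ j ih =>
    change Continuous fun t => if z (k + (j + 1)) ≤ tentCrit s then
      (branchAlong s z k j t + s - 2) / s else tentBranch s (branchAlong s z k j t)
    split_ifs
    · fun_prop
    · exact (continuous_tentBranch s).comp ih

theorem branchAlong_self (hs : 1 < s) {z : ℕ → ℝ} (hz : z ∈ tentInverseLimit s) (k j : ℕ) :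
    branchAlong s z k j (z k) = z (k + j) := by
  have h0 : s ≠ 0 := by linarith
  induction j with
  | zero => rfl
  | succ j ih =>
    have hT : tentMap s (z (k + (j + 1))) = z (k + j) := hz.2 (k + j)
    rw [branchAlong, ih, ← hT]
    split_ifs with h
    · rw [tentMap_of_le h]
      field_simp
      ring
    · rw [tentMap_of_ge hs (not_le.1 h).le, tentBranch]
      field_simp
      ring

/-- Along an interval that avoids the orbit of `c_s`, the local branches are inverse branches of
`T_s`, and their values still avoid the orbit. -/
theorem branchAlong_mem (hs : s ∈ periodicTentParams) {z : ℕ → ℝ} (hz : z ∈ tentInverseLimit s)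
    {k : ℕ} {ε : ℝ} (hε : 0 ≤ ε)
    (hU : ∀ t ∈ Icc (z k - ε) (z k + ε), t ∈ Icc (0 : ℝ) 1 ∧ t ∉ tentOrbit s) (j : ℕ) :
    ∀ t ∈ Icc (z k - ε) (z k + ε), (branchAlong s z k j t ∈ Icc (0 : ℝ) 1 ∧
      branchAlong s z k j t ∉ tentOrbit s) ∧
      tentMap s (branchAlong s z k (j + 1) t) = branchAlong s z k j t := by
  have hs0 : 0 < s := by linarith [hs.1]
  have hc := mul_tentCrit hs.1
  have key : ∀ j, (∀ t ∈ Icc (z k - ε) (z k + ε), branchAlong s z k j t ∈ Icc (0 : ℝ) 1 ∧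
      branchAlong s z k j t ∉ tentOrbit s) → ∀ t ∈ Icc (z k - ε) (z k + ε),
      (branchAlong s z k (j + 1) t ∈ Icc (0 : ℝ) 1) ∧
      tentMap s (branchAlong s z k (j + 1) t) = branchAlong s z k j t := by
    intro j hj t ht
    obtain ⟨h1, h2⟩ := hj t ht
    rw [branchAlong]
    split_ifs with h
    · -- the values stay above `2 - s`, the lower end of the range of the left branch
      have h3 : 2 - s ≤ branchAlong s z k j t := by
        by_contra hlt
        have h4 : 2 - s ≤ branchAlong s z k j (z k) := by
          have hT : tentMap s (z (k + (j + 1))) = z (k + j) := hz.2 (k + j)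
          rw [branchAlong_self hs.1 hz, ← hT, tentMap_of_le h]
          nlinarith [(hz.1 (k + (j + 1))).1]
        have h5 := intermediate_value_uIcc (a := t) (b := z k)
          (continuous_branchAlong s z k j).continuousOn
        obtain ⟨e, he, he'⟩ := h5 (Icc_subset_uIcc ⟨(not_le.1 hlt).le, h4⟩)
        have hmem : e ∈ Icc (z k - ε) (z k + ε) :=
          (ordConnected_Icc.uIcc_subset ht ⟨by linarith, by linarith⟩) he
        refine (hj e hmem).2 ?_
        rw [he', ← tentMap_zero hs.1]
        exact tentMap_mem_tentOrbit hs (zero_mem_tentOrbit hs)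
      have h6 : (branchAlong s z k j t + s - 2) / s ≤ tentCrit s := by
        rw [div_le_iff₀ hs0]
        linarith [h1.2]
      refine ⟨⟨div_nonneg (by linarith) hs0.le, h6.trans (tentCrit_mem_Ioo hs.1).2.le⟩, ?_⟩
      rw [tentMap_of_le h6]
      field_simp
      ring
    · exact ⟨tentBranch_mem hs.1 h1, tentMap_tentBranch hs.1 h1⟩
  have main : ∀ j, ∀ t ∈ Icc (z k - ε) (z k + ε), branchAlong s z k j t ∈ Icc (0 : ℝ) 1 ∧
      branchAlong s z k j t ∉ tentOrbit s := by
    intro j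
    induction j with
    | zero => exact hU
    | succ j ih =>
      intro t ht
      obtain ⟨h1, h2⟩ := key j ih t ht
      exact ⟨h1, fun h3 => (ih t ht).2 (h2 ▸ tentMap_mem_tentOrbit hs h3)⟩
  exact fun t ht => ⟨main j t ht, (key j (main j) t ht).2⟩

theorem isInteriorToArc_of_not_isEnd (hs : s ∈ periodicTentParams) {z : tentInverseLimit s}
    (hz : ¬ IsEnd z) : IsInteriorToArc z := by
  obtain ⟨k, hk⟩ := not_forall.1 hz
  obtain ⟨ε, hε, hU⟩ : ∃ ε > 0, ∀ t ∈ Icc (z.1 k - ε) (z.1 k + ε),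
      t ∈ Icc (0 : ℝ) 1 ∧ t ∉ tentOrbit s := by
    have h0 : z.1 k ≠ 0 := fun h => hk (h ▸ zero_mem_tentOrbit hs)
    have h1 : z.1 k ≠ 1 := fun h => hk (h ▸ one_mem_tentOrbit hs)
    have hm : z.1 k ∈ Ioo (0 : ℝ) 1 ∩ (tentOrbit s : Set ℝ)ᶜ :=
      ⟨⟨lt_of_le_of_ne (z.2.1 k).1 h0.symm, lt_of_le_of_ne (z.2.1 k).2 h1⟩, hk⟩
    have ho : IsOpen (Ioo (0 : ℝ) 1 ∩ (tentOrbit s : Set ℝ)ᶜ) :=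
      isOpen_Ioo.inter (tentOrbit s).finite_toSet.isClosed.isOpen_compl
    obtain ⟨ε, hε, h⟩ := Metric.isOpen_iff.1 ho _ hm
    refine ⟨ε / 2, by linarith, fun t ht => ?_⟩
    have := h (show t ∈ Metric.ball (z.1 k) ε by
      rw [Metric.mem_ball, Real.dist_eq, abs_lt]
      constructor <;> linarith [ht.1, ht.2])
    exact ⟨Ioo_subset_Icc_self this.1, this.2⟩
  have hb := branchAlong_mem hs z.2 hε.le hU
  have hmem : ∀ a ∈ Icc (-1 : ℝ) 1, z.1 k + ε * a ∈ Icc (z.1 k - ε) (z.1 k + ε) := by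
    intro a ha
    constructor <;> nlinarith [ha.1, ha.2]
  have hlim : ∀ a ∈ Icc (-1 : ℝ) 1, (fun i => (tentMap s)^[k] (branchAlong s z.1 k i
      (z.1 k + ε * a))) ∈ tentInverseLimit s := by
    refine fun a ha => ⟨fun i => (mapsTo_tentMap hs.1 hs.2.1).iterate k (hb i _ (hmem a ha)).1.1,
      fun i => ?_⟩
    rw [← Function.iterate_succ_apply' (tentMap s), Function.iterate_succ_apply,
      (hb i _ (hmem a ha)).2]
  have hiter : ∀ a ∈ Icc (-1 : ℝ) 1, ∀ i, (tentMap s)^[i] (branchAlong s z.1 k i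
      (z.1 k + ε * a)) = z.1 k + ε * a := by
    intro a ha i
    induction i with
    | zero => rfl
    | succ i ih => rw [Function.iterate_succ_apply, (hb i _ (hmem a ha)).2, ih]
  classical
  refine ⟨fun a => if ha : a ∈ Icc (-1 : ℝ) 1 then ⟨_, hlim a ha⟩ else z, ?_, ?_, ?_⟩
  · rw [continuousOn_iff_continuous_domRestrict, continuous_induced_rng]
    refine continuous_pi fun i => ?_
    have : Continuous fun a : Icc (-1 : ℝ) 1 => (tentMap s)^[k] (branchAlong s z.1 k i
        (z.1 k + ε * a)) :=
      ((continuous_tentMap hs.1).iterate k).comp ((continuous_branchAlong s z.1 k i).comp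
        (by fun_prop))
    convert this using 2 with a
    simp [domRestrict, a.2.1, a.2.2]
  · intro a ha b hb' hab
    simp only [dif_pos ha, dif_pos hb'] at hab
    have := congrFun (Subtype.mk.inj hab) k
    simp only [hiter a ha, hiter b hb', add_right_inj] at this
    exact mul_left_cancel₀ hε.ne' this
  · have h0 : (0 : ℝ) ∈ Icc (-1 : ℝ) 1 := by norm_num
    simp only [dif_pos h0]
    refine Subtype.ext (funext fun i => ?_)
    change (tentMap s)^[k] (branchAlong s z.1 k i (z.1 k + ε * 0)) = z.1 i
    rw [mul_zero, add_zero, branchAlong_self hs.1 z.2, add_comm, iterate_tentMap_apply z.2]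

theorem exists_coordinate_eq_one (hs : s ∈ periodicTentParams) {z : tentInverseLimit s}
    (hz : IsEnd z) (k : ℕ) : ∃ l ≥ k, z.1 l = 1 := by
  have hmem := hz (k + 1)
  simp only [tentOrbit, Finset.mem_image] at hmem
  obtain ⟨i, -, hi⟩ := hmem
  have key : ∀ i l, (tentMap s)^[i] (tentCrit s) = z.1 l → z.1 (l + i) = tentCrit s := by
    intro i
    induction i with
    | zero => exact fun l h => h.symm
    | succ i ih =>
      intro l h
      rw [← add_assoc, add_right_comm]
      refine ih (l + 1) (injOn_tentMap_tentOrbit hs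
        (iterate_mem_tentOrbit hs (tentCrit_mem_tentOrbit hs) i) (hz _) ?_)
      rw [z.2.2, ← h, Function.iterate_succ_apply']
  refine ⟨k + i, by omega, ?_⟩
  rw [← z.2.2, add_right_comm, key i (k + 1) hi, tentMap_tentCrit hs.1]

theorem eq_empty_of_iInter_eq_empty {X : Type*} [TopologicalSpace X] [CompactSpace X]
    {C : ℕ → Set X} (hC : ∀ n, C (n + 1) ⊆ C n) (hcl : ∀ n, IsClosed (C n))
    (h : ⋂ n, C n = ∅) : ∃ n, C n = ∅ := by
  by_contra! hne
  obtain ⟨z, hz⟩ := IsCompact.nonempty_iInter_of_sequence_nonempty_isCompact_isClosed C hC hne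
    (hcl 0).isCompact hcl
  rw [h] at hz
  exact hz

/-- An arc from `γ 0` cannot contain, at every level, a point with the same coordinate as a point
outside the arc. -/
theorem exists_eq_of_forall_coordinate_eq {γ : ℝ → tentInverseLimit s} {a b : ℝ}
    (hγ : ContinuousOn γ (Icc a b)) {z : tentInverseLimit s}
    (h : ∀ k, ∃ t ∈ Icc a b, (γ t).1 k = z.1 k) : ∃ t ∈ Icc a b, γ t = z := by
  have hcont := continuousOn_iff_continuous_domRestrict.1 hγ
  by_contra! hne
  obtain ⟨k, hk⟩ := eq_empty_of_iInter_eq_empty (X := Icc a b)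
    (C := fun k => {t | (γ t).1 k = z.1 k})
    (fun k t ht => coordinate_eq_of_le _ _ k.le_succ ht)
    (fun k => isClosed_eq ((continuous_coordinate k).comp hcont) continuous_const) (by
      rw [eq_empty_iff_forall_notMem]
      intro t ht
      exact hne t t.2 (Subtype.ext (funext fun k => mem_iInter.1 ht k)))
  obtain ⟨t, ht, e⟩ := h k
  exact (eq_empty_iff_forall_notMem.1 hk) ⟨t, ht⟩ e

/-- Infinitely many coordinates of an end are equal to `1`, the largest value. So at
infinitely many levels one of the two halves of an arc around it would be covered by the other. -/
theorem IsEnd.not_isInteriorToArc (hs : s ∈ periodicTentParams) {z : tentInverseLimit s}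
    (hz : IsEnd z) : ¬ IsInteriorToArc z := by
  rintro ⟨γ, hc, hi, rfl⟩
  have hl : Icc (-1 : ℝ) 0 ⊆ Icc (-1) 1 := Icc_subset_Icc_right zero_le_one
  have hr : Icc (0 : ℝ) 1 ⊆ Icc (-1) 1 := Icc_subset_Icc_left (by norm_num)
  have hcoord : ∀ k, ContinuousOn (fun t => (γ t).1 k) (Icc (-1) 1) := fun k =>
    (continuous_coordinate k).comp_continuousOn hc
  have hcase : ∀ k, (∃ t ∈ Icc (-1 : ℝ) 0, (γ t).1 k = (γ 1).1 k) ∨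
      ∃ t ∈ Icc (0 : ℝ) 1, (γ t).1 k = (γ (-1)).1 k := by
    intro k
    obtain ⟨l, hkl, hl1⟩ := exists_coordinate_eq_one hs hz k
    rcases le_total ((γ (-1)).1 l) ((γ 1).1 l) with h | h
    · obtain ⟨t, ht, e⟩ := intermediate_value_Icc (by norm_num) ((hcoord l).mono hl)
        (show (γ 1).1 l ∈ Icc ((γ (-1)).1 l) ((γ 0).1 l) from ⟨h, hl1 ▸ ((γ 1).2.1 l).2⟩)
      exact Or.inl ⟨t, ht, coordinate_eq_of_le _ _ hkl e⟩
    · obtain ⟨t, ht, e⟩ := intermediate_value_Icc' (by norm_num) ((hcoord l).mono hr)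
        (show (γ (-1)).1 l ∈ Icc ((γ 1).1 l) ((γ 0).1 l) from ⟨h, hl1 ▸ ((γ (-1)).2.1 l).2⟩)
      exact Or.inr ⟨t, ht, coordinate_eq_of_le _ _ hkl e⟩
  by_cases hall : ∀ k, ∃ t ∈ Icc (-1 : ℝ) 0, (γ t).1 k = (γ 1).1 k
  · obtain ⟨t, ht, e⟩ := exists_eq_of_forall_coordinate_eq (hc.mono hl) hall
    have := hi (hl ht) (by norm_num) e
    linarith [ht.2]
  · obtain ⟨k, hk⟩ := not_forall.1 hall
    obtain ⟨t, ht, e⟩ := exists_eq_of_forall_coordinate_eq (hc.mono hr) (z := γ (-1)) fun l => by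
      have h1 := (hcase (max k l)).resolve_left fun ⟨t, ht, e⟩ =>
        hk ⟨t, ht, coordinate_eq_of_le _ _ (le_max_left k l) e⟩
      obtain ⟨t, ht, e⟩ := h1
      exact ⟨t, ht, coordinate_eq_of_le _ _ (le_max_right k l) e⟩
    have := hi (hr ht) (by norm_num) e
    linarith [ht.1]

theorem IsEnd.map (h₁ : s₁ ∈ periodicTentParams) (h₂ : s₂ ∈ periodicTentParams)
    (g : tentInverseLimit s₁ ≃ₜ tentInverseLimit s₂) {z : tentInverseLimit s₁} (hz : IsEnd z) :
    IsEnd (g z) := by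
  by_contra h
  have := (isInteriorToArc_of_not_isEnd h₂ h).map g.symm
  rw [g.symm_apply_apply] at this
  exact hz.not_isInteriorToArc h₁ this

/-! ### Sections of the projections -/

/-- The section of the projection to the `K`-th coordinate given by the branch
`tentBranch s`; outside of `[0, 1]` it is extended by constants. -/
noncomputable def limitSection (hs : s ∈ periodicTentParams) (K : ℕ) (t : ℝ) :
    tentInverseLimit s :=
  ⟨fun i => (tentMap s)^[K] ((tentBranch s)^[i] (projIcc (0 : ℝ) 1 zero_le_one t)), by
    have hm : ∀ i, (tentBranch s)^[i] (projIcc (0 : ℝ) 1 zero_le_one t) ∈ Icc (0 : ℝ) 1 :=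
      fun i => MapsTo.iterate (fun _ => tentBranch_mem hs.1) i (projIcc _ _ _ t).2
    refine ⟨fun i => (mapsTo_tentMap hs.1 hs.2.1).iterate K (hm i), fun i => ?_⟩
    rw [← Function.iterate_succ_apply' (tentMap s), Function.iterate_succ_apply,
      Function.iterate_succ_apply' (tentBranch s), tentMap_tentBranch hs.1 (hm i)]⟩

theorem continuous_limitSection (hs : s ∈ periodicTentParams) (K : ℕ) :
    Continuous (limitSection hs K) := by
  refine Continuous.subtype_mk (continuous_pi fun i => ?_) _
  exact ((continuous_tentMap hs.1).iterate K).comp (((continuous_tentBranch s).iterate i).comp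
    (continuous_subtype_val.comp continuous_projIcc))

theorem limitSection_apply_self (hs : s ∈ periodicTentParams) (K : ℕ) {t : ℝ}
    (ht : t ∈ Icc (0 : ℝ) 1) : (limitSection hs K t).1 K = t := by
  change (tentMap s)^[K] ((tentBranch s)^[K] (projIcc (0 : ℝ) 1 zero_le_one t)) = t
  rw [projIcc_of_mem _ ht, iterate_tentMap_tentBranch hs.1 ht]

theorem limitSection_apply (hs : s ∈ periodicTentParams) {k K : ℕ} (hk : k ≤ K) {t : ℝ}
    (ht : t ∈ Icc (0 : ℝ) 1) : (limitSection hs K t).1 k = (tentMap s)^[K - k] t := by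
  have h := iterate_tentMap_apply (limitSection hs K t).2 (K - k) k
  rw [show k + (K - k) = K by omega, limitSection_apply_self hs K ht] at h
  exact h.symm

end Limit

section Homeomorphic

variable {s₁ s₂ : ℝ} {h₁ : s₁ ∈ periodicTentParams} {h₂ : s₂ ∈ periodicTentParams}

/-! ### Coordinates of the image under a continuous map -/

/-- Points whose `K`-th coordinates are `δ`-close have images with `ε`-close `k`-th coordinates, and
points whose `K`-th coordinate is `δ`-close to the critical orbit have images whose
`k`-th coordinate is `ε`-close to the critical orbit. -/
def Controls (h₁ : s₁ ∈ periodicTentParams) (h₂ : s₂ ∈ periodicTentParams)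
    (g : tentInverseLimit s₁ → tentInverseLimit s₂) (K : ℕ) (δ : ℝ) (k : ℕ) (ε : ℝ) : Prop :=
  (∀ z z', |z.1 K - z'.1 K| ≤ δ → |(g z).1 k - (g z').1 k| ≤ ε) ∧
  ∀ z, (∃ j, |z.1 K - tentPoint s₁ h₁ j| ≤ δ) → ∃ j, |(g z).1 k - tentPoint s₂ h₂ j| ≤ ε

theorem Controls.mono {g : tentInverseLimit s₁ → tentInverseLimit s₂} {K k : ℕ} {δ δ' ε : ℝ}
    (h : Controls h₁ h₂ g K δ k ε) (hδ : δ' ≤ δ) : Controls h₁ h₂ g K δ' k ε :=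
  ⟨fun z z' hz => h.1 z z' (hz.trans hδ), fun z ⟨j, hj⟩ => h.2 z ⟨j, hj.trans hδ⟩⟩

theorem exists_controls {g : tentInverseLimit s₁ → tentInverseLimit s₂} (hg : Continuous g)
    (hE : ∀ z, IsEnd z → IsEnd (g z)) (k : ℕ) {ε : ℝ} (hε : 0 < ε) :
    ∃ K₀, ∀ K ≥ K₀, ∃ δ > 0, Controls h₁ h₂ g K δ k ε := by
  have : CompactSpace (tentInverseLimit s₁) := compactSpace_tentInverseLimit h₁.1
  have hgk : Continuous fun z => (g z).1 k := (continuous_coordinate k).comp hg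
  have hdiff : Continuous fun z : tentInverseLimit s₁ × tentInverseLimit s₁ =>
      |(g z.1).1 k - (g z.2).1 k| :=
    ((hgk.comp continuous_fst).sub (hgk.comp continuous_snd)).abs
  have hfst : ∀ K, Continuous fun z : tentInverseLimit s₁ × tentInverseLimit s₁ => z.1.1 K :=
    fun K => (continuous_coordinate K).comp continuous_fst
  have hsnd : ∀ K, Continuous fun z : tentInverseLimit s₁ × tentInverseLimit s₁ => z.2.1 K :=
    fun K => (continuous_coordinate K).comp continuous_snd
  obtain ⟨K₁, hK₁⟩ := eq_empty_of_iInter_eq_empty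
    (C := fun K => {z : tentInverseLimit s₁ × tentInverseLimit s₁ | z.1.1 K = z.2.1 K ∧
      ε / 2 ≤ |(g z.1).1 k - (g z.2).1 k|})
    (fun K z hz => ⟨coordinate_eq_of_le _ _ K.le_succ hz.1, hz.2⟩)
    (fun K => (isClosed_eq (hfst K) (hsnd K)).inter (isClosed_le continuous_const hdiff)) (by
      rw [eq_empty_iff_forall_notMem]
      intro z hz
      have h0 : z.1 = z.2 := Subtype.ext (funext fun K => (mem_iInter.1 hz K).1)
      have h1 := (mem_iInter.1 hz 0).2
      rw [h0, sub_self, abs_zero] at h1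
      linarith)
  have hfar : IsClosed {z : tentInverseLimit s₁ | ∀ j, ε / 2 ≤ |(g z).1 k - tentPoint s₂ h₂ j|} := by
    simp only [ofPred_forall]
    exact isClosed_iInter fun j => isClosed_le continuous_const (hgk.sub continuous_const).abs
  obtain ⟨K₂, hK₂⟩ := eq_empty_of_iInter_eq_empty
    (C := fun K => {z : tentInverseLimit s₁ | z.1 K ∈ tentOrbit s₁ ∧
      ∀ j, ε / 2 ≤ |(g z).1 k - tentPoint s₂ h₂ j|})
    (fun K z hz => ⟨coordinate_mem_tentOrbit_of_le h₁ _ K.le_succ hz.1, hz.2⟩)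
    (fun K => ((tentOrbit s₁).finite_toSet.isClosed.preimage (continuous_coordinate K)).inter hfar)
    (by
      rw [eq_empty_iff_forall_notMem]
      intro z hz
      have h0 : IsEnd z := fun K => (mem_iInter.1 hz K).1
      obtain ⟨j, hj⟩ := (mem_tentOrbit_iff h₂ _).1 (hE z h0 k)
      have h1 := (mem_iInter.1 hz 0).2 j
      rw [hj, sub_self, abs_zero] at h1
      linarith)
  refine ⟨max K₁ K₂, fun K hK => ?_⟩
  obtain ⟨m, hm⟩ := eq_empty_of_iInter_eq_empty
    (C := fun m : ℕ => {z : tentInverseLimit s₁ × tentInverseLimit s₁ |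
      |z.1.1 K - z.2.1 K| ≤ 1 / ((m : ℝ) + 1) ∧ ε / 2 ≤ |(g z.1).1 k - (g z.2).1 k|})
    (fun m z hz => ⟨hz.1.trans (one_div_le_one_div_of_le (by positivity)
      (by push_cast; linarith)), hz.2⟩)
    (fun m => (isClosed_le ((hfst K).sub (hsnd K)).abs continuous_const).inter
      (isClosed_le continuous_const hdiff)) (by
      rw [eq_empty_iff_forall_notMem]
      intro z hz
      have h0 : |z.1.1 K - z.2.1 K| ≤ 0 :=
        ge_of_tendsto' tendsto_one_div_add_atTop_nhds_zero_nat fun m => (mem_iInter.1 hz m).1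
      have h1 : z.1.1 K = z.2.1 K := sub_eq_zero.1 (abs_nonpos_iff.1 h0)
      exact eq_empty_iff_forall_notMem.1 hK₁ z
        ⟨coordinate_eq_of_le _ _ ((le_max_left _ _).trans hK) h1, (mem_iInter.1 hz 0).2⟩)
  have hclose : ∀ z z' : tentInverseLimit s₁, |z.1 K - z'.1 K| ≤ 1 / ((m : ℝ) + 1) →
      |(g z).1 k - (g z').1 k| < ε / 2 := by
    intro z z' hz
    by_contra hlt
    exact eq_empty_iff_forall_notMem.1 hm (z, z') ⟨hz, not_lt.1 hlt⟩
  refine ⟨1 / ((m : ℝ) + 1), by positivity, fun z z' hz => ?_, fun z ⟨j, hj⟩ => ?_⟩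
  · linarith [hclose z z' hz]
  · set z' := limitSection h₁ K (tentPoint s₁ h₁ j)
    have h3 : z'.1 K = tentPoint s₁ h₁ j :=
      limitSection_apply_self h₁ K (tentOrbit_subset_Icc h₁ (tentPoint_mem h₁ j))
    have h4 := hclose z z' (by rwa [h3])
    have h5 : z'.1 K₂ ∈ tentOrbit s₁ := coordinate_mem_tentOrbit_of_le h₁ z'
      ((le_max_right _ _).trans hK) (h3 ▸ tentPoint_mem h₁ j)
    obtain ⟨j', hj'⟩ : ∃ j', |(g z').1 k - tentPoint s₂ h₂ j'| < ε / 2 := by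
      by_contra! hne
      exact eq_empty_iff_forall_notMem.1 hK₂ z' ⟨h5, hne⟩
    refine ⟨j', ?_⟩
    have := abs_sub_le ((g z).1 k) ((g z').1 k) (tentPoint s₂ h₂ j')
    linarith

theorem Taut.iterate_tentMap {s : ℝ} (hs : s ∈ periodicTentParams) {p : ℝ → ℝ} {u v : ℝ}
    (h : Taut (tentPoint s hs) p u v) (N : ℕ) :
    Taut (tentPoint s hs) (fun t => (tentMap s)^[N] (p t)) u v := by
  induction N with
  | zero => exact h
  | succ N ih =>
    simp only [Function.iterate_succ_apply']
    refine ih.comp (tentSize_pos hs) (continuous_tentMap hs.1) (injOn_tentMap_tentInterval hs) ?_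
      fun j => ?_
    · rw [tentPoint_zero, tentPoint_last]
      exact mapsTo_tentMap hs.1 hs.2.1
    · obtain ⟨j', hj'⟩ := (mem_tentOrbit_iff hs _).1 (tentMap_mem_tentOrbit hs (tentPoint_mem hs j))
      exact ⟨j', hj'.symm⟩

theorem exists_mapsTo_tentInterval {s : ℝ} (hs : s ∈ periodicTentParams) {p : ℝ → ℝ} {u v : ℝ}
    (huv : u ≤ v) (hp : ContinuousOn p (Icc u v)) (hp1 : MapsTo p (Icc u v) (Icc 0 1))
    (hp2 : ∀ t ∈ Icc u v, p t ∉ tentOrbit s) :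
    ∃ i : Fin (tentSize s),
      MapsTo p (Icc u v) (Icc (tentPoint s hs i.castSucc) (tentPoint s hs i.succ)) := by
  have hu : u ∈ Icc u v := ⟨le_rfl, huv⟩
  obtain ⟨i, hi⟩ := exists_mem_tentInterval hs (hp1 hu)
  have key : ∀ t ∈ Icc u v, ∀ j, ¬ tentPoint s hs j ∈ uIcc (p u) (p t) := by
    intro t ht j hj
    have hsub : uIcc u t ⊆ Icc u v := ordConnected_Icc.uIcc_subset hu ht
    obtain ⟨e, he, he'⟩ := intermediate_value_uIcc (hp.mono hsub) hj
    exact hp2 e (hsub he) (he' ▸ tentPoint_mem hs j)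
  refine ⟨i, fun t ht => ⟨?_, ?_⟩⟩
  · by_contra hlt
    exact key t ht _ (Icc_subset_uIcc' ⟨(not_le.1 hlt).le, hi.1⟩)
  · by_contra hlt
    exact key t ht _ (Icc_subset_uIcc ⟨hi.2, (not_le.1 hlt).le⟩)

/-- The coordinate paths of an arc that avoids the ends are taut: at a high enough level the
arc stays inside one interval of the partition, and lower coordinates are images under iterates
of the tent map. -/
theorem taut_coordinate {s : ℝ} (hs : s ∈ periodicTentParams) {y : ℝ → tentInverseLimit s}
    {u v : ℝ} (huv : u ≤ v) (hy : ContinuousOn y (Icc u v)) (hi : InjOn y (Icc u v))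
    (hE : ∀ t ∈ Icc u v, ¬ IsEnd (y t)) (k : ℕ) :
    Taut (tentPoint s hs) (fun t => (y t).1 k) u v := by
  have hcoord : ∀ l, ContinuousOn (fun t => (y t).1 l) (Icc u v) := fun l =>
    (continuous_coordinate l).comp_continuousOn hy
  obtain ⟨q₀, hq₀⟩ := eq_empty_of_iInter_eq_empty (X := Icc u v)
    (C := fun l => {t | (y t).1 l ∈ tentOrbit s})
    (fun l t ht => coordinate_mem_tentOrbit_of_le hs _ l.le_succ ht)
    (fun l => (tentOrbit s).finite_toSet.isClosed.preimage
      (continuousOn_iff_continuous_domRestrict.1 (hcoord l))) (by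
      rw [eq_empty_iff_forall_notMem]
      intro t ht
      exact hE t t.2 fun l => mem_iInter.1 ht l)
  have havoid : ∀ l ≥ q₀, ∀ t ∈ Icc u v, (y t).1 l ∉ tentOrbit s := fun l hl t ht hmem =>
    eq_empty_iff_forall_notMem.1 hq₀ ⟨t, ht⟩ (coordinate_mem_tentOrbit_of_le hs _ hl hmem)
  have hint : ∀ l ≥ q₀, ∃ i : Fin (tentSize s), MapsTo (fun t => (y t).1 l) (Icc u v)
      (Icc (tentPoint s hs i.castSucc) (tentPoint s hs i.succ)) := fun l hl =>
    exists_mapsTo_tentInterval hs huv (hcoord l) (fun t _ => (y t).2.1 l) (havoid l hl)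
  set q := max q₀ k
  have hinj : InjOn (fun t => (y t).1 q) (Icc u v) := by
    intro t ht t' ht' e
    have key : ∀ m, (y t).1 (q + m) = (y t').1 (q + m) := by
      intro m
      induction m with
      | zero => exact e
      | succ m ih =>
        obtain ⟨i, hmap⟩ := hint (q + (m + 1)) (by omega)
        refine injOn_tentMap_tentInterval hs i (hmap ht) (hmap ht') ?_
        rw [← add_assoc, (y t).2.2, (y t').2.2, ih]
    exact hi ht ht' (Subtype.ext (tentInverseLimit_ext (y t).2 (y t').2
      (L := fun m => q + m) (fun m => by omega) key))
  obtain ⟨i, hmap⟩ := hint q (le_max_left _ _)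
  have := (Taut.piece i huv (hcoord q) hinj hmap).iterate_tentMap hs (q - k)
  convert this using 2 with t
  have h := iterate_tentMap_apply (y t).2 (q - k) k
  rw [show k + (q - k) = q by omega] at h
  exact h.symm

theorem exists_forall_abs_sub_le {p : ℝ → ℝ} (hp : Continuous p) {u v ε : ℝ} (huv : u < v)
    (hε : 0 < ε) : ∃ t ∈ Ioo u v, ∀ e ∈ Icc u t, |p e - p u| ≤ ε := by
  obtain ⟨d, hd, h⟩ := Metric.continuousAt_iff.1 (hp.continuousAt (x := u)) ε hε
  refine ⟨min (u + d / 2) ((u + v) / 2), ⟨lt_min (by linarith) (by linarith),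
    (min_le_right _ _).trans_lt (by linarith)⟩, fun e he => ?_⟩
  have h1 : e ≤ u + d / 2 := he.2.trans (min_le_left _ _)
  have h2 := @h e (by rw [Real.dist_eq, abs_lt]; constructor <;> linarith [he.1])
  rw [Real.dist_eq] at h2
  exact h2.le

/-- The `k`-th coordinate of the image of the arc over the interval of a letter follows a word. -/
theorem Controls.exists_follows {g : tentInverseLimit s₁ → tentInverseLimit s₂} {K k : ℕ}
    {δ ε γ : ℝ} (h : Controls h₁ h₂ g K δ k ε) (hδ : 0 ≤ δ) (hε : 0 < ε)
    (hγ : ∀ i : Fin (tentSize s₂), tentPoint s₂ h₂ i.castSucc + γ ≤ tentPoint s₂ h₂ i.succ)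
    (hεγ : 2 * ε < γ) (hg : Continuous g) (hi : Function.Injective g)
    (hE : ∀ z, IsEnd (g z) → IsEnd z) (i : Fin (tentSize s₁)) :
    ∃ w, Follows (tentPoint s₂ h₂) (fun t => (g (limitSection h₁ K t)).1 k) (2 * ε)
      (tentPoint s₁ h₁ i.castSucc) (tentPoint s₁ h₁ i.succ) w := by
  set u := tentPoint s₁ h₁ i.castSucc
  set v := tentPoint s₁ h₁ i.succ
  have huv : u < v := partition_lt _ i
  have hsub : Icc u v ⊆ Icc 0 1 := tentInterval_subset h₁ i
  have hpc : Continuous fun t => (g (limitSection h₁ K t)).1 k :=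
    (continuous_coordinate k).comp (hg.comp (continuous_limitSection h₁ K))
  generalize hp : (fun t => (g (limitSection h₁ K t)).1 k) = p at hpc ⊢
  have hpt : ∀ t, p t = (g (limitSection h₁ K t)).1 k := fun t => by rw [← hp]
  have hend : ∀ j, ∃ j', |p (tentPoint s₁ h₁ j) - tentPoint s₂ h₂ j'| ≤ ε := by
    intro j
    rw [hpt]
    refine h.2 _ ⟨j, ?_⟩
    rwa [limitSection_apply_self h₁ K (tentOrbit_subset_Icc h₁ (tentPoint_mem h₁ j)), sub_self,
      abs_zero]
  obtain ⟨j, hj⟩ := hend i.castSucc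
  obtain ⟨j', hj'⟩ := hend i.succ
  obtain ⟨v', hv', hpv⟩ := exists_forall_abs_sub_le (hpc.comp continuous_neg) (neg_lt_neg huv) hε
  obtain ⟨u', hu', hpu⟩ := exists_forall_abs_sub_le hpc (u := u) (v := -v') (by linarith [hv'.2]) hε
  have hu'v' : u' ≤ -v' := hu'.2.le
  have hnear : ∀ t ∈ Icc u u', |p t - tentPoint s₂ h₂ j| ≤ 2 * ε := fun t ht => by
    have := abs_sub_le (p t) (p u) (tentPoint s₂ h₂ j)
    linarith [hpu t ht]
  have hnear' : ∀ t ∈ Icc (-v') v, |p t - tentPoint s₂ h₂ j'| ≤ 2 * ε := fun t ht => by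
    have h1 := abs_sub_le (p t) (p v) (tentPoint s₂ h₂ j')
    have h2 := hpv (-t) ⟨by linarith [ht.2], by linarith [ht.1]⟩
    simp only [Function.comp_apply, neg_neg] at h2
    linarith
  have hv1 := hv'.1
  have hinner : ∀ t ∈ Icc u' (-v'), t ∈ Ioo u v := fun t ht =>
    ⟨hu'.1.trans_le ht.1, by linarith [ht.2]⟩
  have htaut := taut_coordinate h₂ (y := fun t => g (limitSection h₁ K t)) hu'v'
    (hg.comp (continuous_limitSection h₁ K)).continuousOn (fun t ht t' ht' e => by
      have : (limitSection h₁ K t).1 K = (limitSection h₁ K t').1 K :=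
        congrArg (fun z => z.1 K) (hi e)
      rwa [limitSection_apply_self h₁ K (hsub (Ioo_subset_Icc_self (hinner t ht))),
        limitSection_apply_self h₁ K (hsub (Ioo_subset_Icc_self (hinner t' ht')))] at this)
    (fun t ht hend => by
      have h1 := hE _ hend K
      rw [limitSection_apply_self h₁ K (hsub (Ioo_subset_Icc_self (hinner t ht)))] at h1
      obtain ⟨l, hl⟩ := (mem_tentOrbit_iff h₁ _).1 h1
      have h2 := hinner t ht
      rw [← hl] at h2
      rcases vertex_mem_Icc (Ioo_subset_Icc_self h2) with rfl | rfl
      · exact lt_irrefl _ h2.1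
      · exact lt_irrefl _ h2.2) k
  rw [hp] at htaut
  obtain ⟨w, hw⟩ := htaut.exists_follows hγ hεγ (hnear u' ⟨hu'.1.le, le_rfl⟩)
    (hnear' (-v') ⟨le_rfl, by linarith⟩)
  exact ⟨_, ((Follows.near j hu'.1.le hnear).append hw).append
    (.near j' (by linarith) hnear')⟩

/-- The words of `g` and of its inverse compose to an iterate of `χ`: over the interval of `aᵢ`, the
path of `g` follows the word `W i`, so its image under the inverse has the itinerary
`wordMap V (W i)`; but this image is a path of an iterate of the tent map. -/
theorem wordMap_eq_iterate {g : tentInverseLimit s₁ → tentInverseLimit s₂}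
    {g' : tentInverseLimit s₂ → tentInverseLimit s₁} (hg : Continuous g) (hg' : Continuous g')
    (hgg : ∀ z, g' (g z) = z) {K k K' : ℕ} (hK : K' ≤ K) {ε η γ : ℝ} (hε : 0 ≤ ε) (hη : 0 ≤ η)
    (hC : Controls h₂ h₁ g' k (4 * ε) K' η)
    (hγ : ∀ i : Fin (tentSize s₁), tentPoint s₁ h₁ i.castSucc + γ ≤ tentPoint s₁ h₁ i.succ)
    (hηγ : 32 * η ≤ γ) (hγ0 : 0 < γ)
    {W : Fin (tentSize s₁) → List (Letter (tentSize s₂))}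
    {V : Fin (tentSize s₂) → List (Letter (tentSize s₁))}
    (hW : ∀ i, Follows (tentPoint s₂ h₂) (fun t => (g (limitSection h₁ K t)).1 k) (2 * ε)
      (tentPoint s₁ h₁ i.castSucc) (tentPoint s₁ h₁ i.succ) (W i))
    (hV : ∀ i, Follows (tentPoint s₁ h₁) (fun t => (g' (limitSection h₂ k t)).1 K') (2 * η)
      (tentPoint s₂ h₂ i.castSucc) (tentPoint s₂ h₂ i.succ) (V i)) (i : Fin (tentSize s₁)) :
    wordMap V (W i) = (tentSubstitution s₁ h₁).ext^[K - K'] [(i, true)] := by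
  have hpc : Continuous fun t => (g (limitSection h₁ K t)).1 k :=
    (continuous_coordinate k).comp (hg.comp (continuous_limitSection h₁ K))
  have hqc : Continuous fun t => (g' (limitSection h₂ k t)).1 K' :=
    (continuous_coordinate K').comp (hg'.comp (continuous_limitSection h₂ k))
  have hrc : Continuous fun t => (limitSection h₁ K t).1 K' :=
    (continuous_coordinate K').comp (continuous_limitSection h₁ K)
  have hVi : ∀ b : Fin (tentSize s₂), HasItinerary (tentPoint s₁ h₁)
      (fun t => (g' (limitSection h₂ k t)).1 K') (2 * η) (γ / 4)
      (tentPoint s₂ h₂ b.castSucc) (tentPoint s₂ h₂ b.succ) (V b) := fun b =>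
    (hV b).hasItinerary hqc.continuousOn hγ (by linarith) (by linarith) (by linarith)
  have key := (hW i).hasItinerary_wordMap (y := tentPoint s₁ h₁)
    (r := fun t => (limitSection h₁ K t).1 K') (q := fun t => (g' (limitSection h₂ k t)).1 K')
    (η := η) (δ₁ := 2 * η) (δ₂ := γ / 4) (W := V) hγ hpc.continuousOn hrc.continuousOn
    (fun t _ t' _ htt => by
      have := hC.1 (g (limitSection h₁ K t)) (g (limitSection h₁ K t')) (by linarith)
      rwa [hgg, hgg] at this)
    (fun t _ ⟨j, hj⟩ => by
      have := hC.2 (g (limitSection h₁ K t)) ⟨j, by linarith⟩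
      rwa [hgg] at this)
    (fun t _ => by
      have := hC.1 (g (limitSection h₁ K t))
        (limitSection h₂ k ((g (limitSection h₁ K t)).1 k)) (by
          rw [limitSection_apply_self h₂ k ((g (limitSection h₁ K t)).2.1 k), sub_self, abs_zero]
          linarith)
      rwa [hgg] at this)
    (fun a ha a' ha' haa => by
      rw [tentPoint_zero, tentPoint_last] at ha ha'
      refine hC.1 _ _ ?_
      rw [limitSection_apply_self h₂ k ha, limitSection_apply_self h₂ k ha']
      linarith)
    hVi (by linarith) (by linarith) (by linarith)
  have htrav := (((traverses_iterate_tentMap h₁ i (K - K')).follows (partition_lt _ i)).hasItinerary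
    (δ₂ := γ / 4) ((continuous_tentMap h₁.1).iterate _).continuousOn hγ (by linarith)
    (by linarith) le_rfl).perturb (q := fun t => (limitSection h₁ K t).1 K') (η := 0)
    fun t ht => by
      rw [limitSection_apply h₁ hK (tentInterval_subset h₁ i ht), sub_self, abs_zero]
  exact key.unique htrav (by linarith) (by linarith)

/-! ### A homeomorphism gives a weak equivalence -/

theorem exists_gap {n : ℕ} (x : Fin (n + 1) ↪o ℝ) :
    ∃ γ > 0, ∀ i : Fin n, x i.castSucc + γ ≤ x i.succ := by
  rcases Nat.eq_zero_or_pos n with rfl | hn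
  · exact ⟨1, one_pos, fun i => i.elim0⟩
  · have : Nonempty (Fin n) := ⟨⟨0, hn⟩⟩
    obtain ⟨i, hi⟩ := Finite.exists_min fun i : Fin n => x i.succ - x i.castSucc
    exact ⟨x i.succ - x i.castSucc, sub_pos.2 (partition_lt x i), fun j => by linarith [hi j]⟩

/-- The substitution with prescribed nonempty words for the letters `aᵢ`. -/
def Substitution.ofWords {n m : ℕ} (W : Fin n → List (Letter m)) (hW : ∀ i, W i ≠ []) :
    Substitution n m where
  toFun b := if b.2 then W b.1 else barWord (W b.1)
  ne_nil := by
    rintro ⟨i, _ | _⟩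
    · simpa [barWord] using hW i
    · simpa using hW i
  map_bar := by
    rintro ⟨i, _ | _⟩
    · simp [Letter.bar, barWord_barWord]
    · simp [Letter.bar]

theorem Substitution.ext_comp_ext_eq {n m : ℕ} {σ : Substitution m n} {τ : Substitution n m}
    {χ : Substitution n n} {N : ℕ}
    (h : ∀ i, σ.ext (τ.toFun (i, true)) = χ.ext^[N] [(i, true)]) :
    σ.ext ∘ τ.ext = χ.ext^[N] := by
  funext w
  induction w with
  | nil =>
    change [] = _
    have := χ.iterate_ext_append N [] []
    rw [List.append_nil] at this
    exact (List.self_eq_append_left.1 this).symm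
  | cons b w ih =>
    rw [Function.comp_apply] at ih ⊢
    rw [τ.ext_cons, σ.ext_append, ih, ← List.singleton_append, χ.iterate_ext_append]
    congr 1
    rcases b with ⟨i, _ | _⟩
    · have h1 : τ.toFun (i, false) = barWord (τ.toFun (i, true)) := τ.map_bar (i, true)
      have h2 : [(i, false)] = barWord [((i, true) : Letter n)] := rfl
      rw [h1, h2, σ.ext_barWord, χ.iterate_ext_barWord, h]
    · exact h i

theorem exists_sequence {α : Type*} {P : α → Prop} {R : α → α → Prop} (h0 : ∃ a, P a)
    (h : ∀ a, P a → ∃ b, P b ∧ R a b) :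
    ∃ f : ℕ → α, (∀ i, P (f i)) ∧ ∀ i, R (f i) (f (i + 1)) := by
  obtain ⟨a, ha⟩ := h0
  choose F hF hR using h
  let f : ℕ → {a // P a} := fun i => Nat.rec ⟨a, ha⟩ (fun _ b => ⟨F b.1 b.2, hF b.1 b.2⟩) i
  exact ⟨fun i => (f i).1, fun i => (f i).2, fun i => hR (f i).1 (f i).2⟩

theorem weaklyEquivalent_of_homeomorph (g : tentInverseLimit s₁ ≃ₜ tentInverseLimit s₂) :
    WeaklyEquivalent (tentSubstitution s₁ h₁) (tentSubstitution s₂ h₂) := by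
  obtain ⟨γ₁, hγ₁0, hγ₁⟩ := exists_gap (tentPoint s₁ h₁)
  obtain ⟨γ₂, hγ₂0, hγ₂⟩ := exists_gap (tentPoint s₂ h₂)
  have hE : ∀ z, IsEnd z → IsEnd (g z) := fun z hz => hz.map h₁ h₂ g
  have hE' : ∀ z, IsEnd z → IsEnd (g.symm z) := fun z hz => hz.map h₂ h₁ g.symm
  have step : ∀ (L : ℕ) {η : ℝ}, 0 < η → ∀ K₀, ∃ K δ, K₀ < K ∧ 0 < δ ∧ 32 * δ ≤ γ₁ ∧
      Controls h₁ h₂ g K (4 * δ) L η := by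
    intro L η hη K₀
    obtain ⟨K₁, h⟩ := exists_controls (h₁ := h₁) (h₂ := h₂) g.continuous hE L hη
    obtain ⟨δ, hδ, hC⟩ := h (max K₁ (K₀ + 1)) (le_max_left _ _)
    refine ⟨_, min (δ / 4) (γ₁ / 32), Nat.lt_of_succ_le (le_max_right _ _),
      lt_min (by linarith) (by linarith), ?_, hC.mono ?_⟩
    · linarith [min_le_right (δ / 4) (γ₁ / 32)]
    · linarith [min_le_left (δ / 4) (γ₁ / 32)]
  have step' : ∀ (K : ℕ) {δ : ℝ}, 0 < δ → ∀ L₀, ∃ L η, L₀ < L ∧ 0 < η ∧ 32 * η ≤ γ₂ ∧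
      Controls h₂ h₁ g.symm L (4 * η) K δ := by
    intro K δ hδ L₀
    obtain ⟨L₁, h⟩ := exists_controls (h₁ := h₂) (h₂ := h₁) g.symm.continuous hE' K hδ
    obtain ⟨η, hη, hC⟩ := h (max L₁ (L₀ + 1)) (le_max_left _ _)
    refine ⟨_, min (η / 4) (γ₂ / 32), Nat.lt_of_succ_le (le_max_right _ _),
      lt_min (by linarith) (by linarith), ?_, hC.mono ?_⟩
    · linarith [min_le_right (η / 4) (γ₂ / 32)]
    · linarith [min_le_left (η / 4) (γ₂ / 32)]
  -- levels `K, L` and tolerances `δ, η` in the two inverse limits, chosen alternately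
  obtain ⟨f, hP, hR⟩ := exists_sequence (α := (ℕ × ℝ) × ℕ × ℝ)
    (P := fun a => 0 < a.1.2 ∧ 32 * a.1.2 ≤ γ₁ ∧ 0 < a.2.2 ∧ 32 * a.2.2 ≤ γ₂ ∧
      Controls h₂ h₁ g.symm a.2.1 (4 * a.2.2) a.1.1 a.1.2)
    (R := fun a b => a.1.1 < b.1.1 ∧ a.2.1 < b.2.1 ∧
      Controls h₁ h₂ g b.1.1 (4 * b.1.2) a.2.1 a.2.2)
    (by
      obtain ⟨L, η, -, hη, hη', hC⟩ := step' 0 (δ := γ₁ / 32) (by linarith) 0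
      exact ⟨((0, γ₁ / 32), L, η), by dsimp only; linarith, by dsimp only; linarith, hη, hη', hC⟩)
    (by
      rintro ⟨⟨K₀, δ₀⟩, L₀, η₀⟩ ⟨-, -, hη₀, -, -⟩
      obtain ⟨K, δ, hK, hδ, hδ', hC⟩ := step L₀ hη₀ K₀
      obtain ⟨L, η, hL, hη, hη', hC'⟩ := step' K hδ L₀
      exact ⟨((K, δ), L, η), ⟨hδ, hδ', hη, hη', hC'⟩, hK, hL, hC⟩)
  choose V hV using fun i => (hP i).2.2.2.2.exists_follows (by linarith [(hP i).2.2.1]) (hP i).1 hγ₁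
    (by linarith [(hP i).2.1, (hP i).1]) g.symm.continuous g.symm.injective (fun z hz => by
      have := hE _ hz
      rwa [g.apply_symm_apply] at this)
  choose W hW using fun i => (hR i).2.2.exists_follows (by linarith [(hP (i + 1)).1])
    (hP i).2.2.1 hγ₂
    (by linarith [(hP i).2.2.2.1, (hP i).2.2.1]) g.continuous g.injective (fun z hz => by
      have := hE' _ hz
      rwa [g.symm_apply_apply] at this)
  have hVW : ∀ i a, wordMap (V i) (W i a) =
      (tentSubstitution s₁ h₁).ext^[(f (i + 1)).1.1 - (f i).1.1] [(a, true)] := fun i =>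
    wordMap_eq_iterate g.continuous g.symm.continuous g.symm_apply_apply (hR i).1.le
      (hP i).2.2.1.le (hP i).1.le (hP i).2.2.2.2 hγ₁ (hP i).2.1 hγ₁0 (hW i) (hV i)
  have hWV : ∀ i b, wordMap (W i) (V (i + 1) b) =
      (tentSubstitution s₂ h₂).ext^[(f (i + 1)).2.1 - (f i).2.1] [(b, true)] := fun i =>
    wordMap_eq_iterate g.symm.continuous g.continuous g.apply_symm_apply (hR i).2.1.le
      (hP (i + 1)).1.le (hP i).2.2.1.le (hR i).2.2 hγ₂ (hP i).2.2.2.1 hγ₂0 (hV (i + 1)) (hW i)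
  have hWne : ∀ i a, W i a ≠ [] := fun i a h => by
    have h1 := hVW i a
    rw [h] at h1
    exact (traverses_iterate_tentMap h₁ a _).ne_nil (partition_lt _ a) h1.symm
  have hVne : ∀ i b, V (i + 1) b ≠ [] := fun i b h => by
    have h1 := hWV i b
    rw [h] at h1
    exact (traverses_iterate_tentMap h₂ b _).ne_nil (partition_lt _ b) h1.symm
  refine ⟨fun i => (f (i + 2)).1.1 - (f (i + 1)).1.1, fun i => (f (i + 2)).2.1 - (f (i + 1)).2.1,
    fun i => .ofWords (V (i + 1)) (hVne i), fun i => .ofWords (W (i + 1)) (hWne (i + 1)),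
    fun i => Nat.sub_pos_of_lt (hR (i + 1)).1, fun i => Nat.sub_pos_of_lt (hR (i + 1)).2.1,
    fun i => Substitution.ext_comp_ext_eq fun a => hVW (i + 1) a,
    fun i => Substitution.ext_comp_ext_eq fun b => hWV (i + 1) b⟩

end Homeomorphic

theorem theorem2p7 (s₁ s₂ : ℝ) (h₁ : s₁ ∈ periodicTentParams) (h₂ : s₂ ∈ periodicTentParams) :
    Nonempty (tentInverseLimit s₁ ≃ₜ tentInverseLimit s₂) ↔
      WeaklyEquivalent (tentSubstitution s₁ h₁) (tentSubstitution s₂ h₂) :=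
  ⟨fun ⟨g⟩ => weaklyEquivalent_of_homeomorph g, nonempty_homeomorph_of_weaklyEquivalent⟩
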